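/- Let $V\in C^\infty(\mathbb R;\mathbb R)$ be of the form $V=V_{\rm per}+V_{\rm def}$ with $V_{\rm per}(x+1)=V_{\rm per}(x)$ for all $x$ and $V_{\rm def}(x)=0$ for $|x|>\rho$, where $\rho\ge 0$. Suppose that $H=-\partial_x^2+V$ has a bound state $0\neq\Phi\in L^2(\mathbb R)$, $H\Phi=E\Phi$, with $E>0$. For $M>0$ let $H_{\rm trunc}=-\partial_x^2+V\mathbf 1_{[-M,M]}$ on $L^2(\mathbb R)$. Throughout, $\sqrt{\cdot}$ is the principal branch on $\mathbb C\setminus(-\infty,0]$. A resonance of $H_{\rm trunc}$ is a number $z$ such that $\sqrt z$ is a pole of the meromorphic continuation in $\xi$, from the upper half-plane to $\mathbb C$, of the resolvent $(H_{\rm trunc}-\xi^2)^{-1}$ (as operators $L^2_{\rm comp}\to L^2_{\rm loc}$). A resonant state at $z$ is a nonzero $H^2_{\rm loc}$ solution of $(H_{\rm trunc}-z)\psi=0$ that equals a constant multiple of $e^{i\sqrt z x}$ near $+\infty$ and of $e^{-i\sqrt z x}$ near $-\infty$. For $\zeta=(w,z)\in\mathbb C^2$ let $u_\zeta,v_\zeta$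 be the solutions of $-y''+Vy=zy$ with initial data $$u_\zeta(0)=1,\quad u_\zeta'(0)=w,\quad v_\zeta(0)=\tfrac{-w}{1+w^2},\quad v_\zeta'(0)=\tfrac{1}{1+w^2}\qquad\text{if }\Phi(0)\ne0,$$ $$u_\zeta(0)=-w,\quad u_\zeta'(0)=1,\quad v_\zeta(0)=\tfrac{-1}{1+w^2},\quad v_\zeta'(0)=\tfrac{-w}{1+w^2}\qquad\text{if }\Phi(0)=0.$$ Put $w_0=\Phi'(0)/\Phi(0)$ if $\Phi(0)\neq0$ and $w_0=0$ otherwise, $\eta=(w_0,E)$, and write $u=u_\eta$, $v=v_\eta$, $$a_\pm=u'(\pm M)\mp i\sqrt E\,u(\pm M),\qquad b_\pm=v'(\pm M)\mp i\sqrt E\,v(\pm M),\qquad N=b_+b_-\int_{-M}^{M}u^2\,dy .$$ Then there is $\kappa>0$, the Floquet exponent of the bound state (that is, $\Phi(x+1)=\mu\,\Phi(x)$ for all $x\ge\rho$ with some $\mu\in\mathbb C$, $|\mu|=e^{-\kappa}$), and there are $M_0>\rho$ and $C$ such that for every $M\ge M_0$ one has $N\neq0$ and there is $\zeta^*=(w^*,z^*)\in\mathbb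 C^2$ (depending on $M$) with the following properties. (1) $\operatorname{Re}z^*>0$, $\operatorname{Im}z^*<0$, and $z^*$ is a resonance of $H_{\rm trunc}$. (2) Set $$r_z=z^*-\Big(E-\frac{b_+a_--b_-a_+}{N}\Big),\qquad r_w=w^*-\Big(w_0-\frac{b_-a_+\int_{-M}^0u^2\,dy+b_+a_-\int_0^Mu^2\,dy}{N}\Big).$$ Then $|r_z|\le CMe^{-4\kappa M}$ and $|r_w|\le CMe^{-4\kappa M}$. In particular, for every $0<k<\kappa$, both $r_z$ and $r_w$ are $O(e^{-4kM})$, uniformly for $M\ge M_0$. (3) The resonant states of $H_{\rm trunc}$ at $z^*$ are exactly the nonzero multiples of $$\Phi^*(x)=\begin{cases}u_{\zeta^*}(-M)\,e^{-i\sqrt{z^*}(x+M)},&x<-M,\\ u_{\zeta^*}(x),&|x|\le M,\\ u_{\zeta^*}(M)\,e^{i\sqrt{z^*}(x-M)},&x>M.\end{cases}$$ -/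

import Mathlib

open MeasureTheory Set
open scoped ContDiff

noncomputable section

/-- `-w'' + V w = h` on the line, in the Carathéodory sense: `w` is differentiable, and `w'` is the
indefinite integral of the locally integrable function `V w - h`. If `V` and `h` are continuous this
is the classical equation; if `V` is bounded and `w`, `h` are in `L²(ℝ)`, it says that
`w ∈ H²(ℝ)` and `(D_x² + V) w = h`. -/
def SchrodingerEq (V : ℝ → ℝ) (w h : ℝ → ℂ) : Prop :=
  Differentiable ℝ w ∧
  (∀ a b : ℝ, IntervalIntegrable (fun t => (V t : ℂ) * w t - h t) volume a b) ∧
  ∀ a b : ℝ, deriv w b - deriv w a = ∫ t in a..b, ((V t : ℂ) * w t - h t)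

/-- `Φ` is a bound state (eigenfunction in `L²(ℝ)`) of `D_x² + V` with eigenvalue `E`. -/
def IsBoundState (V : ℝ → ℝ) (E : ℝ) (Φ : ℝ → ℂ) : Prop :=
  Φ ≠ 0 ∧ MemLp Φ 2 volume ∧ SchrodingerEq V Φ (fun x => (E : ℂ) * Φ x)

/-- The potential truncated at `±M`. -/
def truncate (V : ℝ → ℝ) (M : ℝ) : ℝ → ℝ := fun x => if |x| ≤ M then V x else 0

/-- The graph of the operator `D_x² + V` on `L²(ℝ)`: `φ` is in the domain and `(D_x² + V) φ = h`. -/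
def SchrodingerGraph (V : ℝ → ℝ) (φ h : Lp ℂ 2 (volume : Measure ℝ)) : Prop :=
  ∃ w : ℝ → ℂ, (φ : ℝ → ℂ) =ᵐ[volume] w ∧ SchrodingerEq V w (h : ℝ → ℂ)

/-- `R = (H - z)⁻¹` for `H = D_x² + V` on `L²(ℝ)`: `R` is bounded, and `R h = φ` if and only if `φ`
is in the domain of `H` and `(H - z) φ = h`. -/
def IsResolvent (V : ℝ → ℝ) (z : ℂ)
    (R : Lp ℂ 2 (volume : Measure ℝ) →L[ℂ] Lp ℂ 2 (volume : Measure ℝ)) : Prop :=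
  ∀ φ h : Lp ℂ 2 (volume : Measure ℝ), R h = φ ↔ SchrodingerGraph V φ (h + z • φ)

/-- The element `f` of `L²(ℝ)` vanishes (almost everywhere) outside a bounded interval. -/
def HasBoundedSupport (f : Lp ℂ 2 (volume : Measure ℝ)) : Prop :=
  ∃ r : ℝ, ∀ᵐ x ∂(volume : Measure ℝ), r < |x| → f x = 0

/-- `F` is the meromorphic continuation to the whole `ξ`-plane of the matrix element
`⟨g, (H - ξ²)⁻¹ f⟩`, which is given in the upper half-plane wherever `ξ²` is in the resolvent set of
`H = D_x² + V`. -/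
def IsResolventContinuation (V : ℝ → ℝ) (f g : Lp ℂ 2 (volume : Measure ℝ)) (F : ℂ → ℂ) : Prop :=
  Meromorphic F ∧ ∀ ξ : ℂ, 0 < ξ.im → ∀ R, IsResolvent V (ξ ^ 2) R → F ξ = inner ℂ g (R f)

/-- Let `V` be bounded, measurable and compactly supported. `z` (off the half-line `(-∞, 0]`) is a
resonance of `H = D_x² + V`: the point `√z` (principal branch) is a pole of the resolvent
`(H - ξ²)⁻¹` continued meromorphically from the upper half-plane as a family of operators from
`L²_comp` to `L²_loc`. Poles of this family are the poles of its matrix elements between compactly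
supported elements of `L²(ℝ)`. -/
def IsResonance (V : ℝ → ℝ) (z : ℂ) : Prop :=
  ∃ f g : Lp ℂ 2 (volume : Measure ℝ), HasBoundedSupport f ∧ HasBoundedSupport g ∧
    ∃ F : ℂ → ℂ, IsResolventContinuation V f g F ∧ meromorphicOrderAt F (Complex.sqrt z) < 0

/-- `ψ` is a resonant state of `D_x² + V` (compactly supported `V`) at `z`: a nonzero solution of
`(D_x² + V - z) ψ = 0` which is outgoing, that is, a multiple of `exp (± i √z x)` near `±∞`. -/
def IsResonantState (V : ℝ → ℝ) (z : ℂ) (ψ : ℝ → ℂ) : Prop :=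
  ψ ≠ 0 ∧ SchrodingerEq V ψ (fun x => z * ψ x) ∧
  ∃ (r : ℝ) (a b : ℂ),
    (∀ x : ℝ, r < x → ψ x = a * Complex.exp (Complex.I * Complex.sqrt z * x)) ∧
    (∀ x : ℝ, x < -r → ψ x = b * Complex.exp (-(Complex.I * Complex.sqrt z * x)))

/-- The (unique, for continuous `V`) solution of
`(D_x² + V - z) y = 0`, `y 0 = y₀`, `y' 0 = y₁`. -/
def schrodingerSol (V : ℝ → ℝ) (z y₀ y₁ : ℂ) : ℝ → ℂ :=
  Classical.epsilon fun y : ℝ → ℂ =>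
    SchrodingerEq V y (fun x => z * y x) ∧ y 0 = y₀ ∧ deriv y 0 = y₁

open Classical in
/-- The solution `u_ζ`, `ζ = (w, z)`, relative to the bound state `Φ`. -/
def uSol (V : ℝ → ℝ) (Φ : ℝ → ℂ) (w z : ℂ) : ℝ → ℂ :=
  if Φ 0 = 0 then schrodingerSol V z (-w) 1 else schrodingerSol V z 1 w

open Classical in
/-- The solution `v_ζ`, `ζ = (w, z)`, relative to the bound state `Φ`. -/
def vSol (V : ℝ → ℝ) (Φ : ℝ → ℂ) (w z : ℂ) : ℝ → ℂ :=
  if Φ 0 = 0 then schrodingerSol V z (-1 / (1 + w ^ 2)) (-w / (1 + w ^ 2))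
  else schrodingerSol V z (-w / (1 + w ^ 2)) (1 / (1 + w ^ 2))

open Classical in
/-- The first component of `η = (w₀, E)`; it is `Φ' 0` if `Φ` is normalised by `Φ 0 = 1`. -/
def wZero (Φ : ℝ → ℂ) : ℂ := if Φ 0 = 0 then 0 else deriv Φ 0 / Φ 0

/-- `y' M - i √E y M` -/
def bPlus (E M : ℝ) (y : ℝ → ℂ) : ℂ := deriv y M - Complex.I * (Real.sqrt E : ℂ) * y M

/-- `y' (-M) + i √E y (-M)` -/
def bMinus (E M : ℝ) (y : ℝ → ℂ) : ℂ := deriv y (-M) + Complex.I * (Real.sqrt E : ℂ) * y (-M)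

/-- The common denominator of the correction terms of `z*` and `w*`. -/
def corrDenom (E M : ℝ) (u v : ℝ → ℂ) : ℂ :=
  (∫ y in (-M)..M, u y ^ 2) * bPlus E M v * bMinus E M v

/-- The explicit approximation of the resonance `z*`. -/
def zApprox (E M : ℝ) (u v : ℝ → ℂ) : ℂ :=
  E - (bPlus E M v * bMinus E M u - bMinus E M v * bPlus E M u) / corrDenom E M u v

/-- The explicit approximation of the parameter `w*`. -/
def wApprox (w₀ : ℂ) (E M : ℝ) (u v : ℝ → ℂ) : ℂ :=
  w₀ - ((∫ y in (-M)..0, u y ^ 2) * bMinus E M v * bPlus E M u +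
      (∫ y in (0 : ℝ)..M, u y ^ 2) * bPlus E M v * bMinus E M u) / corrDenom E M u v

/-- `u` on `[-M, M]`, extended by outgoing exponentials of frequency `√z`. -/
def outgoingExtension (M : ℝ) (z : ℂ) (u : ℝ → ℂ) : ℝ → ℂ := fun x =>
  if x < -M then u (-M) * Complex.exp (-(Complex.I * Complex.sqrt z * (x + M)))
  else if x ≤ M then u x
  else u M * Complex.exp (Complex.I * Complex.sqrt z * (x - M))

end

/-!
The bound state decays like `exp (-κ|x|)` at both ends of the line, so the solution `u` at energy
`E` misses the outgoing boundary condition at `±M` by `O(exp (-κM))` only, while `v` grows like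
`exp (κM)`. Propagating by variation of constants, perturbing `u` to `u + τ v` and `E` to `E - l`
changes the outgoing trace at either end by a multiple `b` of `τ` minus `l` times an integral of
`u²`, up to relative errors of size `M exp (-2κM)`. Eliminating `τ` from the two outgoing
conditions leaves one almost affine equation for `l`, solved by the contraction principle, whose
explicit affine part gives the approximations of `z*` and `w*`. Flux conservation for the resulting
outgoing solution forces `Im √z* < 0`. Finally, the matrix elements of the resolvent between
indicator functions supported outside `[-M, M]` are explicit: their denominator is the trace at `M`
of the solution outgoing at `-∞`, an entire function of `ξ` which vanishes at `√z*`.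
-/

noncomputable section

section LinearODE

/-- The Bielecki weight `exp (2 |∫₀ˣ m|)`: conjugated by it, the Volterra operator of a coefficient
of norm at most `m` becomes a contraction on all of `ℝ`. -/
def bieleckiWeight (m : ℝ → ℝ) (x : ℝ) : ℝ := Real.exp (2 * |∫ t in (0 : ℝ)..x, m t|)

variable {m : ℝ → ℝ}

theorem bieleckiWeight_pos (x : ℝ) : 0 < bieleckiWeight m x := Real.exp_pos _

theorem one_le_bieleckiWeight (x : ℝ) : 1 ≤ bieleckiWeight m x :=
  Real.one_le_exp (by positivity)

theorem continuous_bieleckiWeight (hm : Continuous m) : Continuous (bieleckiWeight m) :=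
  Real.continuous_exp.comp (continuous_const.mul (intervalIntegral.continuous_primitive
    (fun a b => hm.intervalIntegrable a b) 0).abs)

theorem abs_integral_mul_bieleckiWeight_le (hm : Continuous m) (hm0 : ∀ x, 0 ≤ m x) (x : ℝ) :
    |∫ t in (0 : ℝ)..x, m t * bieleckiWeight m t| ≤ bieleckiWeight m x / 2 := by
  set α : ℝ → ℝ := fun x => ∫ t in (0 : ℝ)..x, m t with hαdef
  have hα (t : ℝ) : HasDerivAt α (m t) t := (hm.integral_hasStrictDerivAt 0 t).hasDerivAt
  obtain ⟨c, hc, habs⟩ : ∃ c : ℝ, c * c = 1 ∧ ∀ t ∈ uIcc 0 x, |α t| = c * α t := by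
    rcases le_total 0 x with hx | hx
    · refine ⟨1, by norm_num, fun t ht => ?_⟩
      rw [uIcc_of_le hx] at ht
      rw [one_mul, abs_of_nonneg (intervalIntegral.integral_nonneg ht.1 fun s _ => hm0 s)]
    · refine ⟨-1, by norm_num, fun t ht => ?_⟩
      rw [uIcc_of_ge hx] at ht
      simp only [hαdef]
      rw [intervalIntegral.integral_symm, abs_neg,
        abs_of_nonneg (intervalIntegral.integral_nonneg ht.2 fun s _ => hm0 s)]
      ring
  have hder (t : ℝ) : HasDerivAt (fun t => c * Real.exp (2 * (c * α t)) / 2)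
      (m t * Real.exp (2 * (c * α t))) t :=
    ((((((hα t).const_mul c).const_mul 2).exp).const_mul c).div_const 2).congr_deriv
      (by linear_combination m t * Real.exp (2 * (c * α t)) * hc)
  have hcont : Continuous fun t => m t * Real.exp (2 * (c * α t)) := by
    have : Continuous α := continuous_iff_continuousAt.2 fun t => (hα t).continuousAt
    fun_prop
  have hint : ∫ t in (0 : ℝ)..x, m t * bieleckiWeight m t = c * ((bieleckiWeight m x - 1) / 2) := by
    rw [intervalIntegral.integral_congr (g := fun t => m t * Real.exp (2 * (c * α t)))
      fun t ht => by
        beta_reduce; rw [← habs t ht]; rfl,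
      intervalIntegral.integral_eq_sub_of_hasDerivAt (fun t _ => hder t)
        (hcont.intervalIntegrable _ _), ← habs x right_mem_uIcc]
    simp only [hαdef, bieleckiWeight, intervalIntegral.integral_same, mul_zero, Real.exp_zero]
    ring
  have habs_c : |c| = 1 := (abs_eq zero_le_one).2 (mul_self_eq_one_iff.1 hc)
  rw [hint, abs_mul, habs_c, one_mul, abs_of_nonneg] <;> linarith [one_le_bieleckiWeight (m := m) x]

variable {𝕜 E : Type*} [NontriviallyNormedField 𝕜] [NormedAddCommGroup E] [NormedSpace ℝ E]
  [NormedSpace 𝕜 E]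

theorem norm_integral_smul_bieleckiWeight_le {A : ℝ → E →L[𝕜] E} (hm : Continuous m)
    (hAm : ∀ x, ‖A x‖ ≤ m x) {f : ℝ → E} {B : ℝ} (hf : ∀ x, ‖f x‖ ≤ B) (x : ℝ) :
    ‖∫ t in (0 : ℝ)..x, A t (bieleckiWeight m t • f t)‖ ≤ bieleckiWeight m x * (1 / 2 * B) := by
  have hm0 (t : ℝ) : 0 ≤ m t := (norm_nonneg _).trans (hAm t)
  have hB : 0 ≤ B := (norm_nonneg _).trans (hf 0)
  have hpoint (t : ℝ) : ‖A t (bieleckiWeight m t • f t)‖ ≤ m t * bieleckiWeight m t * B := by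
    calc ‖A t (bieleckiWeight m t • f t)‖ ≤ ‖A t‖ * ‖bieleckiWeight m t • f t‖ := (A t).le_opNorm _
      _ = ‖A t‖ * (bieleckiWeight m t * ‖f t‖) := by
        rw [norm_smul, Real.norm_of_nonneg (bieleckiWeight_pos t).le]
      _ ≤ m t * (bieleckiWeight m t * B) := by
        gcongr
        exacts [mul_nonneg (bieleckiWeight_pos t).le (norm_nonneg _), hm0 t, hAm t,
          (bieleckiWeight_pos t).le, hf t]
      _ = m t * bieleckiWeight m t * B := by ring
  have hint : IntervalIntegrable (fun t => m t * bieleckiWeight m t * B) volume 0 x :=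
    ((hm.mul (continuous_bieleckiWeight hm)).mul continuous_const).intervalIntegrable _ _
  calc ‖∫ t in (0 : ℝ)..x, A t (bieleckiWeight m t • f t)‖
      ≤ |∫ t in (0 : ℝ)..x, m t * bieleckiWeight m t * B| :=
        intervalIntegral.norm_integral_le_abs_of_norm_le (.of_forall hpoint) hint
    _ = |∫ t in (0 : ℝ)..x, m t * bieleckiWeight m t| * B := by
        rw [intervalIntegral.integral_mul_const, abs_mul, abs_of_nonneg hB]
    _ ≤ bieleckiWeight m x / 2 * B :=
        mul_le_mul_of_nonneg_right (abs_integral_mul_bieleckiWeight_le hm hm0 x) hB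
    _ = bieleckiWeight m x * (1 / 2 * B) := by ring

open scoped BoundedContinuousFunction

theorem exists_weighted_volterra [SMulCommClass ℝ 𝕜 E] {A : ℝ → E →L[𝕜] E} (hm : Continuous m)
    (hA : Continuous A) (hAm : ∀ x, ‖A x‖ ≤ m x) :
    ∃ K : (ℝ →ᵇ E) →L[𝕜] (ℝ →ᵇ E), ‖K‖ ≤ 1 / 2 ∧ ∀ f x,
      bieleckiWeight m x • K f x = ∫ t in (0 : ℝ)..x, A t (bieleckiWeight m t • f t) := by
  have hω := continuous_bieleckiWeight hm
  have hintegrand (f : ℝ →ᵇ E) : Continuous fun t => A t (bieleckiWeight m t • f t) :=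
    hA.clm_apply (hω.smul f.continuous)
  have hcont (f : ℝ →ᵇ E) : Continuous fun x =>
      (bieleckiWeight m x)⁻¹ • ∫ t in (0 : ℝ)..x, A t (bieleckiWeight m t • f t) :=
    (hω.inv₀ fun x => (bieleckiWeight_pos x).ne').smul (intervalIntegral.continuous_primitive
      (fun a b => (hintegrand f).intervalIntegrable a b) 0)
  have hbound (f : ℝ →ᵇ E) (x : ℝ) :
      ‖(bieleckiWeight m x)⁻¹ • ∫ t in (0 : ℝ)..x, A t (bieleckiWeight m t • f t)‖
        ≤ 1 / 2 * ‖f‖ := by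
    rw [norm_smul, norm_inv, Real.norm_of_nonneg (bieleckiWeight_pos x).le,
      inv_mul_le_iff₀ (bieleckiWeight_pos x)]
    exact norm_integral_smul_bieleckiWeight_le hm hAm f.norm_coe_le_norm x
  refine ⟨LinearMap.mkContinuous
    { toFun f := .ofNormedAddCommGroup _ (hcont f) _ (hbound f)
      map_add' f g := ?_
      map_smul' c f := ?_ } (1 / 2) fun f => ?_, ?_, fun f x => ?_⟩
  · ext x
    simp [smul_add, intervalIntegral.integral_add ((hintegrand f).intervalIntegrable _ _)
      ((hintegrand g).intervalIntegrable _ _)]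
  · ext x
    simp [smul_comm _ c, intervalIntegral.integral_smul]
  · exact BoundedContinuousFunction.norm_ofNormedAddCommGroup_le _ (by positivity) (hbound f)
  · exact LinearMap.mkContinuous_norm_le _ (by norm_num) _
  · simp [smul_inv_smul₀ (bieleckiWeight_pos x).ne']

theorem hasDerivAt_of_eq_add_integral [CompleteSpace E] {A : ℝ → E →L[𝕜] E} (hA : Continuous A)
    {Y : ℝ → E} (hY : Continuous Y) {v : E} (h : ∀ x, Y x = v + ∫ t in (0 : ℝ)..x, A t (Y t))
    (x : ℝ) : HasDerivAt Y (A x (Y x)) x := by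
  refine HasDerivAt.congr_of_eventuallyEq ?_ (.of_forall h)
  exact ((hA.clm_apply hY).integral_hasStrictDerivAt 0 x).hasDerivAt.const_add v

theorem exists_bieleckiWeight_smul_eq (hm : Continuous m) (v : E) :
    ∃ g : ℝ →ᵇ E, ∀ x, bieleckiWeight m x • g x = v := by
  refine ⟨.ofNormedAddCommGroup (fun x => (bieleckiWeight m x)⁻¹ • v)
    (((continuous_bieleckiWeight hm).inv₀ fun x => (bieleckiWeight_pos x).ne').smul
      continuous_const) ‖v‖ fun x => ?_, fun x => smul_inv_smul₀ (bieleckiWeight_pos x).ne' v⟩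
  rw [norm_smul, norm_inv, Real.norm_of_nonneg (bieleckiWeight_pos x).le,
    inv_mul_le_iff₀ (bieleckiWeight_pos x)]
  exact le_mul_of_one_le_left (norm_nonneg v) (one_le_bieleckiWeight x)

/-- `1 - K`, with `K` the weighted Volterra operator, is invertible and affine in the parameter, so
the solution inherits the analyticity of `Ring.inverse`. -/
theorem exists_linearODE_solution_differentiableAt [SMulCommClass ℝ 𝕜 E] [CompleteSpace E]
    {A : ℝ → E →L[𝕜] E} (hA : Continuous A) (B : E →L[𝕜] E) (v : E) (z₀ : 𝕜) :
    ∃ Y : 𝕜 → ℝ → E, (∀ᶠ z in nhds z₀, Y z 0 = v ∧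
        ∀ x, HasDerivAt (Y z) ((A x + (z - z₀) • B) (Y z x)) x) ∧
      ∀ x, DifferentiableAt 𝕜 (fun z => Y z x) z₀ := by
  set m : ℝ → ℝ := fun x => ‖A x‖ + ‖B‖
  have hm : Continuous m := hA.norm.add continuous_const
  have hω := continuous_bieleckiWeight hm
  obtain ⟨K, hK_norm, hK⟩ := exists_weighted_volterra hm hA fun x =>
    le_add_of_nonneg_right (norm_nonneg B)
  obtain ⟨L, -, hL⟩ := exists_weighted_volterra (A := fun _ => B) hm continuous_const fun x =>
    le_add_of_nonneg_left (norm_nonneg (A x))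
  obtain ⟨g, hg⟩ := exists_bieleckiWeight_smul_eq hm v
  let T : 𝕜 → (ℝ →ᵇ E) →L[𝕜] (ℝ →ᵇ E) := fun z => 1 - (K + (z - z₀) • L)
  have hT : Differentiable 𝕜 T := by fun_prop
  have hT₀ : IsUnit (T z₀) := by
    simp only [T, sub_self, zero_smul, add_zero]
    exact isUnit_one_sub_of_norm_lt_one (hK_norm.trans_lt (by norm_num))
  refine ⟨fun z x => bieleckiWeight m x • Ring.inverse (T z) g x, ?_, fun x => ?_⟩
  · filter_upwards [hT.continuous.continuousAt.eventually (Units.isOpen.mem_nhds hT₀)] with z hz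
    set f : ℝ →ᵇ E := Ring.inverse (T z) g
    have hTf : T z f = g := DFunLike.congr_fun (Ring.mul_inverse_cancel _ hz) g
    have hcontY : Continuous fun x => bieleckiWeight m x • f x := hω.smul f.continuous
    have hvolterra (x : ℝ) : bieleckiWeight m x • f x
        = v + ∫ t in (0 : ℝ)..x, (A t + (z - z₀) • B) (bieleckiWeight m t • f t) := by
      have hf : f x = g x + (K f x + (z - z₀) • L f x) := by
        rw [← hTf]; simp [T]
      have hint_A : IntervalIntegrable (fun t => A t (bieleckiWeight m t • f t)) volume 0 x :=
        (hA.clm_apply hcontY).intervalIntegrable _ _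
      have hint_B : IntervalIntegrable (fun t => (z - z₀) • B (bieleckiWeight m t • f t)) volume
          0 x :=
        ((B.continuous.comp hcontY).const_smul _).intervalIntegrable _ _
      rw [hf, smul_add, smul_add, smul_comm _ (z - z₀), hK, hL, hg,
        ← intervalIntegral.integral_smul, ← intervalIntegral.integral_add hint_A hint_B]
      rfl
    exact ⟨by simpa using hvolterra 0,
      hasDerivAt_of_eq_add_integral (hA.add continuous_const) hcontY hvolterra⟩
  · have : SMulCommClass 𝕜 ℝ E := .symm ℝ 𝕜 E
    have hinv : DifferentiableAt 𝕜 (fun z => Ring.inverse (T z)) z₀ :=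
      (differentiableAt_inverse hT₀).comp z₀ hT.differentiableAt
    exact (((BoundedContinuousFunction.evalCLM 𝕜 x).differentiableAt.comp z₀
      (hinv.clm_apply (differentiableAt_const g))).const_smul (bieleckiWeight m x))

end LinearODE

section SecondOrderODE

/-- `y'' = q y` on `s`, written as a first-order system: `y'` is the derivative of `y` and `q y`
that of `y'`, both within `s`. -/
def IsSolOn (q : ℝ → ℂ) (y y' : ℝ → ℂ) (s : Set ℝ) : Prop :=
  ∀ x ∈ s, HasDerivWithinAt y (y' x) s x ∧ HasDerivWithinAt y' (q x * y x) s x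

/-- The coefficient of the equation `y'' = (V - z) y` at the spectral parameter `z`. -/
def shiftedPotential (V : ℝ → ℝ) (z : ℂ) : ℝ → ℂ := fun x => (V x : ℂ) - z

/-- The Wronskian of the pairs `(y, y')` and `(v, v')`. -/
def wronskian (y y' v v' : ℝ → ℂ) (x : ℝ) : ℂ := y x * v' x - y' x * v x

variable {V : ℝ → ℝ} {q p y y' v v' w w' : ℝ → ℂ} {s t : Set ℝ} {a b c x : ℝ} {z z₁ z₂ : ℂ}

theorem continuous_shiftedPotential (hV : Continuous V) (z : ℂ) :
    Continuous (shiftedPotential V z) := by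
  unfold shiftedPotential; fun_prop

namespace IsSolOn

theorem mono (h : IsSolOn q y y' s) (hts : t ⊆ s) : IsSolOn q y y' t :=
  fun x hx => ⟨(h x (hts hx)).1.mono hts, (h x (hts hx)).2.mono hts⟩

theorem congr_coeff (h : IsSolOn q y y' s) (hqp : ∀ x ∈ s, q x = p x) : IsSolOn p y y' s :=
  fun x hx => ⟨(h x hx).1, hqp x hx ▸ (h x hx).2⟩

theorem linear_comb (hy : IsSolOn q y y' s) (hv : IsSolOn q v v' s) (a b : ℂ) :
    IsSolOn q (fun x => a * y x + b * v x) (fun x => a * y' x + b * v' x) s := fun x hx =>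
  ⟨((hy x hx).1.const_mul a).add ((hv x hx).1.const_mul b),
    (((hy x hx).2.const_mul a).add ((hv x hx).2.const_mul b)).congr_deriv (by ring)⟩

theorem const_mul (hy : IsSolOn q y y' s) (a : ℂ) :
    IsSolOn q (fun x => a * y x) (fun x => a * y' x) s := fun x hx =>
  ⟨(hy x hx).1.const_mul a, ((hy x hx).2.const_mul a).congr_deriv (by ring)⟩

theorem conj (hy : IsSolOn (shiftedPotential V z) y y' s) :
    IsSolOn (shiftedPotential V (starRingEnd ℂ z)) (fun x => starRingEnd ℂ (y x))
      (fun x => starRingEnd ℂ (y' x)) s := fun x hx =>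
  ⟨(hy x hx).1.star, (hy x hx).2.star.congr_deriv (by simp [shiftedPotential])⟩

theorem continuousOn (h : IsSolOn q y y' s) : ContinuousOn y s :=
  fun x hx => (h x hx).1.continuousWithinAt

theorem continuousOn_deriv (h : IsSolOn q y y' s) : ContinuousOn y' s :=
  fun x hx => (h x hx).2.continuousWithinAt

theorem continuous (h : IsSolOn q y y' univ) : Continuous y :=
  continuousOn_univ.1 h.continuousOn

theorem continuous_deriv (h : IsSolOn q y y' univ) : Continuous y' :=
  continuousOn_univ.1 h.continuousOn_deriv

theorem hasDerivAt (h : IsSolOn q y y' univ) (x : ℝ) : HasDerivAt y (y' x) x :=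
  hasDerivWithinAt_univ.1 (h x (mem_univ x)).1

theorem hasDerivAt_deriv (h : IsSolOn q y y' univ) (x : ℝ) : HasDerivAt y' (q x * y x) x :=
  hasDerivWithinAt_univ.1 (h x (mem_univ x)).2

theorem deriv_eq (h : IsSolOn q y y' univ) : deriv y = y' :=
  funext fun x => (h.hasDerivAt x).deriv

theorem comp_add_const (h : IsSolOn q y y' univ) (c : ℝ) :
    IsSolOn (fun x => q (x + c)) (fun x => y (x + c)) (fun x => y' (x + c)) univ := fun x _ =>
  ⟨((h.hasDerivAt (x + c)).comp_add_const x c).hasDerivWithinAt,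
    ((h.hasDerivAt_deriv (x + c)).comp_add_const x c).hasDerivWithinAt⟩

theorem comp_neg (h : IsSolOn q y y' univ) :
    IsSolOn (fun x => q (-x)) (fun x => y (-x)) (fun x => -y' (-x)) univ := fun x _ =>
  ⟨(((h.hasDerivAt (-x)).scomp x (hasDerivAt_neg x)).congr_deriv (by simp)).hasDerivWithinAt,
    (((h.hasDerivAt_deriv (-x)).scomp x (hasDerivAt_neg x)).neg.congr_deriv
      (by simp)).hasDerivWithinAt⟩

end IsSolOn

theorem exists_isSolOn_differentiableAt (hq : Continuous q) (a b : ℂ) :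
    ∃ y y' : ℂ → ℝ → ℂ, (∀ᶠ c in nhds 0,
        IsSolOn (fun x => q x + c) (y c) (y' c) univ ∧ y c 0 = a ∧ y' c 0 = b) ∧
      ∀ x, DifferentiableAt ℂ (fun c => y c x) 0 ∧ DifferentiableAt ℂ (fun c => y' c x) 0 := by
  let shift : ℂ × ℂ →L[ℂ] ℂ × ℂ := (ContinuousLinearMap.snd ℂ ℂ ℂ).prod 0
  let mass : ℂ × ℂ →L[ℂ] ℂ × ℂ := ContinuousLinearMap.prod 0 (ContinuousLinearMap.fst ℂ ℂ ℂ)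
  obtain ⟨Y, hY, hYdiff⟩ := exists_linearODE_solution_differentiableAt
    (A := fun x => shift + q x • mass) (by fun_prop) mass (a, b) 0
  refine ⟨fun c x => (Y c x).1, fun c x => (Y c x).2, ?_, fun x => ⟨(hYdiff x).fst, (hYdiff x).snd⟩⟩
  filter_upwards [hY] with c ⟨hY0, hYder⟩
  refine ⟨fun x _ => ⟨?_, ?_⟩, by simp [hY0], by simp [hY0]⟩
  · exact (((ContinuousLinearMap.fst ℝ ℂ ℂ).hasFDerivAt.comp_hasDerivAt x
      (hYder x)).congr_deriv (by simp [shift, mass])).hasDerivWithinAt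
  · exact (((ContinuousLinearMap.snd ℝ ℂ ℂ).hasFDerivAt.comp_hasDerivAt x
      (hYder x)).congr_deriv (by simp [shift, mass, add_mul])).hasDerivWithinAt

theorem exists_isSolOn (hq : Continuous q) (a b : ℂ) :
    ∃ y y' : ℝ → ℂ, IsSolOn q y y' univ ∧ y 0 = a ∧ y' 0 = b := by
  obtain ⟨y, y', h, -⟩ := exists_isSolOn_differentiableAt hq a b
  exact ⟨y 0, y' 0, by simpa only [add_zero] using h.self_of_nhds⟩

theorem hasDerivWithinAt_wronskian (hy : IsSolOn q y y' s) (hv : IsSolOn p v v' s) (hx : x ∈ s) :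
    HasDerivWithinAt (wronskian y y' v v') ((p x - q x) * (y x * v x)) s x :=
  (((hy x hx).1.mul (hv x hx).2).sub ((hy x hx).2.mul (hv x hx).1)).congr_deriv (by ring)

theorem IsSolOn.continuous_wronskian (hy : IsSolOn q y y' univ) (hv : IsSolOn p v v' univ) :
    Continuous (wronskian y y' v v') :=
  (hy.continuous.mul hv.continuous_deriv).sub (hy.continuous_deriv.mul hv.continuous)

theorem integral_eq_sub_of_hasDerivWithinAt {E : Type*} [NormedAddCommGroup E] [NormedSpace ℝ E]
    [CompleteSpace E] {f f' : ℝ → E} (hs : OrdConnected s)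
    (hf : ∀ x ∈ s, HasDerivWithinAt f (f' x) s x) (hf' : ContinuousOn f' s)
    (ha : a ∈ s) (hb : b ∈ s) : ∫ x in a..b, f' x = f b - f a := by
  have hsub : uIcc a b ⊆ s := hs.uIcc_subset ha hb
  refine intervalIntegral.integral_eq_sub_of_hasDeriv_right
    (fun x hx => ((hf x (hsub hx)).continuousWithinAt.mono hsub)) (fun x hx => ?_)
    ((hf'.mono hsub).intervalIntegrable)
  have hmem : s ∈ nhds x := Filter.mem_of_superset (Icc_mem_nhds hx.1 hx.2) hsub
  exact ((hf x (mem_of_mem_nhds hmem)).hasDerivAt hmem).hasDerivWithinAt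

theorem wronskian_sub_eq_integral (hs : OrdConnected s)
    (hy : IsSolOn (shiftedPotential V z₁) y y' s) (hv : IsSolOn (shiftedPotential V z₂) v v' s)
    (ha : a ∈ s) (hb : b ∈ s) :
    wronskian y y' v v' b - wronskian y y' v v' a = (z₁ - z₂) * ∫ x in a..b, y x * v x := by
  rw [← intervalIntegral.integral_const_mul]
  refine (integral_eq_sub_of_hasDerivWithinAt hs (fun x hx => ?_)
    (continuousOn_const.mul (hy.continuousOn.mul hv.continuousOn)) ha hb).symm
  exact (hasDerivWithinAt_wronskian hy hv hx).congr_deriv (by simp [shiftedPotential])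

theorem wronskian_const (hs : OrdConnected s) (hy : IsSolOn q y y' s) (hv : IsSolOn q v v' s)
    (ha : a ∈ s) (hb : b ∈ s) : wronskian y y' v v' a = wronskian y y' v v' b := by
  have hint := integral_eq_sub_of_hasDerivWithinAt hs (f := wronskian y y' v v') (f' := fun _ => 0)
    (fun x hx => by simpa using hasDerivWithinAt_wronskian hy hv hx) continuousOn_const ha hb
  rw [intervalIntegral.integral_zero] at hint
  linear_combination hint

theorem eq_wronskian_combination {u u' : ℝ → ℂ} (hW : wronskian u u' v v' x = 1) :
    y x = wronskian y y' v v' x * u x + wronskian u u' y y' x * v x ∧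
      y' x = wronskian y y' v v' x * u' x + wronskian u u' y y' x * v' x := by
  simp only [wronskian] at *
  constructor
  · linear_combination (-y x) * hW
  · linear_combination (-y' x) * hW

namespace IsSolOn

/-- The Wronskians with a fundamental system vanish at `c`, hence everywhere on `s`. -/
theorem eq_zero (hq : Continuous q) (hs : OrdConnected s) (hy : IsSolOn q y y' s) (hc : c ∈ s)
    (h0 : y c = 0) (h0' : y' c = 0) (hx : x ∈ s) : y x = 0 ∧ y' x = 0 := by
  obtain ⟨C, C', hC, hC0, hC0'⟩ := exists_isSolOn hq 1 0
  obtain ⟨S, S', hS, -, hS0'⟩ := exists_isSolOn hq 0 1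
  have hW : wronskian C C' S S' x = 1 := by
    rw [wronskian_const ordConnected_univ hC hS (mem_univ x) (mem_univ 0)]
    simp [wronskian, hC0, hS0', hC0']
  have hWS : wronskian y y' S S' x = 0 := by
    rw [wronskian_const hs hy (hS.mono (subset_univ s)) hx hc]; simp [wronskian, h0, h0']
  have hWC : wronskian C C' y y' x = 0 := by
    rw [wronskian_const hs (hC.mono (subset_univ s)) hy hx hc]; simp [wronskian, h0, h0']
  simpa [hWS, hWC] using eq_wronskian_combination (y := y) (y' := y') hW

theorem eqOn (hq : Continuous q) (hs : OrdConnected s) (hy : IsSolOn q y y' s)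
    (hv : IsSolOn q v v' s) (hc : c ∈ s) (h0 : y c = v c) (h0' : y' c = v' c) (hx : x ∈ s) :
    y x = v x ∧ y' x = v' x := by
  have := (hy.linear_comb hv 1 (-1)).eq_zero hq hs hc (by simp [h0]) (by simp [h0']) hx
  constructor
  · linear_combination this.1
  · linear_combination this.2

theorem eqOn_linear_comb (hq : Continuous q) (hs : OrdConnected s) (hy : IsSolOn q y y' s)
    (hv : IsSolOn q v v' s) (hw : IsSolOn q w w' s) {α β : ℂ} (hc : c ∈ s)
    (h0 : y c = α * v c + β * w c) (h0' : y' c = α * v' c + β * w' c) (hx : x ∈ s) :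
    y x = α * v x + β * w x ∧ y' x = α * v' x + β * w' x :=
  hy.eqOn hq hs (hv.linear_comb hw α β) hc h0 h0' hx

theorem ne_zero_or_deriv_ne_zero (hq : Continuous q) (hy : IsSolOn q y y' univ)
    (hne : ∃ x, y x ≠ 0) (c : ℝ) : y c ≠ 0 ∨ y' c ≠ 0 := by
  by_contra! h
  obtain ⟨x, hx⟩ := hne
  exact hx (hy.eq_zero hq ordConnected_univ (mem_univ c) h.1 h.2 (mem_univ x)).1

end IsSolOn

theorem schrodingerEq_iff (hV : Continuous V) (z : ℂ) (w : ℝ → ℂ) :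
    SchrodingerEq V w (fun x => z * w x) ↔
      IsSolOn (shiftedPotential V z) w (deriv w) univ := by
  have hcont (hw : Continuous w) : Continuous fun t => (V t : ℂ) * w t - z * w t := by fun_prop
  have hcoeff (x : ℝ) : shiftedPotential V z x * w x = V x * w x - z * w x := sub_mul _ _ _
  constructor
  · rintro ⟨hw, -, hint⟩ x _
    refine ⟨(hw x).hasDerivAt.hasDerivWithinAt, HasDerivAt.hasDerivWithinAt ?_⟩
    have hprim (b : ℝ) : deriv w b = deriv w 0 + ∫ t in (0 : ℝ)..b, (V t * w t - z * w t) := by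
      rw [← hint 0 b]; ring
    rw [hcoeff, funext hprim]
    exact ((hcont hw.continuous).integral_hasStrictDerivAt 0 x).hasDerivAt.const_add _
  · intro h
    refine ⟨fun x => (h.hasDerivAt x).differentiableAt,
      fun a b => (hcont h.continuous).intervalIntegrable a b, fun a b => ?_⟩
    exact (integral_eq_sub_of_hasDerivWithinAt ordConnected_univ
      (fun x hx => (h x hx).2.congr_deriv (hcoeff x)) (hcont h.continuous).continuousOn
      (mem_univ a) (mem_univ b)).symm

theorem schrodingerSol_spec (hV : Continuous V) (z a b : ℂ) :
    IsSolOn (shiftedPotential V z) (schrodingerSol V z a b) (deriv (schrodingerSol V z a b)) univ ∧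
      schrodingerSol V z a b 0 = a ∧ deriv (schrodingerSol V z a b) 0 = b := by
  have hex : ∃ y : ℝ → ℂ, SchrodingerEq V y (fun x => z * y x) ∧ y 0 = a ∧ deriv y 0 = b := by
    obtain ⟨y, y', hy, h0, h1⟩ := exists_isSolOn (continuous_shiftedPotential hV z) a b
    obtain rfl := hy.deriv_eq
    exact ⟨y, (schrodingerEq_iff hV z y).2 hy, h0, h1⟩
  have hsol := Classical.epsilon_spec hex
  exact ⟨(schrodingerEq_iff hV z _).1 hsol.1, hsol.2⟩

theorem differentiable_schrodingerSol (hV : Continuous V) (a b : ℂ) (x : ℝ) :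
    Differentiable ℂ (fun z => schrodingerSol V z a b x) ∧
      Differentiable ℂ (fun z => deriv (schrodingerSol V z a b) x) := by
  rw [Differentiable, Differentiable, ← forall_and]
  intro z₀
  obtain ⟨y, y', hy, hdiff⟩ :=
    exists_isSolOn_differentiableAt (continuous_shiftedPotential hV z₀) a b
  have hshift : Filter.Tendsto (fun z => z₀ - z) (nhds z₀) (nhds 0) := by
    have hcont : Continuous fun z => z₀ - z := by fun_prop
    simpa using hcont.tendsto z₀
  have heq : ∀ᶠ z in nhds z₀, schrodingerSol V z a b x = y (z₀ - z) x ∧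
      deriv (schrodingerSol V z a b) x = y' (z₀ - z) x := by
    filter_upwards [hshift.eventually hy] with z ⟨hsol, h0, h0'⟩
    obtain ⟨hY, hY0, hY0'⟩ := schrodingerSol_spec hV z a b
    refine hY.eqOn (continuous_shiftedPotential hV z) ordConnected_univ
      (hsol.congr_coeff fun t _ => ?_) (mem_univ 0) (hY0.trans h0.symm) (hY0'.trans h0'.symm)
      (mem_univ x)
    simp [shiftedPotential]
  have hcomp {f : ℂ → ℂ} (hf : DifferentiableAt ℂ f 0) :
      DifferentiableAt ℂ (fun z => f (z₀ - z)) z₀ :=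
    DifferentiableAt.comp z₀ (g := f) (by simpa using hf) (by fun_prop)
  exact ⟨(hcomp (hdiff x).1).congr_of_eventuallyEq (heq.mono fun z h => h.1),
    (hcomp (hdiff x).2).congr_of_eventuallyEq (heq.mono fun z h => h.2)⟩

end SecondOrderODE

section HalfLine

open Filter

theorem integrableOn_Ioi_or_tendsto_intervalIntegral_atTop {f : ℝ → ℝ} (hf : Continuous f)
    (hf0 : ∀ x, 0 ≤ f x) (a : ℝ) :
    IntegrableOn f (Ioi a) ∨ Tendsto (fun b => ∫ x in a..b, f x) atTop atTop := by
  have hmono : Monotone fun b => ∫ x in a..b, f x := fun b c hbc => by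
    beta_reduce
    rw [← intervalIntegral.integral_add_adjacent_intervals (hf.intervalIntegrable a b)
      (hf.intervalIntegrable b c)]
    exact le_add_of_nonneg_right (intervalIntegral.integral_nonneg hbc fun x _ => hf0 x)
  rcases tendsto_atTop_of_monotone hmono with h | ⟨l, hl⟩
  · exact .inr h
  · refine .inl (integrableOn_Ioi_of_intervalIntegral_norm_tendsto l a
      (fun b => (hf.integrableOn_Icc.mono_set Ioc_subset_Icc_self)) tendsto_id ?_)
    simpa only [Real.norm_of_nonneg (hf0 _), id_eq] using hl

theorem tendsto_atTop_of_eventually_le_deriv {f f' : ℝ → ℝ} (hf : ∀ x, HasDerivAt f (f' x) x)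
    {c : ℝ} (hc : 0 < c) (hf' : ∀ᶠ x in atTop, c ≤ f' x) : Tendsto f atTop atTop := by
  obtain ⟨b, hb⟩ := eventually_atTop.1 hf'
  have hlin : Tendsto (fun x => f b + c * (x - b)) atTop atTop :=
    tendsto_atTop_add_const_left _ _
      ((tendsto_atTop_add_const_right _ (-b) tendsto_id).const_mul_atTop hc)
  refine tendsto_atTop_mono' _ ((eventually_ge_atTop b).mono fun x hx => ?_) hlin
  have hle := (convex_Ici b).mul_sub_le_image_sub_of_le_deriv
    (fun t _ => (hf t).continuousAt.continuousWithinAt)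
    (fun t _ => (hf t).differentiableAt.differentiableWithinAt)
    (fun t ht => (hb t (interior_subset ht)).trans_eq (hf t).deriv.symm) b self_mem_Ici x hx hx
  linarith

theorem not_integrableOn_Ioi_of_tendsto_atTop {f : ℝ → ℝ} {a : ℝ} (hf : Tendsto f atTop atTop) :
    ¬ IntegrableOn f (Ioi a) := fun hint => by
  obtain ⟨b, hb⟩ := eventually_atTop.1 (hf.eventually_ge_atTop 1)
  have hsub : Ioi (max a b) ⊆ {x | 1 ≤ ‖f x‖} ∩ Ioi a := fun x hx =>
    ⟨(hb x ((le_max_right a b).trans (le_of_lt hx))).trans (le_abs_self _),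
      (le_max_left a b).trans_lt hx⟩
  have hfin := hint.measure_norm_ge_lt_top one_pos
  rw [Measure.restrict_apply' measurableSet_Ioi] at hfin
  exact ((measure_mono hsub).trans_lt hfin).ne Real.volume_Ioi

theorem memLp_comp_add_const_of_memLp_Ioi {F : Type*} [NormedAddCommGroup F] {f : ℝ → F}
    {p : ENNReal} {a c : ℝ} (hc : 0 ≤ c) (hf : MemLp f p (volume.restrict (Ioi a))) :
    MemLp (fun x => f (x + c)) p (volume.restrict (Ioi a)) := by
  have hshift := ((measurePreserving_add_right volume c).restrict_preimage
    (measurableSet_Ioi (a := a + c)))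
  rw [preimage_add_const_Ioi, add_sub_cancel_right] at hshift
  exact (hf.mono_measure (Measure.restrict_mono (Ioi_subset_Ioi (by linarith))
    le_rfl)).comp_measurePreserving hshift

variable {q y y' v v' : ℝ → ℂ} {a K : ℝ}

/-- If `y'` were not square integrable, then `(‖y‖²)' → ∞` because
`(‖y‖²)'' = 2 Re (ȳ q y) + 2 ‖y'‖²`, contradicting the integrability of `‖y‖²`. -/
theorem IsSolOn.memLp_deriv (hq : Continuous q) (hK : ∀ x, a < x → ‖q x‖ ≤ K)
    (hy : IsSolOn q y y' univ) (hL2 : MemLp y 2 (volume.restrict (Ioi a))) :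
    MemLp y' 2 (volume.restrict (Ioi a)) := by
  have hyc := hy.continuous
  have hyc' := hy.continuous_deriv
  have hsq : IntegrableOn (fun x => ‖y x‖ ^ 2) (Ioi a) :=
    (memLp_two_iff_integrable_sq_norm hL2.1).1 hL2
  have hpot : IntegrableOn (fun x => inner ℝ (y x) (q x * y x)) (Ioi a) := by
    refine (hsq.const_mul K).mono' (by fun_prop) (ae_restrict_of_forall_mem measurableSet_Ioi
      fun x hx => (norm_inner_le_norm _ _).trans ?_)
    rw [norm_mul]
    nlinarith [mul_le_mul_of_nonneg_right (hK x hx) (sq_nonneg ‖y x‖)]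
  refine (memLp_two_iff_integrable_sq_norm hyc'.aestronglyMeasurable).2
    ((integrableOn_Ioi_or_tendsto_intervalIntegral_atTop (by fun_prop)
      (fun x => sq_nonneg ‖y' x‖) a).resolve_right fun htop => ?_)
  have hderiv (x : ℝ) : HasDerivAt (fun x => inner ℝ (y x) (y' x))
      (inner ℝ (y x) (q x * y x) + ‖y' x‖ ^ 2) x :=
    ((hy.hasDerivAt x).inner ℝ (hy.hasDerivAt_deriv x)).congr_deriv
      (by rw [real_inner_self_eq_norm_sq])
  have hprim (b : ℝ) : inner ℝ (y b) (y' b) = inner ℝ (y a) (y' a) +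
      ((∫ x in a..b, inner ℝ (y x) (q x * y x)) + ∫ x in a..b, ‖y' x‖ ^ 2) := by
    have hint (f : ℝ → ℝ) (hf : Continuous f) : IntervalIntegrable f volume a b :=
      hf.intervalIntegrable a b
    rw [← intervalIntegral.integral_add (hint _ (by fun_prop)) (hint _ (by fun_prop)),
      intervalIntegral.integral_eq_sub_of_hasDerivAt (fun x _ => hderiv x)
        (hint _ (by fun_prop)), add_sub_cancel]
  have hinner : Tendsto (fun b => inner ℝ (y b) (y' b)) atTop atTop := by
    rw [funext hprim]
    exact tendsto_atTop_add_const_left _ _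
      ((intervalIntegral_tendsto_integral_Ioi a hpot tendsto_id).add_atTop htop)
  refine not_integrableOn_Ioi_of_tendsto_atTop (tendsto_atTop_of_eventually_le_deriv
    (fun x => (hy.hasDerivAt x).norm_sq) zero_lt_two ?_) hsq
  filter_upwards [hinner.eventually_ge_atTop 1] with x hx
  linarith

theorem wronskian_eq_zero_of_memLp (hy : IsSolOn q y y' (Ici a)) (hv : IsSolOn q v v' (Ici a))
    (hyL2 : MemLp y 2 (volume.restrict (Ioi a))) (hyL2' : MemLp y' 2 (volume.restrict (Ioi a)))
    (hvL2 : MemLp v 2 (volume.restrict (Ioi a))) (hvL2' : MemLp v' 2 (volume.restrict (Ioi a))) :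
    wronskian y y' v v' a = 0 := by
  have hint : IntegrableOn (fun x => y x * v' x - y' x * v x) (Ioi a) :=
    (hyL2.integrable_mul hvL2').sub (hyL2'.integrable_mul hvL2)
  have hconst : IntegrableOn (fun _ => wronskian y y' v v' a) (Ioi a) :=
    hint.congr_fun (fun x hx => wronskian_const ordConnected_Ici hy hv (Ioi_subset_Ici_self hx)
      self_mem_Ici) measurableSet_Ioi
  simpa using (integrableOn_const_iff (by finiteness)).1 hconst

end HalfLine

section Outgoing

variable {V : ℝ → ℝ} {y y' : ℝ → ℂ} {ξ : ℂ} {M : ℝ}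

/-- Green's identity for `y` and its complex conjugate, divided by `2 i Re ξ`. -/
theorem outgoing_energy_identity (hξ : ξ.re ≠ 0) (hM : 0 ≤ M)
    (hy : IsSolOn (shiftedPotential V (ξ ^ 2)) y y' (Icc (-M) M))
    (hright : y' M = Complex.I * ξ * y M) (hleft : y' (-M) = -(Complex.I * ξ * y (-M))) :
    ‖y M‖ ^ 2 + ‖y (-M)‖ ^ 2 + 2 * ξ.im * ∫ x in (-M)..M, ‖y x‖ ^ 2 = 0 := by
  have hgreen := wronskian_sub_eq_integral ordConnected_Icc hy hy.conj
    (left_mem_Icc.2 (by linarith)) (right_mem_Icc.2 (by linarith))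
  have hnorm (x : ℝ) : y x * starRingEnd ℂ (y x) = ((‖y x‖ ^ 2 : ℝ) : ℂ) := by
    rw [Complex.mul_conj, Complex.normSq_eq_norm_sq]
  simp_rw [hnorm] at hgreen
  rw [intervalIntegral.integral_ofReal] at hgreen
  simp only [wronskian, hright, hleft, map_mul, map_neg, Complex.conj_I, map_pow] at hgreen
  set J := ∫ x in (-M)..M, ‖y x‖ ^ 2
  have hre : ξ + starRingEnd ℂ ξ = 2 * (ξ.re : ℂ) := by rw [Complex.add_conj]; push_cast; ring
  have him : ξ - starRingEnd ℂ ξ = 2 * (ξ.im : ℂ) * Complex.I := by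
    rw [Complex.sub_conj]; push_cast; ring
  have hprod : (2 * Complex.I * (ξ.re : ℂ)) * ((‖y M‖ ^ 2 + ‖y (-M)‖ ^ 2 +
      2 * ξ.im * J : ℝ) : ℂ) = 0 := by
    have hM := hnorm M
    have hM' := hnorm (-M)
    push_cast at hgreen hM hM' ⊢
    linear_combination -hgreen - Complex.I * (ξ + starRingEnd ℂ ξ) * (hM + hM') +
      (-Complex.I * ((‖y M‖ : ℂ) ^ 2 + (‖y (-M)‖ : ℂ) ^ 2) -
        (ξ - starRingEnd ℂ ξ) * J) * hre - (2 * ξ.re * J) * him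
  rcases mul_eq_zero.1 hprod with h | h
  · simp [hξ] at h
  · exact_mod_cast h

theorem im_neg_of_outgoing (hV : Continuous V) (hξ : ξ.re ≠ 0) (hM : 0 ≤ M)
    (hy : IsSolOn (shiftedPotential V (ξ ^ 2)) y y' (Icc (-M) M))
    (hright : y' M = Complex.I * ξ * y M) (hleft : y' (-M) = -(Complex.I * ξ * y (-M)))
    (hne : ∃ x ∈ Icc (-M) M, y x ≠ 0) : ξ.im < 0 := by
  have henergy := outgoing_energy_identity hξ hM hy hright hleft
  have hint : 0 ≤ ∫ x in (-M)..M, ‖y x‖ ^ 2 :=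
    intervalIntegral.integral_nonneg (by linarith) fun x _ => sq_nonneg _
  by_contra! hneg
  have hyM : y M = 0 := by
    have : ‖y M‖ ^ 2 = 0 := by
      nlinarith [sq_nonneg ‖y M‖, sq_nonneg ‖y (-M)‖, mul_nonneg hneg hint]
    simpa using this
  obtain ⟨x, hx, hx0⟩ := hne
  exact hx0 (hy.eq_zero (continuous_shiftedPotential hV _) ordConnected_Icc
    (right_mem_Icc.2 (by linarith)) hyM (by simp [hright, hyM]) hx).1

end Outgoing

section Floquet

variable {q : ℝ → ℂ} {y y' u u' v v' : ℝ → ℂ} {a b k κ ρ : ℝ} {s : Set ℝ} {μ ν : ℂ}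

theorem exists_forall_le_of_add_one_le {g : ℝ → ℝ} (hg : Continuous g) (ha : a ≤ ρ)
    (hstep : ∀ x, ρ ≤ x → g (x + 1) ≤ g x) : ∃ B, ∀ x, a ≤ x → g x ≤ B := by
  obtain ⟨B, hB⟩ := isCompact_Icc.bddAbove_image (hg.continuousOn (s := Icc a (ρ + 1)))
  have hiter (n : ℕ) (x : ℝ) (hx : ρ ≤ x) : g (x + n) ≤ g x := by
    induction n with
    | zero => simp
    | succ n ih =>
      rw [Nat.cast_succ, ← add_assoc]
      exact (hstep _ (hx.trans (le_add_of_nonneg_right n.cast_nonneg))).trans ih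
  refine ⟨B, fun x hx => ?_⟩
  rcases le_total x ρ with hxρ | hxρ
  · exact hB ⟨x, ⟨hx, by linarith⟩, rfl⟩
  · have hfloor := Nat.floor_le (sub_nonneg.2 hxρ)
    have hfloor' := Nat.lt_floor_add_one (x - ρ)
    calc g x = g (x - ⌊x - ρ⌋₊ + ⌊x - ρ⌋₊) := by rw [sub_add_cancel]
      _ ≤ g (x - ⌊x - ρ⌋₊) := hiter _ _ (by linarith)
      _ ≤ B := hB ⟨_, ⟨by linarith, by linarith⟩, rfl⟩

theorem exists_norm_le_mul_exp_of_add_one_eq_mul {f : ℝ → ℂ} (hf : Continuous f) (ha : a ≤ ρ)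
    (hμ : ‖μ‖ = Real.exp k) (hshift : ∀ x, ρ ≤ x → f (x + 1) = μ * f x) :
    ∃ B, ∀ x, a ≤ x → ‖f x‖ ≤ B * Real.exp (k * x) := by
  obtain ⟨B, hB⟩ := exists_forall_le_of_add_one_le (g := fun x => ‖f x‖ / Real.exp (k * x))
    (by fun_prop (disch := exact fun x => (Real.exp_pos _).ne')) ha fun x hx => by
      rw [hshift x hx, norm_mul, hμ, mul_add, mul_one, Real.exp_add, mul_comm (Real.exp (k * x)),
        mul_div_mul_left _ _ (Real.exp_pos k).ne']
  exact ⟨B, fun x hx => (div_le_iff₀ (Real.exp_pos _)).1 (hB x hx)⟩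

theorem exists_eq_mul_of_det_eq_zero {p p' r r' : ℂ} (hp : p ≠ 0 ∨ p' ≠ 0)
    (hdet : p * r' - p' * r = 0) : ∃ c, r = c * p ∧ r' = c * p' := by
  rcases hp with hp | hp
  · refine ⟨r / p, by field_simp, ?_⟩
    field_simp; linear_combination hdet
  · refine ⟨r' / p', ?_, by field_simp⟩
    field_simp; linear_combination -hdet

theorem IsSolOn.exists_eq_const_mul (hq : Continuous q) (hs : OrdConnected s)
    (hy : IsSolOn q y y' univ) (hne : ∃ x, y x ≠ 0) (hv : IsSolOn q v v' s) (ha : a ∈ s)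
    (hW : wronskian y y' v v' a = 0) : ∃ c, ∀ x ∈ s, v x = c * y x ∧ v' x = c * y' x := by
  obtain ⟨c, hc, hc'⟩ := exists_eq_mul_of_det_eq_zero (hy.ne_zero_or_deriv_ne_zero hq hne a) hW
  exact ⟨c, fun x hx =>
    hv.eqOn hq hs ((hy.const_mul c).mono (subset_univ s)) ha hc hc' hx⟩

theorem IsSolOn.comp_add_one (hper : ∀ x, ρ ≤ x → q (x + 1) = q x) (hy : IsSolOn q y y' univ) :
    IsSolOn q (fun x => y (x + 1)) (fun x => y' (x + 1)) (Ici ρ) :=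
  ((hy.comp_add_const 1).mono (subset_univ _)).congr_coeff hper

theorem IsSolOn.integral_norm_sq_pos (hq : Continuous q) (hy : IsSolOn q y y' univ)
    (hne : ∃ x, y x ≠ 0) (hab : a < b) : 0 < ∫ x in a..b, ‖y x‖ ^ 2 := by
  have hyc := hy.continuous
  refine intervalIntegral.integral_pos hab (by fun_prop) (fun x _ => sq_nonneg _) ?_
  by_contra! hcon
  have hzero (x : ℝ) (hx : x ∈ Icc a b) : y x = 0 := by
    have : ‖y x‖ ^ 2 = 0 := le_antisymm (hcon x hx) (sq_nonneg _)
    simpa using this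
  obtain ⟨m, hm⟩ := nonempty_Ioo.2 hab
  have hderiv : HasDerivAt y 0 m := (hasDerivAt_const m (0 : ℂ)).congr_of_eventuallyEq <| by
    filter_upwards [Icc_mem_nhds hm.1 hm.2] with x hx using hzero x hx
  rcases hy.ne_zero_or_deriv_ne_zero hq hne m with h | h
  · exact h (hzero m (Ioo_subset_Icc_self hm))
  · exact h ((hy.hasDerivAt m).unique hderiv)

/-- With `I` the square integral of `y` over `(ρ, ∞)`, that over `(ρ + 1, ∞)` is `‖μ‖² I < I`. -/
theorem IsSolOn.norm_multiplier_lt_one (hq : Continuous q) (hy : IsSolOn q y y' univ)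
    (hne : ∃ x, y x ≠ 0) (hL2 : MemLp y 2 (volume.restrict (Ioi ρ)))
    (hμ : ∀ x, ρ ≤ x → y (x + 1) = μ * y x) : ‖μ‖ < 1 := by
  have hint : IntegrableOn (fun x => ‖y x‖ ^ 2) (Ioi ρ) :=
    (memLp_two_iff_integrable_sq_norm hL2.1).1 hL2
  have hsplit := intervalIntegral.integral_interval_add_Ioi hint
    (hint.mono_set (Ioi_subset_Ioi (by linarith : ρ ≤ ρ + 1)))
  have htail : ∫ x in Ioi (ρ + 1), ‖y x‖ ^ 2 = ‖μ‖ ^ 2 * ∫ x in Ioi ρ, ‖y x‖ ^ 2 := by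
    have hshift := (measurePreserving_add_right volume (1 : ℝ)).setIntegral_preimage_emb
      (measurableEmbedding_addRight 1) (fun x => ‖y x‖ ^ 2) (Ioi (ρ + 1))
    rw [preimage_add_const_Ioi, add_sub_cancel_right] at hshift
    rw [← hshift, ← integral_const_mul]
    refine setIntegral_congr_fun measurableSet_Ioi fun x hx => ?_
    simp only [hμ x (le_of_lt hx), norm_mul, mul_pow]
  have hpos := hy.integral_norm_sq_pos hq hne (lt_add_one ρ)
  have hnonneg : 0 ≤ ∫ x in Ioi ρ, ‖y x‖ ^ 2 :=
    setIntegral_nonneg measurableSet_Ioi fun x _ => sq_nonneg _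
  by_contra! hge
  nlinarith [mul_self_nonneg (‖μ‖ - 1)]

/-- The Wronskian of a square integrable solution and its translate vanishes. -/
theorem IsSolOn.exists_floquet_multiplier (hq : Continuous q)
    (hper : ∀ x, ρ ≤ x → q (x + 1) = q x) (hy : IsSolOn q y y' univ) (hne : ∃ x, y x ≠ 0)
    (hL2 : MemLp y 2 (volume.restrict (Ioi ρ))) :
    ∃ μ : ℂ, μ ≠ 0 ∧ ‖μ‖ < 1 ∧ ∀ x, ρ ≤ x → y (x + 1) = μ * y x ∧ y' (x + 1) = μ * y' x := by
  obtain ⟨K, hK⟩ := exists_forall_le_of_add_one_le (g := fun x => ‖q x‖) (by fun_prop) le_rfl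
    fun x hx => by rw [hper x hx]
  have hL2' := hy.memLp_deriv hq (fun x hx => hK x (le_of_lt hx)) hL2
  have hW := wronskian_eq_zero_of_memLp (hy.mono (subset_univ _)) (hy.comp_add_one hper) hL2 hL2'
    (memLp_comp_add_const_of_memLp_Ioi zero_le_one hL2)
    (memLp_comp_add_const_of_memLp_Ioi zero_le_one hL2')
  obtain ⟨μ, hμ⟩ := hy.exists_eq_const_mul hq ordConnected_Ici hne (hy.comp_add_one hper)
    self_mem_Ici hW
  refine ⟨μ, ?_, hy.norm_multiplier_lt_one hq hne hL2 fun x hx => (hμ x hx).1, hμ⟩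
  rintro rfl
  have hzero := hμ ρ self_mem_Ici
  simp only [zero_mul] at hzero
  rcases hy.ne_zero_or_deriv_ne_zero hq hne (ρ + 1) with h | h
  · exact h hzero.1
  · exact h hzero.2

theorem IsSolOn.exists_dual_floquet_solution (hq : Continuous q)
    (hper : ∀ x, ρ ≤ x → q (x + 1) = q x) (hu : IsSolOn q u u' univ) (hv : IsSolOn q v v' univ)
    (hW : ∀ x, wronskian u u' v v' x = 1) (hμ0 : μ ≠ 0) (hμ1 : ‖μ‖ < 1)
    (hμ : ∀ x, ρ ≤ x → u (x + 1) = μ * u x ∧ u' (x + 1) = μ * u' x) :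
    ∃ d : ℂ, ∀ x, ρ ≤ x → v (x + 1) + d * u (x + 1) = μ⁻¹ * (v x + d * u x) ∧
      v' (x + 1) + d * u' (x + 1) = μ⁻¹ * (v' x + d * u' x) := by
  have hμsq : 1 - μ ^ 2 ≠ 0 := fun h => by
    have : ‖μ‖ ^ 2 = 1 := by rw [← norm_pow, ← sub_eq_zero.1 h, norm_one]
    nlinarith [norm_nonneg μ]
  have hu0 : ∃ x, u x ≠ 0 := by
    by_contra! hzero
    have hderiv : HasDerivAt u 0 0 := by
      rw [show u = fun _ => 0 from funext hzero]; exact hasDerivAt_const 0 0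
    simpa [wronskian, hzero, (hu.hasDerivAt 0).unique hderiv] using hW 0
  have hWdefect : wronskian u u' (fun x => 1 * v (x + 1) + -μ⁻¹ * v x)
      (fun x => 1 * v' (x + 1) + -μ⁻¹ * v' x) ρ = 0 := by
    have h₀ := hW ρ
    have h₁ := hW (ρ + 1)
    simp only [wronskian, (hμ ρ le_rfl).1, (hμ ρ le_rfl).2] at h₀ h₁ ⊢
    field_simp
    linear_combination h₁ - h₀
  obtain ⟨c, hc⟩ := hu.exists_eq_const_mul hq ordConnected_Ici hu0
    ((hv.comp_add_one hper).linear_comb (hv.mono (subset_univ _)) 1 (-μ⁻¹)) self_mem_Ici hWdefect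
  refine ⟨c * μ / (1 - μ ^ 2), fun x hx => ?_⟩
  obtain ⟨hcx, hcx'⟩ := hc x hx
  obtain ⟨hμx, hμx'⟩ := hμ x hx
  rw [hμx, hμx', ← sub_eq_zero, ← sub_eq_zero (a := v' _ + _)]
  field_simp at hcx hcx' ⊢
  constructor
  · linear_combination (1 - μ ^ 2) * hcx
  · linear_combination (1 - μ ^ 2) * hcx'

theorem exists_norm_le_mul_exp_of_dual {f g : ℝ → ℂ} {d : ℂ} (hf : Continuous f)
    (hg : Continuous g) (hρ : 0 ≤ ρ) (hκ : 0 ≤ κ) (hμ : ‖μ‖ = Real.exp (-κ))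
    (hgμ : ∀ x, ρ ≤ x → g (x + 1) = μ * g x)
    (hfμ : ∀ x, ρ ≤ x → f (x + 1) + d * g (x + 1) = μ⁻¹ * (f x + d * g x)) :
    ∃ B, ∀ x, 0 ≤ x → ‖g x‖ ≤ B * Real.exp (-κ * x) ∧ ‖f x‖ ≤ B * Real.exp (κ * x) := by
  obtain ⟨B₁, hB₁⟩ := exists_norm_le_mul_exp_of_add_one_eq_mul hg hρ hμ hgμ
  obtain ⟨B₂, hB₂⟩ := exists_norm_le_mul_exp_of_add_one_eq_mul (f := fun x => f x + d * g x)
    (k := κ) (by fun_prop) hρ (by rw [norm_inv, hμ, Real.exp_neg, inv_inv]) hfμ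
  have hB₁0 : 0 ≤ B₁ := by simpa using (norm_nonneg _).trans (hB₁ 0 le_rfl)
  have hB₂0 : 0 ≤ B₂ := by simpa using (norm_nonneg _).trans (hB₂ 0 le_rfl)
  refine ⟨B₁ + (B₂ + ‖d‖ * B₁), fun x hx => ⟨(hB₁ x hx).trans ?_, ?_⟩⟩
  · exact mul_le_mul_of_nonneg_right (le_add_of_nonneg_right (by positivity)) (Real.exp_nonneg _)
  · calc ‖f x‖ = ‖(f x + d * g x) - d * g x‖ := by rw [add_sub_cancel_right]
      _ ≤ ‖f x + d * g x‖ + ‖d * g x‖ := norm_sub_le _ _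
      _ ≤ B₂ * Real.exp (κ * x) + ‖d‖ * (B₁ * Real.exp (κ * x)) := by
        rw [norm_mul]
        gcongr
        · exact hB₂ x hx
        · refine (hB₁ x hx).trans ?_
          gcongr
          linarith
      _ ≤ (B₁ + (B₂ + ‖d‖ * B₁)) * Real.exp (κ * x) := by
        nlinarith [mul_nonneg hB₁0 (Real.exp_nonneg (κ * x))]

theorem exists_floquet_exp_bounds (hq : Continuous q) (hρ : 0 ≤ ρ) (hκ : 0 < κ)
    (hper : ∀ x, ρ ≤ x → q (x + 1) = q x) (hu : IsSolOn q u u' univ) (hv : IsSolOn q v v' univ)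
    (hW : ∀ x, wronskian u u' v v' x = 1) (hμ : ‖μ‖ = Real.exp (-κ))
    (hμu : ∀ x, ρ ≤ x → u (x + 1) = μ * u x ∧ u' (x + 1) = μ * u' x) :
    ∃ C, 0 < C ∧ ∀ x, 0 ≤ x → ‖u x‖ ≤ C * Real.exp (-κ * x) ∧ ‖u' x‖ ≤ C * Real.exp (-κ * x) ∧
      ‖v x‖ ≤ C * Real.exp (κ * x) ∧ ‖v' x‖ ≤ C * Real.exp (κ * x) := by
  have hμ0 : μ ≠ 0 := norm_pos_iff.1 (hμ ▸ Real.exp_pos _)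
  have hμ1 : ‖μ‖ < 1 := by rw [hμ]; exact Real.exp_lt_one_iff.2 (by linarith)
  obtain ⟨d, hd⟩ := hu.exists_dual_floquet_solution hq hper hv hW hμ0 hμ1 hμu
  obtain ⟨B, hB⟩ := exists_norm_le_mul_exp_of_dual hv.continuous hu.continuous hρ hκ.le hμ
    (fun x hx => (hμu x hx).1) (fun x hx => (hd x hx).1)
  obtain ⟨B', hB'⟩ := exists_norm_le_mul_exp_of_dual hv.continuous_deriv hu.continuous_deriv hρ
    hκ.le hμ (fun x hx => (hμu x hx).2) (fun x hx => (hd x hx).2)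
  refine ⟨max 1 (max B B'), by positivity, fun x hx => ⟨(hB x hx).1.trans ?_,
    (hB' x hx).1.trans ?_, (hB x hx).2.trans ?_, (hB' x hx).2.trans ?_⟩⟩ <;>
  · gcongr
    simp

/-- Compare the Wronskian of `y` and `v` at the two end points. -/
theorem IsSolOn.multipliers_eq (hq : Continuous q) (hs : OrdConnected s)
    (hy : IsSolOn q y y' univ) (hne : ∃ x, y x ≠ 0) (hv : IsSolOn q v v' s) (ha : a ∈ s)
    (hb : b ∈ s) (hμ1 : ‖μ‖ < 1) (hν1 : ‖ν‖ < 1) (hv0 : v b ≠ 0 ∨ v' b ≠ 0)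
    (hμ : y b = μ * y a ∧ y' b = μ * y' a) (hν : v a = ν * v b ∧ v' a = ν * v' b) : μ = ν := by
  have hW := wronskian_const hs (hy.mono (subset_univ s)) hv ha hb
  by_cases hz : wronskian y y' v v' a = 0
  · exfalso
    obtain ⟨k, hk⟩ := hy.exists_eq_const_mul hq hs hne hv ha hz
    have hμν : 1 - μ * ν ≠ 0 := fun h => by
      have : ‖μ‖ * ‖ν‖ = 1 := by rw [← norm_mul, ← sub_eq_zero.1 h, norm_one]
      nlinarith [norm_nonneg μ, norm_nonneg ν]
    have hzero : (1 - μ * ν) * v b = 0 ∧ (1 - μ * ν) * v' b = 0 := by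
      constructor
      · linear_combination (hk b hb).1 + k * hμ.1 - μ * (hk a ha).1 + μ * hν.1
      · linear_combination (hk b hb).2 + k * hμ.2 - μ * (hk a ha).2 + μ * hν.2
    rcases hv0 with h | h
    · exact h ((mul_eq_zero.1 hzero.1).resolve_left hμν)
    · exact h ((mul_eq_zero.1 hzero.2).resolve_left hμν)
  · refine sub_eq_zero.1 ((mul_eq_zero.1 ?_).resolve_right hz)
    simp only [wronskian, hμ, hν] at hW ⊢
    linear_combination -ν * hW

end Floquet

section DecayPair

open Filter

/-- A fundamental system `u`, `v` with Wronskian `1` for the energy `E`, where on `[0, ∞)` the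
solution `u` decays and `v` grows at the exponential rate `κ`, and `v` stays at distance at least
`c * exp (κ x)` from the outgoing boundary condition `v' = i √E v`. -/
structure DecayPair (V : ℝ → ℝ) (E κ C c : ℝ) (u u' v v' : ℝ → ℂ) : Prop where
  solu : IsSolOn (shiftedPotential V E) u u' univ
  solv : IsSolOn (shiftedPotential V E) v v' univ
  wronskian_eq : ∀ x, wronskian u u' v v' x = 1
  norm_u : ∀ x, 0 ≤ x → ‖u x‖ ≤ C * Real.exp (-κ * x)
  norm_u' : ∀ x, 0 ≤ x → ‖u' x‖ ≤ C * Real.exp (-κ * x)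
  norm_v : ∀ x, 0 ≤ x → ‖v x‖ ≤ C * Real.exp (κ * x)
  norm_v' : ∀ x, 0 ≤ x → ‖v' x‖ ≤ C * Real.exp (κ * x)
  lower : ∀ x, 0 ≤ x → c * Real.exp (κ * x) ≤ ‖v' x - Complex.I * (Real.sqrt E : ℂ) * v x‖

theorem exp_neg_mul_mul_exp_mul (k t : ℝ) : Real.exp (-k * t) * Real.exp (k * t) = 1 := by
  rw [← Real.exp_add, neg_mul, neg_add_cancel, Real.exp_zero]

theorem exp_two_mul_mul (k t : ℝ) :
    Real.exp (2 * k * t) = Real.exp (k * t) * Real.exp (k * t) := by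
  rw [← Real.exp_add]; ring_nf

theorem integral_exp_mul {k : ℝ} (hk : k ≠ 0) (x : ℝ) :
    ∫ t in (0 : ℝ)..x, Real.exp (k * t) = (Real.exp (k * x) - 1) / k := by
  rw [intervalIntegral.integral_comp_mul_left _ hk, integral_exp, smul_eq_mul, mul_zero,
    Real.exp_zero, inv_mul_eq_div]

theorem integral_exp_mul_le {k x : ℝ} (hk : 0 < k) :
    ∫ t in (0 : ℝ)..x, Real.exp (k * t) ≤ 1 / k * Real.exp (k * x) := by
  rw [integral_exp_mul hk.ne', one_div_mul_eq_div]
  gcongr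
  exact sub_le_self _ zero_le_one

theorem integral_exp_neg_mul_le {k x : ℝ} (hk : 0 < k) :
    ∫ t in (0 : ℝ)..x, Real.exp (-k * t) ≤ 1 / k := by
  rw [integral_exp_mul (neg_ne_zero.2 hk.ne'), div_neg, ← neg_div]
  gcongr
  linarith [Real.exp_pos (-k * x)]

theorem tendsto_mul_exp_neg_mul_atTop {k : ℝ} (hk : 0 < k) :
    Tendsto (fun x : ℝ => x * Real.exp (-k * x)) atTop (nhds 0) := by
  have h := ((Real.tendsto_pow_mul_exp_neg_atTop_nhds_zero 1).comp
    (tendsto_id.const_mul_atTop hk)).const_mul k⁻¹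
  rw [mul_zero] at h
  refine h.congr fun x => ?_
  simp only [Function.comp_apply, id_eq, pow_one, neg_mul]
  field_simp

theorem norm_integral_mul_le_of_norm_le {f h : ℝ → ℂ} {p : ℝ → ℝ} {a x : ℝ} (hx : 0 ≤ x)
    (hp : Continuous p) (hf : ∀ t ∈ Icc 0 x, ‖f t‖ ≤ p t) (hh : ∀ t ∈ Icc 0 x, ‖h t‖ ≤ a) :
    ‖∫ t in (0 : ℝ)..x, f t * h t‖ ≤ (∫ t in (0 : ℝ)..x, p t) * a := by
  rw [← intervalIntegral.integral_mul_const]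
  refine intervalIntegral.norm_integral_le_of_norm_le hx (Eventually.of_forall
    fun t ht => ?_) ((hp.mul continuous_const).intervalIntegrable _ _)
  have ht' : t ∈ Icc 0 x := Ioc_subset_Icc_self ht
  rw [norm_mul]
  exact mul_le_mul (hf t ht') (hh t ht') (norm_nonneg _) ((norm_nonneg _).trans (hf t ht'))

theorem exists_forall_norm_le_norm {f : ℝ → ℂ} (hf : Continuous f) {M : ℝ} (hM : 0 ≤ M) :
    ∃ t₀ ∈ Icc 0 M, ∀ t ∈ Icc 0 M, ‖f t‖ ≤ ‖f t₀‖ :=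
  isCompact_Icc.exists_isMaxOn ⟨0, le_rfl, hM⟩ hf.norm.continuousOn

theorem bootstrap_le {P X α β : ℝ} (hP : 0 ≤ P) (hα : 0 ≤ α) (hβ : 0 ≤ β)
    (hsmall : (P + 2 * P ^ 2) * X ≤ 1 / 2) (hα' : α ≤ 1 + P * (X * α + X * β))
    (hβ' : β ≤ P * (α + X * β)) : α ≤ 2 ∧ β ≤ 4 * P := by
  have hβα : β ≤ 2 * P * α := by
    nlinarith [mul_le_mul_of_nonneg_right hsmall hβ]
  have hα2 : α ≤ 2 := by
    nlinarith
  exact ⟨hα2, by nlinarith⟩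

namespace DecayPair

variable {V : ℝ → ℝ} {E κ C c : ℝ} {u u' v v' : ℝ → ℂ}

theorem norm_integral_mul_le (h : DecayPair V E κ C c u u' v v') {f : ℝ → ℂ} {a x : ℝ}
    (hx : 0 ≤ x) (hf : ∀ t ∈ Icc 0 x, ‖f t‖ ≤ a) :
    ‖∫ t in (0 : ℝ)..x, u t * v t * f t‖ ≤ C ^ 2 * x * a := by
  have huv : ∀ t ∈ Icc 0 x, ‖u t * v t‖ ≤ C ^ 2 := fun t ht => by
    calc ‖u t * v t‖ ≤ (C * Real.exp (-κ * t)) * (C * Real.exp (κ * t)) :=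
          norm_mul_le_of_le (h.norm_u t ht.1) (h.norm_v t ht.1)
      _ = C ^ 2 := by linear_combination C ^ 2 * exp_neg_mul_mul_exp_mul κ t
  refine (norm_integral_mul_le_of_norm_le hx continuous_const huv hf).trans_eq ?_
  rw [intervalIntegral.integral_const, smul_eq_mul, sub_zero, mul_comm x]

theorem norm_integral_sq_mul_le (h : DecayPair V E κ C c u u' v v') (hκ : 0 < κ) {f : ℝ → ℂ}
    {a x : ℝ} (hx : 0 ≤ x) (hf : ∀ t ∈ Icc 0 x, ‖f t‖ ≤ a) :
    ‖∫ t in (0 : ℝ)..x, u t ^ 2 * f t‖ ≤ C ^ 2 * (1 / (2 * κ)) * a := by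
  have huu : ∀ t ∈ Icc 0 x, ‖u t ^ 2‖ ≤ C ^ 2 * Real.exp (-(2 * κ) * t) := fun t ht => by
    rw [← mul_neg, exp_two_mul_mul, ← sq, ← mul_pow, norm_pow]
    gcongr
    exact h.norm_u t ht.1
  have ha : 0 ≤ a := (norm_nonneg _).trans (hf 0 ⟨le_rfl, hx⟩)
  refine (norm_integral_mul_le_of_norm_le hx (by fun_prop) huu hf).trans ?_
  rw [intervalIntegral.integral_const_mul]
  gcongr
  exact integral_exp_neg_mul_le (by linarith)

theorem norm_integral_sq_mul_le' (h : DecayPair V E κ C c u u' v v') (hκ : 0 < κ) {f : ℝ → ℂ}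
    {a x : ℝ} (hx : 0 ≤ x) (hf : ∀ t ∈ Icc 0 x, ‖f t‖ ≤ a) :
    ‖∫ t in (0 : ℝ)..x, v t ^ 2 * f t‖ ≤ C ^ 2 * (1 / (2 * κ) * Real.exp (2 * κ * x)) * a := by
  have hvv : ∀ t ∈ Icc 0 x, ‖v t ^ 2‖ ≤ C ^ 2 * Real.exp (2 * κ * t) := fun t ht => by
    rw [exp_two_mul_mul, ← sq, ← mul_pow, norm_pow]
    gcongr
    exact h.norm_v t ht.1
  have ha : 0 ≤ a := (norm_nonneg _).trans (hf 0 ⟨le_rfl, hx⟩)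
  refine (norm_integral_mul_le_of_norm_le hx (by fun_prop) hvv hf).trans ?_
  rw [intervalIntegral.integral_const_mul]
  gcongr
  exact integral_exp_mul_le (by linarith)

variable {M P a b : ℝ} {l : ℂ} {A B : ℝ → ℂ}

theorem norm_mul_integral_mul_v_le (h : DecayPair V E κ C c u u' v v') (hκ : 0 < κ)
    (hl : C ^ 2 * (1 + 1 / (2 * κ)) * ‖l‖ ≤ P * Real.exp (-(2 * κ) * M))
    (hA : Continuous A) (hB : Continuous B) (hAa : ∀ t ∈ Icc 0 M, ‖A t‖ ≤ a)
    (hBb : ∀ t ∈ Icc 0 M, ‖B t‖ ≤ b) {x : ℝ} (hx : x ∈ Icc 0 M) :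
    ‖l * ∫ t in (0 : ℝ)..x, (A t * u t + B t * v t) * v t‖
      ≤ P * (M * Real.exp (-(2 * κ) * M) * a + b) := by
  have huc := h.solu.continuous
  have hvc := h.solv.continuous
  have hx0 : 0 ≤ x := hx.1
  have hM : 0 ≤ M := hx0.trans hx.2
  have ha0 : 0 ≤ a := (norm_nonneg _).trans (hAa x hx)
  have hb0 : 0 ≤ b := (norm_nonneg _).trans (hBb x hx)
  have hsub : Icc 0 x ⊆ Icc 0 M := Icc_subset_Icc_right hx.2
  have hκ2 : 0 ≤ 1 / (2 * κ) := by positivity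
  have hsplit : ∫ t in (0 : ℝ)..x, (A t * u t + B t * v t) * v t
      = (∫ t in (0 : ℝ)..x, u t * v t * A t) + ∫ t in (0 : ℝ)..x, v t ^ 2 * B t := by
    rw [← intervalIntegral.integral_add (Continuous.intervalIntegrable (by fun_prop) _ _)
      (Continuous.intervalIntegrable (by fun_prop) _ _)]
    congr 1; ext t; ring
  have hint : ‖∫ t in (0 : ℝ)..x, (A t * u t + B t * v t) * v t‖
      ≤ C ^ 2 * (1 + 1 / (2 * κ)) * (M * a + Real.exp (2 * κ * M) * b) := by
    rw [hsplit]
    calc _ ≤ C ^ 2 * x * a + C ^ 2 * (1 / (2 * κ) * Real.exp (2 * κ * x)) * b :=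
          norm_add_le_of_le (h.norm_integral_mul_le hx.1 fun t ht => hAa t (hsub ht))
            (h.norm_integral_sq_mul_le' hκ hx.1 fun t ht => hBb t (hsub ht))
      _ = C ^ 2 * 1 * (x * a) + C ^ 2 * (1 / (2 * κ)) * (Real.exp (2 * κ * x) * b) := by ring
      _ ≤ C ^ 2 * (1 + 1 / (2 * κ)) * (M * a)
          + C ^ 2 * (1 + 1 / (2 * κ)) * (Real.exp (2 * κ * M) * b) := by
        gcongr
        exacts [le_add_of_nonneg_right hκ2, hx.2, le_add_of_nonneg_left zero_le_one, hx.2]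
      _ = _ := by ring
  calc _ ≤ ‖l‖ * (C ^ 2 * (1 + 1 / (2 * κ)) * (M * a + Real.exp (2 * κ * M) * b)) := by
        rw [norm_mul]; gcongr
    _ = C ^ 2 * (1 + 1 / (2 * κ)) * ‖l‖ * (M * a + Real.exp (2 * κ * M) * b) := by ring
    _ ≤ P * Real.exp (-(2 * κ) * M) * (M * a + Real.exp (2 * κ * M) * b) := by gcongr
    _ = _ := by linear_combination P * b * exp_neg_mul_mul_exp_mul (2 * κ) M

theorem norm_mul_integral_u_mul_le (h : DecayPair V E κ C c u u' v v') (hκ : 0 < κ)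
    (hl : C ^ 2 * (1 + 1 / (2 * κ)) * ‖l‖ ≤ P * Real.exp (-(2 * κ) * M))
    (hA : Continuous A) (hB : Continuous B) (hAa : ∀ t ∈ Icc 0 M, ‖A t‖ ≤ a)
    (hBb : ∀ t ∈ Icc 0 M, ‖B t‖ ≤ b) {x : ℝ} (hx : x ∈ Icc 0 M) :
    ‖l * ∫ t in (0 : ℝ)..x, u t * (A t * u t + B t * v t)‖
      ≤ P * (Real.exp (-(2 * κ) * M) * a + M * Real.exp (-(2 * κ) * M) * b) := by
  have huc := h.solu.continuous
  have hvc := h.solv.continuous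
  have hx0 : 0 ≤ x := hx.1
  have hM : 0 ≤ M := hx0.trans hx.2
  have ha0 : 0 ≤ a := (norm_nonneg _).trans (hAa x hx)
  have hb0 : 0 ≤ b := (norm_nonneg _).trans (hBb x hx)
  have hsub : Icc 0 x ⊆ Icc 0 M := Icc_subset_Icc_right hx.2
  have hκ2 : 0 ≤ 1 / (2 * κ) := by positivity
  have hsplit : ∫ t in (0 : ℝ)..x, u t * (A t * u t + B t * v t)
      = (∫ t in (0 : ℝ)..x, u t ^ 2 * A t) + ∫ t in (0 : ℝ)..x, u t * v t * B t := by
    rw [← intervalIntegral.integral_add (Continuous.intervalIntegrable (by fun_prop) _ _)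
      (Continuous.intervalIntegrable (by fun_prop) _ _)]
    congr 1; ext t; ring
  have hint : ‖∫ t in (0 : ℝ)..x, u t * (A t * u t + B t * v t)‖
      ≤ C ^ 2 * (1 + 1 / (2 * κ)) * (a + M * b) := by
    rw [hsplit]
    calc _ ≤ C ^ 2 * (1 / (2 * κ)) * a + C ^ 2 * x * b :=
          norm_add_le_of_le (h.norm_integral_sq_mul_le hκ hx.1 fun t ht => hAa t (hsub ht))
            (h.norm_integral_mul_le hx.1 fun t ht => hBb t (hsub ht))
      _ = C ^ 2 * (1 / (2 * κ)) * a + C ^ 2 * 1 * (x * b) := by ring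
      _ ≤ C ^ 2 * (1 + 1 / (2 * κ)) * a + C ^ 2 * (1 + 1 / (2 * κ)) * (M * b) := by
        gcongr
        exacts [le_add_of_nonneg_left zero_le_one, le_add_of_nonneg_right hκ2, hx.2]
      _ = _ := by ring
  calc _ ≤ ‖l‖ * (C ^ 2 * (1 + 1 / (2 * κ)) * (a + M * b)) := by
        rw [norm_mul]; gcongr
    _ = C ^ 2 * (1 + 1 / (2 * κ)) * ‖l‖ * (a + M * b) := by ring
    _ ≤ P * Real.exp (-(2 * κ) * M) * (a + M * b) := by gcongr
    _ = _ := by ring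

theorem wronskian_sub_eq (h : DecayPair V E κ C c u u' v v') {y y' : ℝ → ℂ}
    (hy : IsSolOn (shiftedPotential V (E + l)) y y' univ) (x : ℝ) :
    wronskian y y' v v' x - wronskian y y' v v' 0 = l * ∫ t in (0 : ℝ)..x,
      (wronskian y y' v v' t * u t + wronskian u u' y y' t * v t) * v t ∧
    wronskian u u' y y' x - wronskian u u' y y' 0 = -(l * ∫ t in (0 : ℝ)..x,
      u t * (wronskian y y' v v' t * u t + wronskian u u' y y' t * v t)) := by
  simp_rw [fun t => ((eq_wronskian_combination (h.wronskian_eq t)).1.symm :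
    wronskian y y' v v' t * u t + wronskian u u' y y' t * v t = y t)]
  rw [wronskian_sub_eq_integral ordConnected_univ hy h.solv (mem_univ 0) (mem_univ x),
    wronskian_sub_eq_integral ordConnected_univ h.solu hy (mem_univ 0) (mem_univ x)]
  constructor <;> ring

variable {y y' : ℝ → ℂ}

theorem norm_wronskian_sub_le (h : DecayPair V E κ C c u u' v v') (hκ : 0 < κ)
    (hl : C ^ 2 * (1 + 1 / (2 * κ)) * ‖l‖ ≤ P * Real.exp (-(2 * κ) * M))
    (hy : IsSolOn (shiftedPotential V (E + l)) y y' univ)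
    (ha : ∀ t ∈ Icc 0 M, ‖wronskian y y' v v' t‖ ≤ a)
    (hb : ∀ t ∈ Icc 0 M, ‖wronskian u u' y y' t‖ ≤ b) {x : ℝ} (hx : x ∈ Icc 0 M) :
    ‖wronskian y y' v v' x - wronskian y y' v v' 0‖
        ≤ P * (M * Real.exp (-(2 * κ) * M) * a + b) ∧
      ‖wronskian u u' y y' x - wronskian u u' y y' 0‖
        ≤ P * (Real.exp (-(2 * κ) * M) * a + M * Real.exp (-(2 * κ) * M) * b) := by
  have hA := hy.continuous_wronskian h.solv
  have hB := h.solu.continuous_wronskian hy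
  rw [(h.wronskian_sub_eq hy x).1, (h.wronskian_sub_eq hy x).2, norm_neg]
  exact ⟨h.norm_mul_integral_mul_v_le hκ hl hA hB ha hb hx,
    h.norm_mul_integral_u_mul_le hκ hl hA hB ha hb hx⟩

theorem norm_wronskian_sub_one_le_of_data_u (h : DecayPair V E κ C c u u' v v') (hκ : 0 < κ)
    (hM : 1 ≤ M) (hP : 0 ≤ P)
    (hsmall : (P + 2 * P ^ 2) * (M * Real.exp (-(2 * κ) * M)) ≤ 1 / 2)
    (hl : C ^ 2 * (1 + 1 / (2 * κ)) * ‖l‖ ≤ P * Real.exp (-(2 * κ) * M))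
    (hy : IsSolOn (shiftedPotential V (E + l)) y y' univ) (h0 : y 0 = u 0) (h0' : y' 0 = u' 0) :
    ∀ x ∈ Icc 0 M,
      ‖wronskian y y' v v' x - 1‖ ≤ (2 * P + 4 * P ^ 2) * (M * Real.exp (-(2 * κ) * M)) ∧
      ‖wronskian u u' y y' x‖ ≤ 4 * P * Real.exp (-(2 * κ) * M) := by
  have hM0 : 0 ≤ M := zero_le_one.trans hM
  set e := Real.exp (-(2 * κ) * M)
  have he0 : 0 < e := Real.exp_pos _
  have hXe : e ≤ M * e := le_mul_of_one_le_left he0.le hM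
  have hA0 : wronskian y y' v v' 0 = 1 := by
    rw [← h.wronskian_eq 0]; simp only [wronskian, h0, h0']
  have hB0 : wronskian u u' y y' 0 = 0 := by simp only [wronskian, h0, h0']; ring
  obtain ⟨s, hs, hsA⟩ := exists_forall_norm_le_norm (hy.continuous_wronskian h.solv) hM0
  obtain ⟨t, ht, htB⟩ := exists_forall_norm_le_norm (h.solu.continuous_wronskian hy) hM0
  set a := ‖wronskian y y' v v' s‖
  set b := ‖wronskian u u' y y' t‖
  have hvar : ∀ x ∈ Icc 0 M, ‖wronskian y y' v v' x - 1‖ ≤ P * (M * e * a + b) ∧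
      ‖wronskian u u' y y' x‖ ≤ P * (e * a + M * e * b) := fun x hx => by
    simpa only [hA0, hB0, sub_zero] using h.norm_wronskian_sub_le hκ hl hy hsA htB hx
  have hb : b = e * (b / e) := by field_simp
  have hboot := bootstrap_le (X := M * e) (α := a) (β := b / e) hP (norm_nonneg _) (by positivity)
    hsmall ?_ ?_
  · obtain ⟨ha2, hb4⟩ := hboot
    rw [div_le_iff₀ he0] at hb4
    refine fun x hx => ⟨(hvar x hx).1.trans ?_, (htB x hx).trans hb4⟩
    calc P * (M * e * a + b) ≤ P * (M * e * 2 + 4 * P * (M * e)) := by gcongr; nlinarith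
      _ = _ := by ring
  · calc a ≤ 1 + ‖wronskian y y' v v' s - 1‖ := by
          simpa only [norm_one] using norm_le_norm_add_norm_sub' (wronskian y y' v v' s) 1
      _ ≤ 1 + P * (M * e * a + e * (b / e)) := by rw [← hb]; gcongr; exact (hvar s hs).1
      _ ≤ _ := by gcongr
  · rw [div_le_iff₀ he0]
    calc b ≤ P * (e * a + M * e * b) := (hvar t ht).2
      _ = _ := by rw [hb]; field_simp

theorem norm_wronskian_sub_one_le_of_data_v (h : DecayPair V E κ C c u u' v v') (hκ : 0 < κ)
    (hM : 1 ≤ M) (hP : 0 ≤ P)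
    (hsmall : (P + 2 * P ^ 2) * (M * Real.exp (-(2 * κ) * M)) ≤ 1 / 2)
    (hl : C ^ 2 * (1 + 1 / (2 * κ)) * ‖l‖ ≤ P * Real.exp (-(2 * κ) * M))
    (hy : IsSolOn (shiftedPotential V (E + l)) y y' univ) (h0 : y 0 = v 0) (h0' : y' 0 = v' 0) :
    ∀ x ∈ Icc 0 M, ‖wronskian y y' v v' x‖ ≤ 4 * P ∧
      ‖wronskian u u' y y' x - 1‖ ≤ (2 * P + 4 * P ^ 2) * (M * Real.exp (-(2 * κ) * M)) := by
  have hM0 : 0 ≤ M := zero_le_one.trans hM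
  set e := Real.exp (-(2 * κ) * M)
  have he0 : 0 < e := Real.exp_pos _
  have hXe : e ≤ M * e := le_mul_of_one_le_left he0.le hM
  have hA0 : wronskian y y' v v' 0 = 0 := by simp only [wronskian, h0, h0']; ring
  have hB0 : wronskian u u' y y' 0 = 1 := by
    rw [← h.wronskian_eq 0]; simp only [wronskian, h0, h0']
  obtain ⟨s, hs, hsA⟩ := exists_forall_norm_le_norm (hy.continuous_wronskian h.solv) hM0
  obtain ⟨t, ht, htB⟩ := exists_forall_norm_le_norm (h.solu.continuous_wronskian hy) hM0
  set a := ‖wronskian y y' v v' s‖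
  set b := ‖wronskian u u' y y' t‖
  have hvar : ∀ x ∈ Icc 0 M, ‖wronskian y y' v v' x‖ ≤ P * (M * e * a + b) ∧
      ‖wronskian u u' y y' x - 1‖ ≤ P * (e * a + M * e * b) := fun x hx => by
    simpa only [hA0, hB0, sub_zero] using h.norm_wronskian_sub_le hκ hl hy hsA htB hx
  have hboot := bootstrap_le (X := M * e) (α := b) (β := a) hP (norm_nonneg _) (norm_nonneg _)
    hsmall ?_ ?_
  · obtain ⟨hb2, ha4⟩ := hboot
    refine fun x hx => ⟨(hsA x hx).trans ha4, (hvar x hx).2.trans ?_⟩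
    calc P * (e * a + M * e * b) ≤ P * (M * e * (4 * P) + M * e * 2) := by gcongr
      _ = _ := by ring
  · calc b ≤ 1 + ‖wronskian u u' y y' t - 1‖ := by
          simpa only [norm_one] using norm_le_norm_add_norm_sub' (wronskian u u' y y' t) 1
      _ ≤ 1 + P * (e * a + M * e * b) := by gcongr; exact (hvar t ht).2
      _ ≤ 1 + P * (M * e * b + M * e * a) := by rw [add_comm (e * a)]; gcongr
  · rw [add_comm b]
    exact (hvar s hs).1

theorem norm_wronskian_add_integral_sq_le (h : DecayPair V E κ C c u u' v v') (hκ : 0 < κ)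
    (hM : 1 ≤ M) (hP : 0 ≤ P)
    (hsmall : (P + 2 * P ^ 2) * (M * Real.exp (-(2 * κ) * M)) ≤ 1 / 2)
    (hl : C ^ 2 * (1 + 1 / (2 * κ)) * ‖l‖ ≤ P * Real.exp (-(2 * κ) * M))
    (hy : IsSolOn (shiftedPotential V (E + l)) y y' univ) (h0 : y 0 = u 0) (h0' : y' 0 = u' 0) :
    ‖wronskian u u' y y' M + l * ∫ t in (0 : ℝ)..M, u t ^ 2‖
      ≤ P * (6 * P + 4 * P ^ 2) * (M * Real.exp (-(2 * κ) * M) * Real.exp (-(2 * κ) * M)) := by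
  have huc := h.solu.continuous
  have hvc := h.solv.continuous
  have hA := hy.continuous_wronskian h.solv
  have hB := h.solu.continuous_wronskian hy
  have hcoeff := h.norm_wronskian_sub_one_le_of_data_u hκ hM hP hsmall hl hy h0 h0'
  have hB0 : wronskian u u' y y' 0 = 0 := by simp only [wronskian, h0, h0']; ring
  have hsplit : wronskian u u' y y' M + l * ∫ t in (0 : ℝ)..M, u t ^ 2 =
      -(l * ∫ t in (0 : ℝ)..M,
        u t * ((wronskian y y' v v' t - 1) * u t + wronskian u u' y y' t * v t)) := by
    rw [← sub_zero (wronskian u u' y y' M), ← hB0, (h.wronskian_sub_eq hy M).2, neg_add_eq_sub,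
      ← neg_sub, ← mul_sub, ← intervalIntegral.integral_sub
        (Continuous.intervalIntegrable (by fun_prop) _ _)
        (Continuous.intervalIntegrable (by fun_prop) _ _)]
    congr 3; ext t; ring
  rw [hsplit, norm_neg]
  refine (h.norm_mul_integral_u_mul_le hκ hl (hA.sub continuous_const) hB
    (fun t ht => (hcoeff t ht).1) (fun t ht => (hcoeff t ht).2)
    ⟨zero_le_one.trans hM, le_rfl⟩).trans_eq ?_
  ring

end DecayPair

end DecayPair

section EnergyWindow

open Filter Asymptotics Topology

/-- The size `exp (-2κM)` of the square of a solution decaying at the rate `κ`, at distance `M`. -/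
abbrev decaySq (κ M : ℝ) : ℝ := Real.exp (-(2 * κ) * M)

/-- The filter on pairs `(M, l)` expressing that `M → ∞` while the energy shift `l` stays of size at
most `K * exp (-2κM)`. Estimates along this filter are uniform in `l`. -/
def energyWindow (κ K : ℝ) : Filter (ℝ × ℂ) :=
  comap Prod.fst atTop ⊓ 𝓟 {p | ‖p.2‖ ≤ K * decaySq κ p.1}

variable {κ K : ℝ}

theorem eventually_energyWindow {P : ℝ × ℂ → Prop} :
    (∀ᶠ p in energyWindow κ K, P p) ↔
      ∀ᶠ M in atTop, ∀ l, ‖l‖ ≤ K * decaySq κ M → P (M, l) := by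
  rw [energyWindow, eventually_inf_principal, eventually_comap]
  exact eventually_congr (Eventually.of_forall fun M =>
    ⟨fun h l hl => h (M, l) rfl hl, fun h p hp hl => by subst hp; exact h p.2 hl⟩)

theorem tendsto_fst_energyWindow : Tendsto Prod.fst (energyWindow κ K) atTop :=
  tendsto_comap.mono_left inf_le_left

theorem tendsto_prodMk_energyWindow {l : ℝ → ℂ} (hl : ∀ᶠ M in atTop, ‖l M‖ ≤ K * decaySq κ M) :
    Tendsto (fun M => (M, l M)) atTop (energyWindow κ K) :=
  tendsto_inf.2 ⟨tendsto_comap_iff.2 tendsto_id, tendsto_principal.2 hl⟩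

theorem isBigO_snd_energyWindow :
    (fun p : ℝ × ℂ => p.2) =O[energyWindow κ K] fun p => decaySq κ p.1 :=
  IsBigO.of_bound K ((eventually_inf_principal.2 (Eventually.of_forall fun p hp => by
    rwa [Real.norm_of_nonneg (Real.exp_pos _).le])))

theorem tendsto_mul_decaySq (hκ : 0 < κ) :
    Tendsto (fun M => M * decaySq κ M) atTop (𝓝 0) :=
  tendsto_mul_exp_neg_mul_atTop (by positivity)

theorem isBigO_mul_of_one_le (f : ℝ → ℝ) : f =O[atTop] fun M => M * f M :=
  IsBigO.of_bound 1 ((eventually_ge_atTop 1).mono fun M hM => by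
    rw [one_mul, norm_mul, Real.norm_of_nonneg (zero_le_one.trans hM)]
    exact le_mul_of_one_le_left (norm_nonneg _) hM)

theorem tendsto_decaySq (hκ : 0 < κ) : Tendsto (decaySq κ) atTop (𝓝 0) :=
  (isBigO_mul_of_one_le _).trans_tendsto (tendsto_mul_decaySq hκ)

theorem tendsto_snd_energyWindow (hκ : 0 < κ) :
    Tendsto (fun p : ℝ × ℂ => p.2) (energyWindow κ K) (𝓝 0) :=
  isBigO_snd_energyWindow.trans_tendsto ((tendsto_decaySq hκ).comp tendsto_fst_energyWindow)

theorem isBigO_sqrt_sub_sqrt {E : ℝ} (hE : 0 < E) (hκ : 0 < κ) :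
    (fun p : ℝ × ℂ => Complex.sqrt (E + p.2) - (Real.sqrt E : ℂ)) =O[energyWindow κ K]
      fun p => decaySq κ p.1 := by
  have hsqrt : Complex.sqrt E = (Real.sqrt E : ℂ) := by
    rw [Complex.sqrt_of_nonneg (by exact_mod_cast hE.le), Complex.ofReal_re]
  have hshift : Tendsto (fun p : ℝ × ℂ => (E : ℂ) + p.2) (energyWindow κ K) (𝓝 E) := by
    simpa only [add_zero] using (tendsto_snd_energyWindow hκ).const_add (E : ℂ)
  have hderiv := (Complex.hasDerivAt_sqrt (Complex.ofReal_mem_slitPlane.2 hE)).isBigO_sub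
  rw [hsqrt] at hderiv
  refine (hderiv.comp_tendsto hshift).trans ?_
  simpa only [Function.comp_def, add_sub_cancel_left] using isBigO_snd_energyWindow

theorem tendsto_sqrt_energyWindow {E : ℝ} (hE : 0 < E) (hκ : 0 < κ) :
    Tendsto (fun p : ℝ × ℂ => Complex.sqrt (E + p.2)) (energyWindow κ K) (𝓝 (Real.sqrt E)) :=
  tendsto_sub_nhds_zero_iff.1 ((isBigO_sqrt_sub_sqrt hE hκ).trans_tendsto
    ((tendsto_decaySq hκ).comp tendsto_fst_energyWindow))

theorem eventually_re_pos_energyWindow {E : ℝ} (hE : 0 < E) (hκ : 0 < κ) :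
    ∀ᶠ p in energyWindow κ K, 0 < ((E : ℂ) + p.2).re := by
  have hshift : Tendsto (fun p : ℝ × ℂ => ((E : ℂ) + p.2).re) (energyWindow κ K) (𝓝 E) := by
    simpa [Function.comp_def] using (Complex.continuous_re.tendsto _).comp
      ((tendsto_snd_energyWindow (K := K) hκ).const_add (E : ℂ))
  exact hshift.eventually (lt_mem_nhds hE)

theorem exists_eventually_energyWindow (hκ : 0 < κ) (K : ℝ) {A : ℝ} (hA : 0 ≤ A) :
    ∃ P, 0 ≤ P ∧ ∀ᶠ p in energyWindow κ K, 1 ≤ p.1 ∧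
      (P + 2 * P ^ 2) * (p.1 * decaySq κ p.1) ≤ 1 / 2 ∧ A * ‖p.2‖ ≤ P * decaySq κ p.1 := by
  refine ⟨|A * K|, abs_nonneg _, ?_⟩
  have hsmall : Tendsto (fun M => (|A * K| + 2 * |A * K| ^ 2) * (M * decaySq κ M)) atTop (𝓝 0) := by
    simpa only [mul_zero] using (tendsto_mul_decaySq hκ).const_mul (|A * K| + 2 * |A * K| ^ 2)
  refine eventually_energyWindow.2 ?_
  filter_upwards [eventually_ge_atTop 1, hsmall.eventually (ge_mem_nhds one_half_pos)]
    with M hM1 hsm l hl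
  refine ⟨hM1, hsm, (mul_le_mul_of_nonneg_left hl hA).trans ?_⟩
  rw [← mul_assoc]
  gcongr
  exact le_abs_self _

end EnergyWindow

section OutgoingTrace

open Filter Asymptotics Topology

/-- `y' M - i s y M`, the defect of the boundary condition at `M` satisfied by the outgoing wave of
frequency `s`. -/
def outgoingTrace (s : ℂ) (M : ℝ) (y y' : ℝ → ℂ) : ℂ := y' M - Complex.I * s * y M

namespace DecayPair

variable {V : ℝ → ℝ} {E κ C c K : ℝ} {u u' v v' : ℝ → ℂ}

theorem outgoingTrace_eq (h : DecayPair V E κ C c u u' v v') (s : ℂ) (M : ℝ) (y y' : ℝ → ℂ) :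
    outgoingTrace s M y y' = wronskian y y' v v' M * outgoingTrace s M u u' +
      wronskian u u' y y' M * outgoingTrace s M v v' := by
  obtain ⟨hval, hderiv⟩ := eq_wronskian_combination (y := y) (y' := y') (h.wronskian_eq M)
  simp only [outgoingTrace]
  linear_combination hderiv - Complex.I * s * hval

theorem outgoingTrace_div_sub_div (h : DecayPair V E κ C c u u' v v') {s t : ℂ} {M : ℝ}
    (hs : outgoingTrace s M v v' ≠ 0) (ht : outgoingTrace t M v v' ≠ 0) :
    outgoingTrace s M u u' / outgoingTrace s M v v' -
        outgoingTrace t M u u' / outgoingTrace t M v v' =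
      -(Complex.I * (s - t)) * (outgoingTrace s M v v' * outgoingTrace t M v v')⁻¹ := by
  rw [div_sub_div _ _ hs ht, ← div_eq_mul_inv]
  congr 1
  have hW := h.wronskian_eq M
  simp only [wronskian] at hW
  simp only [outgoingTrace]
  linear_combination (-Complex.I * (s - t)) * hW

theorem isBigO_outgoingTrace_u (h : DecayPair V E κ C c u u' v v') {α : Type*} {f : Filter α}
    {M : α → ℝ} (hM : Tendsto M f atTop) {s : α → ℂ} (hs : s =O[f] (1 : α → ℝ)) :
    (fun p => outgoingTrace (s p) (M p) u u') =O[f] fun p => Real.exp (-κ * M p) := by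
  have bound {y : ℝ → ℂ} (hy : ∀ x, 0 ≤ x → ‖y x‖ ≤ C * Real.exp (-κ * x)) :
      (fun p => y (M p)) =O[f] fun p => Real.exp (-κ * M p) :=
    IsBigO.of_bound C ((hM.eventually_ge_atTop 0).mono fun p hp => by
      rw [Real.norm_of_nonneg (Real.exp_pos _).le]; exact hy _ hp)
  refine (bound h.norm_u').sub ?_
  simpa only [Pi.one_apply, one_mul] using (hs.const_mul_left Complex.I).mul (bound h.norm_u)

theorem isBigO_exp_outgoingTrace_v (h : DecayPair V E κ C c u u' v v') (hc : 0 < c) {α : Type*}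
    {f : Filter α} {M : α → ℝ} (hM : Tendsto M f atTop) {s : α → ℂ}
    (hs : Tendsto s f (𝓝 (Real.sqrt E))) :
    (fun p => Real.exp (κ * M p)) =O[f] fun p => outgoingTrace (s p) (M p) v v' := by
  have hlower : (fun p => Real.exp (κ * M p)) =O[f]
      fun p => outgoingTrace (Real.sqrt E) (M p) v v' :=
    IsBigO.of_bound c⁻¹ ((hM.eventually_ge_atTop 0).mono fun p hp => by
      rw [Real.norm_of_nonneg (Real.exp_pos _).le, ← div_eq_inv_mul, le_div_iff₀' hc]
      exact h.lower _ hp)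
  have hv : (fun p => v (M p)) =O[f] fun p => Real.exp (κ * M p) :=
    IsBigO.of_bound C ((hM.eventually_ge_atTop 0).mono fun p hp => by
      rw [Real.norm_of_nonneg (Real.exp_pos _).le]; exact h.norm_v _ hp)
  have hs0 : (fun p => -Complex.I * (s p - Real.sqrt E)) =o[f] (1 : α → ℝ) :=
    (isLittleO_one_iff ℝ).2 (by
      simpa only [sub_self, mul_zero] using (hs.sub_const (Real.sqrt E : ℂ)).const_mul (-Complex.I))
  have hpert := (hs0.mul_isBigO hv).trans_isBigO
    (by simpa only [Pi.one_apply, one_mul] using hlower)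
  refine hlower.trans (hpert.right_isBigO_add.congr_right fun p => ?_)
  simp only [outgoingTrace]
  ring

theorem eventually_outgoingTrace_v_ne_zero (h : DecayPair V E κ C c u u' v v') (hc : 0 < c)
    {α : Type*} {f : Filter α} {M : α → ℝ} (hM : Tendsto M f atTop) {s : α → ℂ}
    (hs : Tendsto s f (𝓝 (Real.sqrt E))) : ∀ᶠ p in f, outgoingTrace (s p) (M p) v v' ≠ 0 :=
  (h.isBigO_exp_outgoingTrace_v hc hM hs).eq_zero_imp.mono fun _ hp h0 =>
    (Real.exp_pos _).ne' (hp h0)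

theorem isBigO_inv_outgoingTrace_v (h : DecayPair V E κ C c u u' v v') (hc : 0 < c) {α : Type*}
    {f : Filter α} {M : α → ℝ} (hM : Tendsto M f atTop) {s : α → ℂ}
    (hs : Tendsto s f (𝓝 (Real.sqrt E))) :
    (fun p => (outgoingTrace (s p) (M p) v v')⁻¹) =O[f] fun p => Real.exp (-κ * M p) :=
  ((h.isBigO_exp_outgoingTrace_v hc hM hs).inv_rev (Eventually.of_forall fun _ h0 =>
    absurd h0 (Real.exp_pos _).ne')).congr_right fun p => by rw [← Real.exp_neg, neg_mul]

theorem isBigO_outgoingTrace_div (h : DecayPair V E κ C c u u' v v') (hc : 0 < c) {α : Type*}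
    {f : Filter α} {M : α → ℝ} (hM : Tendsto M f atTop) {s : α → ℂ}
    (hs : Tendsto s f (𝓝 (Real.sqrt E))) :
    (fun p => outgoingTrace (s p) (M p) u u' / outgoingTrace (s p) (M p) v v') =O[f]
      fun p => decaySq κ (M p) :=
  ((h.isBigO_outgoingTrace_u hM (hs.isBigO_one ℝ)).mul
    (h.isBigO_inv_outgoingTrace_v hc hM hs)).congr (fun p => (div_eq_mul_inv _ _).symm) fun p => by
      rw [decaySq, ← Real.exp_add]; ring_nf

theorem isBigO_outgoingTrace_div_sub_div (h : DecayPair V E κ C c u u' v v') (hE : 0 < E)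
    (hκ : 0 < κ) (hc : 0 < c) :
    (fun p : ℝ × ℂ =>
        outgoingTrace (Complex.sqrt (E + p.2)) p.1 u u' /
            outgoingTrace (Complex.sqrt (E + p.2)) p.1 v v' -
          outgoingTrace (Real.sqrt E) p.1 u u' / outgoingTrace (Real.sqrt E) p.1 v v')
      =O[energyWindow κ K] fun p => decaySq κ p.1 * decaySq κ p.1 := by
  have hM := tendsto_fst_energyWindow (κ := κ) (K := K)
  have hs := tendsto_sqrt_energyWindow (K := K) hE hκ
  have hne := h.eventually_outgoingTrace_v_ne_zero hc hM hs
  have hne₀ := h.eventually_outgoingTrace_v_ne_zero hc hM tendsto_const_nhds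
  refine IsBigO.congr' (((isBigO_sqrt_sub_sqrt hE hκ).const_mul_left (-Complex.I)).mul
      ((h.isBigO_inv_outgoingTrace_v hc hM hs).mul
        (h.isBigO_inv_outgoingTrace_v hc hM tendsto_const_nhds)))
    ?_ (Eventually.of_forall fun p => by simp only [← Real.exp_add]; ring_nf)
  filter_upwards [hne, hne₀] with p hp hp₀
  rw [h.outgoingTrace_div_sub_div hp hp₀, mul_inv, neg_mul]

theorem wronskian_asymptotics_of_data_u (h : DecayPair V E κ C c u u' v v') (hκ : 0 < κ)
    {y y' : ℂ → ℝ → ℂ}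
    (hy : ∀ l, IsSolOn (shiftedPotential V (E + l)) (y l) (y' l) univ)
    (h0 : ∀ l, y l 0 = u 0) (h0' : ∀ l, y' l 0 = u' 0) :
    ((fun p : ℝ × ℂ => wronskian (y p.2) (y' p.2) v v' p.1 - 1) =O[energyWindow κ K]
        fun p => p.1 * decaySq κ p.1) ∧
      (fun p : ℝ × ℂ => wronskian u u' (y p.2) (y' p.2) p.1 + p.2 * ∫ t in (0 : ℝ)..p.1, u t ^ 2)
        =O[energyWindow κ K] fun p => p.1 * decaySq κ p.1 * decaySq κ p.1 := by
  obtain ⟨P, hP, hsmall⟩ := exists_eventually_energyWindow hκ K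
    (A := C ^ 2 * (1 + 1 / (2 * κ))) (by positivity)
  refine ⟨IsBigO.of_bound (2 * P + 4 * P ^ 2) ?_, IsBigO.of_bound (P * (6 * P + 4 * P ^ 2)) ?_⟩ <;>
    filter_upwards [hsmall] with p ⟨hM1, hsm, hlp⟩ <;>
    have hp : 0 ≤ p.1 := zero_le_one.trans hM1
  · rw [Real.norm_of_nonneg (by positivity)]
    exact (h.norm_wronskian_sub_one_le_of_data_u hκ hM1 hP hsm hlp (hy _) (h0 _) (h0' _) p.1
      ⟨hp, le_rfl⟩).1
  · rw [Real.norm_of_nonneg (by positivity)]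
    exact h.norm_wronskian_add_integral_sq_le hκ hM1 hP hsm hlp (hy _) (h0 _) (h0' _)

theorem wronskian_asymptotics_of_data_v (h : DecayPair V E κ C c u u' v v') (hκ : 0 < κ)
    {z z' : ℂ → ℝ → ℂ}
    (hz : ∀ l, IsSolOn (shiftedPotential V (E + l)) (z l) (z' l) univ)
    (h0 : ∀ l, z l 0 = v 0) (h0' : ∀ l, z' l 0 = v' 0) :
    ((fun p : ℝ × ℂ => wronskian (z p.2) (z' p.2) v v' p.1) =O[energyWindow κ K] (1 : ℝ × ℂ → ℝ)) ∧
      (fun p : ℝ × ℂ => wronskian u u' (z p.2) (z' p.2) p.1 - 1) =O[energyWindow κ K]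
        fun p => p.1 * decaySq κ p.1 := by
  obtain ⟨P, hP, hsmall⟩ := exists_eventually_energyWindow hκ K
    (A := C ^ 2 * (1 + 1 / (2 * κ))) (by positivity)
  have hbound : ∀ᶠ p : ℝ × ℂ in energyWindow κ K, ‖wronskian (z p.2) (z' p.2) v v' p.1‖ ≤ 4 * P ∧
      ‖wronskian u u' (z p.2) (z' p.2) p.1 - 1‖ ≤ (2 * P + 4 * P ^ 2) * (p.1 * decaySq κ p.1) :=
    hsmall.mono fun p ⟨hM1, hsm, hlp⟩ =>
      h.norm_wronskian_sub_one_le_of_data_v hκ hM1 hP hsm hlp (hz _) (h0 _) (h0' _) p.1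
        ⟨zero_le_one.trans hM1, le_rfl⟩
  refine ⟨IsBigO.of_bound (4 * P) ?_, IsBigO.of_bound (2 * P + 4 * P ^ 2) ?_⟩
  · filter_upwards [hbound] with p hp
    simpa only [Pi.one_apply, norm_one, mul_one] using hp.1
  · filter_upwards [hbound, hsmall] with p hp hp'
    have hp0 : 0 ≤ p.1 := zero_le_one.trans hp'.1
    rw [Real.norm_of_nonneg (by positivity)]
    exact hp.2

end DecayPair

end OutgoingTrace

section TraceAsymptotics

open Filter Asymptotics Topology

/-- Asymptotics on one half-line of the normalised outgoing traces at distance `M` and energy shift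
`l`: `S₁ M l` belongs to the solution with the initial data of the decaying solution `u`, and is
affine in `l` up to a smaller error; `S₂ M l` belongs to the one with the initial data of `v`. -/
structure TraceAsymptotics (κ : ℝ) (S₁ S₂ : ℝ → ℂ → ℂ) (m I : ℝ → ℂ) : Prop where
  isBigO_m : m =O[atTop] decaySq κ
  isBigO_I : I =O[atTop] (1 : ℝ → ℝ)
  isBigO_fst : ∀ K, (fun p : ℝ × ℂ => S₁ p.1 p.2 - (m p.1 - p.2 * I p.1)) =O[energyWindow κ K]
    fun p => p.1 * decaySq κ p.1 * decaySq κ p.1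
  isBigO_snd : ∀ K, (fun p : ℝ × ℂ => S₂ p.1 p.2 - 1) =O[energyWindow κ K]
    fun p => p.1 * decaySq κ p.1
  differentiableAt : ∀ K, ∀ᶠ p in energyWindow κ K,
    DifferentiableAt ℂ (S₁ p.1) p.2 ∧ DifferentiableAt ℂ (S₂ p.1) p.2

theorem differentiableAt_outgoingTrace_sqrt {z : ℂ} (hz : 0 < z.re) {M : ℝ} {y y' : ℂ → ℝ → ℂ}
    (hy : DifferentiableAt ℂ (y · M) z) (hy' : DifferentiableAt ℂ (y' · M) z) :
    DifferentiableAt ℂ (fun z => outgoingTrace (Complex.sqrt z) M (y z) (y' z)) z :=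
  hy'.sub (((Complex.differentiableAt_sqrt (Or.inl hz)).const_mul Complex.I).mul hy)

namespace DecayPair

variable {V : ℝ → ℝ} {E κ C c K : ℝ} {u u' v v' : ℝ → ℂ}

theorem isBigO_integral_sq (h : DecayPair V E κ C c u u' v v') (hκ : 0 < κ) :
    (fun M : ℝ => ∫ t in (0 : ℝ)..M, u t ^ 2) =O[atTop] (1 : ℝ → ℝ) :=
  IsBigO.of_bound (C ^ 2 * (1 / (2 * κ)) * 1) ((eventually_ge_atTop 0).mono fun M hM => by
    simpa only [mul_one, Pi.one_apply, norm_one] using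
      h.norm_integral_sq_mul_le hκ (f := fun _ => 1) hM fun _ _ => norm_one.le)

theorem outgoingTrace_div_eq (h : DecayPair V E κ C c u u' v v') {s : ℂ} {M : ℝ}
    (hs : outgoingTrace s M v v' ≠ 0) (y y' : ℝ → ℂ) :
    outgoingTrace s M y y' / outgoingTrace s M v v' =
      wronskian y y' v v' M * (outgoingTrace s M u u' / outgoingTrace s M v v') +
        wronskian u u' y y' M := by
  rw [h.outgoingTrace_eq s M y y']
  field_simp

theorem outgoingTrace_div_isBigO_of_data_u (h : DecayPair V E κ C c u u' v v') (hE : 0 < E)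
    (hκ : 0 < κ) (hc : 0 < c) {y y' : ℂ → ℝ → ℂ}
    (hy : ∀ z, IsSolOn (shiftedPotential V z) (y z) (y' z) univ)
    (h0 : ∀ z, y z 0 = u 0) (h0' : ∀ z, y' z 0 = u' 0) :
    (fun p : ℝ × ℂ =>
        outgoingTrace (Complex.sqrt (E + p.2)) p.1 (y (E + p.2)) (y' (E + p.2)) /
            outgoingTrace (Complex.sqrt (E + p.2)) p.1 v v' -
          (outgoingTrace (Real.sqrt E) p.1 u u' / outgoingTrace (Real.sqrt E) p.1 v v' -
            p.2 * ∫ t in (0 : ℝ)..p.1, u t ^ 2))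
      =O[energyWindow κ K] fun p => p.1 * decaySq κ p.1 * decaySq κ p.1 := by
  have hM := tendsto_fst_energyWindow (κ := κ) (K := K)
  have hs := tendsto_sqrt_energyWindow (K := K) hE hκ
  obtain ⟨hyv, huy⟩ := h.wronskian_asymptotics_of_data_u (K := K) hκ
    (fun l => hy (E + l)) (fun l => h0 (E + l)) (fun l => h0' (E + l))
  have hm := (h.isBigO_outgoingTrace_div_sub_div (K := K) hE hκ hc).trans
    ((isBigO_mul_of_one_le fun M => decaySq κ M * decaySq κ M).comp_tendsto hM)
  simp only [Function.comp_def, ← mul_assoc] at hm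
  refine ((huy.add (hyv.mul (h.isBigO_outgoingTrace_div hc hM hs))).add hm).congr' ?_ .rfl
  filter_upwards [h.eventually_outgoingTrace_v_ne_zero hc hM hs] with p hp
  rw [h.outgoingTrace_div_eq hp (y (E + p.2))]
  ring

theorem outgoingTrace_div_isBigO_of_data_v (h : DecayPair V E κ C c u u' v v') (hE : 0 < E)
    (hκ : 0 < κ) (hc : 0 < c) {z z' : ℂ → ℝ → ℂ}
    (hz : ∀ l, IsSolOn (shiftedPotential V l) (z l) (z' l) univ)
    (h0 : ∀ l, z l 0 = v 0) (h0' : ∀ l, z' l 0 = v' 0) :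
    (fun p : ℝ × ℂ =>
        outgoingTrace (Complex.sqrt (E + p.2)) p.1 (z (E + p.2)) (z' (E + p.2)) /
            outgoingTrace (Complex.sqrt (E + p.2)) p.1 v v' - 1)
      =O[energyWindow κ K] fun p => p.1 * decaySq κ p.1 := by
  have hM := tendsto_fst_energyWindow (κ := κ) (K := K)
  have hs := tendsto_sqrt_energyWindow (K := K) hE hκ
  obtain ⟨hzv, huz⟩ := h.wronskian_asymptotics_of_data_v (K := K) hκ
    (fun l => hz (E + l)) (fun l => h0 (E + l)) (fun l => h0' (E + l))
  have hm := (hzv.mul (h.isBigO_outgoingTrace_div hc hM hs)).trans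
    (((isBigO_mul_of_one_le (decaySq κ)).comp_tendsto hM).congr_left fun p =>
      by simp only [Function.comp_apply, Pi.one_apply, one_mul])
  refine (hm.add huz).congr' ?_ .rfl
  filter_upwards [h.eventually_outgoingTrace_v_ne_zero hc hM hs] with p hp
  rw [h.outgoingTrace_div_eq hp (z (E + p.2))]
  ring

theorem traceAsymptotics (h : DecayPair V E κ C c u u' v v') (hE : 0 < E) (hκ : 0 < κ) (hc : 0 < c)
    {y y' z z' : ℂ → ℝ → ℂ}
    (hy : ∀ l, IsSolOn (shiftedPotential V l) (y l) (y' l) univ)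
    (hy0 : ∀ l, y l 0 = u 0) (hy0' : ∀ l, y' l 0 = u' 0)
    (hyd : ∀ x, Differentiable ℂ (y · x) ∧ Differentiable ℂ (y' · x))
    (hz : ∀ l, IsSolOn (shiftedPotential V l) (z l) (z' l) univ)
    (hz0 : ∀ l, z l 0 = v 0) (hz0' : ∀ l, z' l 0 = v' 0)
    (hzd : ∀ x, Differentiable ℂ (z · x) ∧ Differentiable ℂ (z' · x)) :
    TraceAsymptotics κ
      (fun M l => outgoingTrace (Complex.sqrt (E + l)) M (y (E + l)) (y' (E + l)) /
        outgoingTrace (Complex.sqrt (E + l)) M v v')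
      (fun M l => outgoingTrace (Complex.sqrt (E + l)) M (z (E + l)) (z' (E + l)) /
        outgoingTrace (Complex.sqrt (E + l)) M v v')
      (fun M => outgoingTrace (Real.sqrt E) M u u' / outgoingTrace (Real.sqrt E) M v v')
      (fun M => ∫ t in (0 : ℝ)..M, u t ^ 2) where
  isBigO_m := h.isBigO_outgoingTrace_div hc tendsto_id tendsto_const_nhds
  isBigO_I := h.isBigO_integral_sq hκ
  isBigO_fst _ := h.outgoingTrace_div_isBigO_of_data_u hE hκ hc hy hy0 hy0'
  isBigO_snd _ := h.outgoingTrace_div_isBigO_of_data_v hE hκ hc hz hz0 hz0'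
  differentiableAt K := by
    have hs := tendsto_sqrt_energyWindow (K := K) hE hκ
    filter_upwards [eventually_re_pos_energyWindow hE hκ,
      h.eventually_outgoingTrace_v_ne_zero hc tendsto_fst_energyWindow hs] with p hp hne
    have trace {f f' : ℂ → ℝ → ℂ} (hf : ∀ x, Differentiable ℂ (f · x) ∧ Differentiable ℂ (f' · x)) :
        DifferentiableAt ℂ (fun l : ℂ =>
          outgoingTrace (Complex.sqrt (E + l)) p.1 (f (E + l)) (f' (E + l))) p.2 :=
      (differentiableAt_outgoingTrace_sqrt hp ((hf p.1).1 _) ((hf p.1).2 _)).comp p.2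
        (differentiableAt_id.const_add _)
    have hv : DifferentiableAt ℂ
        (fun l : ℂ => outgoingTrace (Complex.sqrt (E + l)) p.1 v v') p.2 :=
      trace (f := fun _ => v) (f' := fun _ => v') fun _ =>
        ⟨differentiable_const _, differentiable_const _⟩
    exact ⟨(trace hyd).div hv hne, (trace hzd).div hv hne⟩

end DecayPair

end TraceAsymptotics

section Matching

open Filter Asymptotics Topology

theorem norm_deriv_le_div_of_norm_sub_le {g : ℂ → ℂ} {b : ℂ} {r δ : ℝ} (hr : 0 < r)
    (hgd : DifferentiableOn ℂ g (Metric.ball 0 (3 * r)))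
    (hg : ∀ l ∈ Metric.ball (0 : ℂ) (3 * r), ‖g l - b‖ ≤ δ) {l : ℂ}
    (hl : l ∈ Metric.closedBall (0 : ℂ) r) : ‖deriv g l‖ ≤ δ / r := by
  have hsub : Metric.closedBall l r ⊆ Metric.ball 0 (3 * r) :=
    (Metric.closedBall_subset_closedBall' (by
      rw [Metric.mem_closedBall] at hl; linarith : r + dist l 0 ≤ 2 * r)).trans
        (Metric.closedBall_subset_ball (by linarith))
  have hdc : DiffContOnCl ℂ (fun w => g w - b) (Metric.ball l r) := by
    refine DifferentiableOn.diffContOnCl ?_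
    rw [closure_ball l hr.ne']
    exact (hgd.mono hsub).sub (differentiableOn_const _)
  rw [← deriv_sub_const (f := g) b]
  exact Complex.norm_deriv_le_of_forall_mem_sphere_norm_le hr hdc fun w hw =>
    hg w (hsub (Metric.sphere_subset_closedBall hw))

theorem exists_fixedPoint_of_norm_sub_le {g : ℂ → ℂ} {b : ℂ} {r δ : ℝ} (hr : 0 < r)
    (hgd : DifferentiableOn ℂ g (Metric.ball 0 (3 * r)))
    (hg : ∀ l ∈ Metric.ball (0 : ℂ) (3 * r), ‖g l - b‖ ≤ δ)
    (hb : ‖b‖ ≤ r / 2) (hδ : δ ≤ r / 4) : ∃ l, ‖l‖ ≤ r ∧ g l = l := by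
  have hball : Metric.closedBall (0 : ℂ) r ⊆ Metric.ball 0 (3 * r) :=
    Metric.closedBall_subset_ball (by linarith)
  have hlip : LipschitzOnWith (1 / 4) g (Metric.closedBall 0 r) :=
    (convex_closedBall (0 : ℂ) r).lipschitzOnWith_of_nnnorm_deriv_le
      (fun l hl => (hgd l (hball hl)).differentiableAt (Metric.isOpen_ball.mem_nhds (hball hl)))
      fun l hl => by
        have hderiv : ‖deriv g l‖ ≤ 1 / 4 := by
          refine (norm_deriv_le_div_of_norm_sub_le hr hgd hg hl).trans ?_
          rw [div_le_iff₀ hr]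
          linarith
        rw [← NNReal.coe_le_coe]
        simpa using hderiv
  have hmaps : MapsTo g (Metric.closedBall 0 r) (Metric.closedBall 0 r) := fun l hl => by
    rw [mem_closedBall_zero_iff]
    have htri := norm_add_le (g l - b) b
    rw [sub_add_cancel] at htri
    linarith [hg l (hball hl)]
  have hcontr : ContractingWith (1 / 4) (hmaps.restrict g _ _) :=
    ⟨by rw [← NNReal.coe_lt_coe]; norm_num, hlip.mapsToRestrict hmaps⟩
  obtain ⟨l, hl, hfix, -⟩ := hcontr.exists_fixedPoint' Metric.isClosed_closedBall.isComplete hmaps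
    (x := 0) (by simp [hr.le]) (edist_ne_top _ _)
  exact ⟨l, mem_closedBall_zero_iff.1 hl, hfix⟩

theorem exists_zero_near_affine {f : ℂ → ℂ} {m I : ℂ} {r ε I₀ : ℝ} (hr : 0 < r) (hI₀ : 0 < I₀)
    (hI : I₀ ≤ ‖I‖) (hd : DifferentiableOn ℂ f (Metric.ball 0 (3 * r)))
    (hf : ∀ l ∈ Metric.ball (0 : ℂ) (3 * r), ‖f l - (m - l * I)‖ ≤ ε)
    (hm : ‖m‖ ≤ I₀ * (r / 2)) (hε : ε ≤ I₀ * (r / 4)) :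
    ∃ l : ℂ, ‖l‖ ≤ r ∧ f l = 0 ∧ ‖l - m / I‖ ≤ ε / I₀ := by
  have hI0 : I ≠ 0 := norm_pos_iff.1 (hI₀.trans_le hI)
  have hg : ∀ l ∈ Metric.ball (0 : ℂ) (3 * r), ‖l + f l / I - m / I‖ ≤ ε / I₀ := fun l hl => by
    have hrw : l + f l / I - m / I = (f l - (m - l * I)) / I := by field_simp; ring
    rw [hrw, norm_div]
    exact div_le_div₀ ((norm_nonneg _).trans (hf l hl)) (hf l hl) hI₀ hI
  obtain ⟨l, hlr, hfix⟩ := exists_fixedPoint_of_norm_sub_le hr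
    (differentiableOn_id.add (hd.div_const I)) hg
    (by rw [norm_div, div_le_iff₀' (hI₀.trans_le hI)]; exact hm.trans (by gcongr))
    ((div_le_iff₀' hI₀).2 hε)
  refine ⟨l, hlr, ?_, ?_⟩
  · exact (div_eq_zero_iff.1 (add_eq_left.1 hfix)).resolve_right hI0
  · have hl := hg l (mem_ball_zero_iff.2 (by linarith))
    rwa [show l + f l / I = l from hfix] at hl

theorem exists_zero_of_isBigO_affine {κ I₀ : ℝ} (hκ : 0 < κ) (hI₀ : 0 < I₀) {f : ℝ → ℂ → ℂ}
    {m I : ℝ → ℂ} (hm : m =O[atTop] decaySq κ) (hI : ∀ᶠ M in atTop, I₀ ≤ ‖I M‖)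
    (hf : ∀ K, (fun p : ℝ × ℂ => f p.1 p.2 - (m p.1 - p.2 * I p.1)) =O[energyWindow κ K]
      fun p => p.1 * decaySq κ p.1 * decaySq κ p.1)
    (hd : ∀ K, ∀ᶠ p in energyWindow κ K, DifferentiableAt ℂ (f p.1) p.2) :
    ∃ l : ℝ → ℂ, (∃ K, ∀ᶠ M in atTop, ‖l M‖ ≤ K * decaySq κ M) ∧
      (∀ᶠ M in atTop, f M (l M) = 0) ∧
      (fun M => l M - m M / I M) =O[atTop] fun M => M * decaySq κ M * decaySq κ M := by
  obtain ⟨B, hB, hmB⟩ := hm.exists_pos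
  set r : ℝ → ℝ := fun M => 2 * (B / I₀) * decaySq κ M
  obtain ⟨D, hfD⟩ := (hf (3 * (2 * (B / I₀)))).bound
  have hsmall : Tendsto (fun M => D * (M * decaySq κ M)) atTop (𝓝 0) := by
    simpa only [mul_zero] using (tendsto_mul_decaySq hκ).const_mul D
  have hzero : ∀ᶠ M in atTop, ∃ l : ℂ, ‖l‖ ≤ r M ∧ f M l = 0 ∧
      ‖l - m M / I M‖ ≤ D * ‖M * decaySq κ M * decaySq κ M‖ / I₀ := by
    filter_upwards [hmB.bound, eventually_energyWindow.1 hfD, eventually_energyWindow.1 (hd _), hI,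
      hsmall.eventually (ge_mem_nhds (half_pos hB)), eventually_ge_atTop 0]
      with M hmM hfM hdM hIM hM hM0
    have he : 0 < decaySq κ M := Real.exp_pos _
    have hwindow {l : ℂ} (hl : l ∈ Metric.ball (0 : ℂ) (3 * r M)) :
        ‖l‖ ≤ 3 * (2 * (B / I₀)) * decaySq κ M := by
      rw [mul_assoc]
      exact (mem_ball_zero_iff.1 hl).le
    refine exists_zero_near_affine (by positivity) hI₀ hIM
      (fun l hl => (hdM l (hwindow hl)).differentiableWithinAt) (fun l hl => hfM l (hwindow hl))
      (hmM.trans_eq ?_) ?_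
    · simp only [r]
      rw [Real.norm_of_nonneg he.le]
      field_simp
    · rw [Real.norm_of_nonneg (by positivity)]
      calc D * (M * decaySq κ M * decaySq κ M) = D * (M * decaySq κ M) * decaySq κ M := by ring
        _ ≤ B / 2 * decaySq κ M := by gcongr
        _ = I₀ * (r M / 4) := by simp only [r]; field_simp; norm_num
  obtain ⟨l, hl⟩ := hzero.choice
  exact ⟨l, ⟨_, hl.mono fun _ h => h.1⟩, hl.mono fun _ h => h.2.1,
    IsBigO.of_bound (D / I₀) (hl.mono fun _ h => h.2.2.trans_eq (mul_div_right_comm _ _ _))⟩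

namespace TraceAsymptotics

variable {κ K : ℝ} {S₁ S₂ T₁ T₂ : ℝ → ℂ → ℂ} {m₁ m₂ I₁ I₂ : ℝ → ℂ}

theorem isBigO_affine (hS : TraceAsymptotics κ S₁ S₂ m₁ I₁) :
    (fun p : ℝ × ℂ => m₁ p.1 - p.2 * I₁ p.1) =O[energyWindow κ K] fun p => decaySq κ p.1 := by
  have hI := (isBigO_snd_energyWindow (κ := κ) (K := K)).mul
    (hS.isBigO_I.comp_tendsto tendsto_fst_energyWindow)
  simp only [Function.comp_def, Pi.one_apply, mul_one] at hI
  exact (hS.isBigO_m.comp_tendsto tendsto_fst_energyWindow).sub hI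

theorem isBigO_fst_self (hκ : 0 < κ) (hS : TraceAsymptotics κ S₁ S₂ m₁ I₁) :
    (fun p : ℝ × ℂ => S₁ p.1 p.2) =O[energyWindow κ K] fun p => decaySq κ p.1 := by
  have hXe := (((tendsto_mul_decaySq hκ).comp (tendsto_fst_energyWindow (K := K))).isBigO_one ℝ).mul
    (isBigO_refl (fun p : ℝ × ℂ => decaySq κ p.1) (energyWindow κ K))
  simp only [Function.comp_def, one_mul] at hXe
  exact (((hS.isBigO_fst K).trans hXe).add hS.isBigO_affine).congr_left fun p => by ring

theorem tendsto_snd (hκ : 0 < κ) (hS : TraceAsymptotics κ S₁ S₂ m₁ I₁) :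
    Tendsto (fun p : ℝ × ℂ => S₂ p.1 p.2) (energyWindow κ K) (𝓝 1) :=
  tendsto_sub_nhds_zero_iff.1 ((hS.isBigO_snd K).trans_tendsto
    ((tendsto_mul_decaySq hκ).comp tendsto_fst_energyWindow))

theorem isBigO_mul_snd (hκ : 0 < κ) (hS : TraceAsymptotics κ S₁ S₂ m₁ I₁)
    (hT : TraceAsymptotics κ T₁ T₂ m₂ I₂) :
    (fun p : ℝ × ℂ => S₁ p.1 p.2 * T₂ p.1 p.2 - (m₁ p.1 - p.2 * I₁ p.1)) =O[energyWindow κ K]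
      fun p => p.1 * decaySq κ p.1 * decaySq κ p.1 := by
  have hT₂ := hT.tendsto_snd (K := K) hκ
  have hfst := (hS.isBigO_fst K).mul (hT₂.isBigO_one ℝ)
  have hsnd := (hT.isBigO_snd K).mul hS.isBigO_affine
  simp only [mul_one] at hfst
  refine (hfst.add hsnd).congr_left fun p => ?_
  ring

theorem exists_matching (hκ : 0 < κ) (hS : TraceAsymptotics κ S₁ S₂ m₁ I₁)
    (hT : TraceAsymptotics κ T₁ T₂ m₂ I₂) {I₀ : ℝ} (hI₀ : 0 < I₀)
    (hI : ∀ᶠ M in atTop, I₀ ≤ ‖I₁ M + I₂ M‖) :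
    ∃ l τ : ℝ → ℂ, (∃ K, ∀ᶠ M in atTop, ‖l M‖ ≤ K * decaySq κ M) ∧
      (∀ᶠ M in atTop, S₁ M (l M) + τ M * S₂ M (l M) = 0 ∧ T₁ M (l M) - τ M * T₂ M (l M) = 0) ∧
      τ =O[atTop] decaySq κ ∧
      (fun M => l M - (m₁ M + m₂ M) / (I₁ M + I₂ M)) =O[atTop]
        (fun M => M * decaySq κ M * decaySq κ M) ∧
      (fun M => τ M - ((m₁ M + m₂ M) / (I₁ M + I₂ M) * I₁ M - m₁ M)) =O[atTop]
        fun M => M * decaySq κ M * decaySq κ M := by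
  obtain ⟨l, ⟨K, hlK⟩, hl0, hl⟩ := exists_zero_of_isBigO_affine hκ hI₀
    (hS.isBigO_m.add hT.isBigO_m) hI
    (f := fun M l => S₁ M l * T₂ M l + T₁ M l * S₂ M l)
    (fun K => ((hS.isBigO_mul_snd hκ hT).add (hT.isBigO_mul_snd hκ hS)).congr_left
      fun p => by ring)
    (fun K => ((hS.differentiableAt K).and (hT.differentiableAt K)).mono fun p hp =>
      (hp.1.1.mul hp.2.2).add (hp.2.1.mul hp.1.2))
  have hwin := tendsto_prodMk_energyWindow hlK
  have hS₂ : Tendsto (fun M => S₂ M (l M)) atTop (𝓝 1) := (hS.tendsto_snd hκ).comp hwin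
  have hS₂ne : ∀ᶠ M in atTop, S₂ M (l M) ≠ 0 := hS₂.eventually_ne one_ne_zero
  have hτ : (fun M => -S₁ M (l M) / S₂ M (l M)) =O[atTop] decaySq κ := by
    have h := (((hS.isBigO_fst_self hκ).neg_left).comp_tendsto hwin).mul
      ((hS₂.inv₀ one_ne_zero).isBigO_one ℝ)
    simp only [mul_one] at h
    exact h.congr_left fun M => (div_eq_mul_inv _ _).symm
  refine ⟨l, fun M => -S₁ M (l M) / S₂ M (l M), ⟨K, hlK⟩, ?_, hτ, hl, ?_⟩
  · filter_upwards [hS₂ne, hl0] with M hne h0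
    refine ⟨by field_simp; ring, ?_⟩
    field_simp
    linear_combination h0
  · have hfst := (hS.isBigO_fst K).comp_tendsto hwin
    have hsnd := hτ.mul ((hS.isBigO_snd K).comp_tendsto hwin)
    have hshift := hl.mul hS.isBigO_I
    simp only [Pi.one_apply, mul_one] at hshift
    have hsnd_rate := hsnd.congr_right (g₂ := fun M => M * decaySq κ M * decaySq κ M) fun M => by
      simp only [Function.comp_apply]; ring
    refine ((hshift.sub hfst).sub hsnd_rate).congr' ?_ .rfl
    filter_upwards [hS₂ne] with M hne
    simp only [Function.comp_apply]
    field_simp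
    ring

end TraceAsymptotics

end Matching

section BoundState

variable {V Vper : ℝ → ℝ} {Φ y y' u u' v v' : ℝ → ℂ} {C E ρ κ a x : ℝ} {w z μ ν : ℂ}

theorem add_one_eq_of_eq_periodic_outside (hV : Continuous V) (hper : Function.Periodic Vper 1)
    (hout : ∀ x, ρ < |x| → V x = Vper x) (hx : ρ ≤ x) : V (x + 1) = V x := by
  have hcl : IsClosed {x | V (x + 1) = V x} := isClosed_eq (by fun_prop) hV
  have hIoi : Ioi ρ ⊆ {x | V (x + 1) = V x} := fun x hx => by
    have hx' : ρ < x := hx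
    rw [mem_ofPred_eq, hout x (hx'.trans_le (le_abs_self x)),
      hout (x + 1) ((by linarith : ρ < x + 1).trans_le (le_abs_self _)), hper]
  have hIci := hcl.closure_subset_iff.2 hIoi
  rw [closure_Ioi] at hIci
  exact hIci hx

theorem neg_add_one_eq_of_eq_periodic_outside (hV : Continuous V) (hper : Function.Periodic Vper 1)
    (hout : ∀ x, ρ < |x| → V x = Vper x) (hx : ρ ≤ x) : V (-(x + 1)) = V (-x) :=
  add_one_eq_of_eq_periodic_outside (V := fun x => V (-x)) (Vper := fun x => Vper (-x))
    (by fun_prop) (fun x => by simp only [neg_add', hper.sub_eq])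
    (fun x hx => hout (-x) (by rwa [abs_neg])) hx

/-- A large integer translation carries an interval at the left end of the line to one at the right
end, where both solutions solve the same equation. -/
theorem IsSolOn.left_right_multipliers_eq (hV : Continuous V) (hper : Function.Periodic Vper 1)
    (hout : ∀ x, ρ < |x| → V x = Vper x) (hy : IsSolOn (shiftedPotential V z) y y' univ)
    (hne : ∃ x, y x ≠ 0) (hμ1 : ‖μ‖ < 1) (hν1 : ‖ν‖ < 1)
    (hμ : ∀ x, ρ ≤ x → y (x + 1) = μ * y x ∧ y' (x + 1) = μ * y' x)
    (hν : ∀ x, ρ ≤ x → y (-(x + 1)) = ν * y (-x) ∧ y' (-(x + 1)) = ν * y' (-x)) : μ = ν := by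
  have hq := continuous_shiftedPotential hV z
  obtain ⟨n, hn⟩ := exists_nat_gt (2 * ρ + 1)
  obtain ⟨a, ha⟩ : ∃ a : ℝ, a + 1 + -n = -a := ⟨(n - 1) / 2, by ring⟩
  have hρa : ρ < a := by linarith
  have haa : a + -n = -(a + 1) := by linarith
  have hv : IsSolOn (shiftedPotential V z) (fun x => y (x + -n)) (fun x => y' (x + -n))
      (Icc a (a + 1)) :=
    ((hy.comp_add_const (-n)).mono (subset_univ _)).congr_coeff fun x hx => by
      simp only [shiftedPotential]
      rw [hout x ((hρa.trans_le hx.1).trans_le (le_abs_self x)),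
        hout (x + -n) ((by linarith [hx.2] : ρ < -(x + -n)).trans_le (neg_le_abs _)),
        ← sub_eq_add_neg, ← mul_one (n : ℝ), hper.sub_nat_mul_eq]
  refine hy.multipliers_eq hq ordConnected_Icc hne hv (left_mem_Icc.2 (by linarith))
    (right_mem_Icc.2 (by linarith)) hμ1 hν1 (hy.ne_zero_or_deriv_ne_zero hq hne _)
    (hμ a hρa.le) ?_
  simpa only [ha, haa] using hν a hρa.le

theorem IsSolOn.exists_common_floquet_multiplier (hV : Continuous V)
    (hper : Function.Periodic Vper 1) (hout : ∀ x, ρ < |x| → V x = Vper x)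
    (hy : IsSolOn (shiftedPotential V z) y y' univ) (hne : ∃ x, y x ≠ 0) (hL2 : MemLp y 2 volume) :
    ∃ μ : ℂ, μ ≠ 0 ∧ ‖μ‖ < 1 ∧
      (∀ x, ρ ≤ x → y (x + 1) = μ * y x ∧ y' (x + 1) = μ * y' x) ∧
      ∀ x, ρ ≤ x → y (-(x + 1)) = μ * y (-x) ∧ y' (-(x + 1)) = μ * y' (-x) := by
  have hq := continuous_shiftedPotential hV z
  obtain ⟨μ, hμ0, hμ1, hμ⟩ := hy.exists_floquet_multiplier hq (ρ := ρ)
    (fun x hx => by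
      simp only [shiftedPotential, add_one_eq_of_eq_periodic_outside hV hper hout hx]) hne
    (hL2.restrict _)
  obtain ⟨ν, -, hν1, hν⟩ := hy.comp_neg.exists_floquet_multiplier (hq.comp continuous_neg) (ρ := ρ)
    (fun x hx => by
      simp only [Function.comp_apply, shiftedPotential,
        neg_add_one_eq_of_eq_periodic_outside hV hper hout hx])
    (by obtain ⟨x, hx⟩ := hne; exact ⟨-x, by rwa [neg_neg]⟩)
    ((hL2.comp_measurePreserving (Measure.measurePreserving_neg volume)).restrict _)
  have hν' (x : ℝ) (hx : ρ ≤ x) : y (-(x + 1)) = ν * y (-x) ∧ y' (-(x + 1)) = ν * y' (-x) :=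
    ⟨(hν x hx).1, by linear_combination -(hν x hx).2⟩
  have hμν := hy.left_right_multipliers_eq hV hper hout hne hμ1 hν1 hμ hν'
  exact ⟨μ, hμ0, hμ1, hμ, hμν ▸ hν'⟩

theorem IsSolOn.im_eq_zero (hV : Continuous V) (hy : IsSolOn (shiftedPotential V E) y y' univ)
    (h0 : starRingEnd ℂ (y 0) = y 0) (h0' : starRingEnd ℂ (y' 0) = y' 0) (x : ℝ) :
    (y x).im = 0 ∧ (y' x).im = 0 := by
  have hconj := hy.conj
  rw [Complex.conj_ofReal] at hconj
  have heq := hconj.eqOn (continuous_shiftedPotential hV E) ordConnected_univ hy (mem_univ 0) h0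
    h0' (mem_univ x)
  exact ⟨Complex.conj_eq_iff_im.1 heq.1, Complex.conj_eq_iff_im.1 heq.2⟩

/-- The constant Wronskian of `y` and `conj y` is multiplied by `‖μ‖²` under `x ↦ x + 1`. -/
theorem IsSolOn.mul_conj_deriv_eq (hy : IsSolOn (shiftedPotential V E) y y' univ) (hμ1 : ‖μ‖ < 1)
    (hμ : y (a + 1) = μ * y a ∧ y' (a + 1) = μ * y' a) (x : ℝ) :
    y x * starRingEnd ℂ (y' x) = y' x * starRingEnd ℂ (y x) := by
  have hconj := hy.conj
  rw [Complex.conj_ofReal] at hconj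
  have hconst (t : ℝ) := wronskian_const ordConnected_univ hy hconj (mem_univ t) (mem_univ a)
  have hstep := hconst (a + 1)
  simp only [wronskian, hμ, map_mul] at hstep
  have hnorm : μ * starRingEnd ℂ μ ≠ 1 := fun h => by
    rw [Complex.mul_conj'] at h
    have : ‖μ‖ ^ 2 = 1 := by exact_mod_cast h
    nlinarith [norm_nonneg μ]
  have hzero :
      wronskian y y' (fun x => starRingEnd ℂ (y x)) (fun x => starRingEnd ℂ (y' x)) a = 0 :=
    (mul_eq_zero.1 (by simp only [wronskian]; linear_combination hstep)).resolve_left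
      (sub_ne_zero.2 hnorm)
  exact sub_eq_zero.1 ((hconst x).trans hzero)

theorem conj_wZero (h : Φ 0 * starRingEnd ℂ (deriv Φ 0) = deriv Φ 0 * starRingEnd ℂ (Φ 0)) :
    starRingEnd ℂ (wZero Φ) = wZero Φ := by
  unfold wZero
  split_ifs with h0
  · exact map_zero _
  · rw [map_div₀, div_eq_div_iff (by simpa using h0) h0]
    linear_combination h

theorem one_add_sq_ne_zero (hw : starRingEnd ℂ w = w) : 1 + w ^ 2 ≠ 0 := by
  obtain ⟨r, rfl⟩ := Complex.conj_eq_iff_real.1 hw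
  have : (1 : ℝ) + r ^ 2 ≠ 0 := by positivity
  exact_mod_cast this

open Classical in
theorem uSol_spec (hV : Continuous V) (Φ : ℝ → ℂ) (w z : ℂ) :
    IsSolOn (shiftedPotential V z) (uSol V Φ w z) (deriv (uSol V Φ w z)) univ ∧
      uSol V Φ w z 0 = (if Φ 0 = 0 then -w else 1) ∧
      deriv (uSol V Φ w z) 0 = if Φ 0 = 0 then 1 else w := by
  unfold uSol
  split_ifs
  exacts [schrodingerSol_spec hV z _ _, schrodingerSol_spec hV z _ _]

open Classical in
theorem vSol_spec (hV : Continuous V) (Φ : ℝ → ℂ) (w z : ℂ) :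
    IsSolOn (shiftedPotential V z) (vSol V Φ w z) (deriv (vSol V Φ w z)) univ ∧
      vSol V Φ w z 0 = (if Φ 0 = 0 then -1 else -w) / (1 + w ^ 2) ∧
      deriv (vSol V Φ w z) 0 = (if Φ 0 = 0 then -w else 1) / (1 + w ^ 2) := by
  unfold vSol
  split_ifs
  exacts [schrodingerSol_spec hV z _ _, schrodingerSol_spec hV z _ _]

theorem differentiable_uSol (hV : Continuous V) (Φ : ℝ → ℂ) (w : ℂ) (x : ℝ) :
    Differentiable ℂ (fun z => uSol V Φ w z x) ∧
      Differentiable ℂ (fun z => deriv (uSol V Φ w z) x) := by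
  unfold uSol
  split_ifs
  exacts [differentiable_schrodingerSol hV _ _ x, differentiable_schrodingerSol hV _ _ x]

theorem differentiable_vSol (hV : Continuous V) (Φ : ℝ → ℂ) (w : ℂ) (x : ℝ) :
    Differentiable ℂ (fun z => vSol V Φ w z x) ∧
      Differentiable ℂ (fun z => deriv (vSol V Φ w z) x) := by
  unfold vSol
  split_ifs
  exacts [differentiable_schrodingerSol hV _ _ x, differentiable_schrodingerSol hV _ _ x]

theorem wronskian_uSol_vSol (hV : Continuous V) (Φ : ℝ → ℂ) (hw : 1 + w ^ 2 ≠ 0) (z : ℂ) (x : ℝ) :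
    wronskian (uSol V Φ w z) (deriv (uSol V Φ w z)) (vSol V Φ w z) (deriv (vSol V Φ w z)) x =
      1 := by
  obtain ⟨hu, hu0, hu0'⟩ := uSol_spec hV Φ w z
  obtain ⟨hv, hv0, hv0'⟩ := vSol_spec hV Φ w z
  rw [wronskian_const ordConnected_univ hu hv (mem_univ x) (mem_univ 0)]
  simp only [wronskian, hu0, hu0', hv0, hv0']
  split_ifs <;>
  · field_simp
    ring

theorem vSol_im_eq_zero (hV : Continuous V) (Φ : ℝ → ℂ) (hw : starRingEnd ℂ w = w) (x : ℝ) :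
    (vSol V Φ w E x).im = 0 ∧ (deriv (vSol V Φ w E) x).im = 0 := by
  obtain ⟨hv, hv0, hv0'⟩ := vSol_spec hV Φ w E
  refine hv.im_eq_zero hV ?_ ?_ x
  · rw [hv0]; split_ifs <;> simp [hw]
  · rw [hv0']; split_ifs <;> simp [hw]

theorem uSol_im_eq_zero (hV : Continuous V) (Φ : ℝ → ℂ) (hw : starRingEnd ℂ w = w) (x : ℝ) :
    (uSol V Φ w E x).im = 0 ∧ (deriv (uSol V Φ w E) x).im = 0 := by
  obtain ⟨hu, hu0, hu0'⟩ := uSol_spec hV Φ w E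
  refine hu.im_eq_zero hV ?_ ?_ x
  · rw [hu0]; split_ifs <;> simp [hw]
  · rw [hu0']; split_ifs <;> simp [hw]

theorem uSol_ne_zero_or_deriv_ne_zero (hV : Continuous V) (Φ : ℝ → ℂ) (w z : ℂ) (x : ℝ) :
    uSol V Φ w z x ≠ 0 ∨ deriv (uSol V Φ w z) x ≠ 0 := by
  obtain ⟨hu, hu0, hu0'⟩ := uSol_spec hV Φ w z
  by_contra! h
  have hzero := hu.eq_zero (continuous_shiftedPotential hV z) ordConnected_univ (mem_univ x) h.1
    h.2 (mem_univ 0)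
  rw [hu0, hu0'] at hzero
  split_ifs at hzero
  exacts [one_ne_zero hzero.2, one_ne_zero hzero.1]

theorem uSol_add (hV : Continuous V) (Φ : ℝ → ℂ) (hw : 1 + w ^ 2 ≠ 0) (d z : ℂ) (x : ℝ) :
    uSol V Φ (w + d) z x =
        (1 + w / (1 + w ^ 2) * d) * uSol V Φ w z x + d * vSol V Φ w z x ∧
      deriv (uSol V Φ (w + d) z) x =
        (1 + w / (1 + w ^ 2) * d) * deriv (uSol V Φ w z) x + d * deriv (vSol V Φ w z) x := by
  obtain ⟨hd, hd0, hd0'⟩ := uSol_spec hV Φ (w + d) z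
  obtain ⟨hu, hu0, hu0'⟩ := uSol_spec hV Φ w z
  obtain ⟨hv, hv0, hv0'⟩ := vSol_spec hV Φ w z
  refine hd.eqOn_linear_comb (continuous_shiftedPotential hV z) ordConnected_univ hu hv
    (mem_univ 0) ?_ ?_ (mem_univ x)
  · rw [hd0, hu0, hv0]
    split_ifs <;>
    · field_simp
      ring
  · rw [hd0', hu0', hv0']
    split_ifs <;>
    · field_simp
      ring

theorem exists_uSol_eq_const_mul (hV : Continuous V)
    (hΦ : IsSolOn (shiftedPotential V z) Φ (deriv Φ) univ) (hne : ∃ x, Φ x ≠ 0) :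
    ∃ k : ℂ, ∀ x, uSol V Φ (wZero Φ) z x = k * Φ x ∧
      deriv (uSol V Φ (wZero Φ) z) x = k * deriv Φ x := by
  obtain ⟨hu, hu0, hu0'⟩ := uSol_spec hV Φ (wZero Φ) z
  have hq := continuous_shiftedPotential hV z
  suffices hk : ∃ k : ℂ, uSol V Φ (wZero Φ) z 0 = k * Φ 0 ∧
      deriv (uSol V Φ (wZero Φ) z) 0 = k * deriv Φ 0 by
    obtain ⟨k, hk⟩ := hk
    exact ⟨k, fun x => hu.eqOn hq ordConnected_univ (hΦ.const_mul k) (mem_univ 0) hk.1 hk.2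
      (mem_univ x)⟩
  rw [hu0, hu0', wZero]
  split_ifs with h
  · have hne' : deriv Φ 0 ≠ 0 := (hΦ.ne_zero_or_deriv_ne_zero hq hne 0).resolve_left (by simp [h])
    exact ⟨(deriv Φ 0)⁻¹, by simp [h], (inv_mul_cancel₀ hne').symm⟩
  · exact ⟨(Φ 0)⁻¹, (inv_mul_cancel₀ h).symm, div_eq_inv_mul _ _⟩

theorem norm_le_norm_sub_I_mul {p p' : ℂ} (hp : p.im = 0) (hp' : p'.im = 0) (σ : ℝ) :
    ‖p'‖ ≤ ‖p' - Complex.I * σ * p‖ ∧ |σ| * ‖p‖ ≤ ‖p' - Complex.I * σ * p‖ := by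
  lift p to ℝ using hp
  lift p' to ℝ using hp'
  constructor
  · simpa using Complex.abs_re_le_norm ((p' : ℂ) - Complex.I * σ * p)
  · simpa [abs_mul] using Complex.abs_im_le_norm ((p' : ℂ) - Complex.I * σ * p)

/-- Since `v` is real, `‖v' - i √E v‖` controls both `‖v'‖` and `‖v‖`; the decay of `u` and
`u v' - u' v = 1` then force it to grow. -/
theorem exists_mul_exp_le_norm_deriv_sub (hE : 0 < E) (hC : 0 < C)
    (hW : ∀ x, wronskian u u' v v' x = 1) (hvr : ∀ x, (v x).im = 0 ∧ (v' x).im = 0)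
    (hu : ∀ x, 0 ≤ x → ‖u x‖ ≤ C * Real.exp (-κ * x) ∧ ‖u' x‖ ≤ C * Real.exp (-κ * x)) :
    ∃ c, 0 < c ∧ ∀ x, 0 ≤ x →
      c * Real.exp (κ * x) ≤ ‖v' x - Complex.I * (Real.sqrt E : ℂ) * v x‖ := by
  have hσ : 0 < Real.sqrt E := Real.sqrt_pos.2 hE
  refine ⟨(C * (1 + 1 / Real.sqrt E))⁻¹, by positivity, fun x hx => ?_⟩
  set n := ‖v' x - Complex.I * (Real.sqrt E : ℂ) * v x‖
  obtain ⟨hv', hv⟩ := norm_le_norm_sub_I_mul (hvr x).1 (hvr x).2 (Real.sqrt E)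
  rw [abs_of_pos hσ] at hv
  have hone : (1 : ℝ) ≤ C * Real.exp (-κ * x) * ((1 + 1 / Real.sqrt E) * n) :=
    calc (1 : ℝ) = ‖wronskian u u' v v' x‖ := by rw [hW, norm_one]
      _ ≤ ‖u x‖ * ‖v' x‖ + ‖u' x‖ * ‖v x‖ := by
        rw [← norm_mul, ← norm_mul]; exact norm_sub_le _ _
      _ ≤ C * Real.exp (-κ * x) * n + C * Real.exp (-κ * x) * (n / Real.sqrt E) := by
        gcongr
        exacts [(hu x hx).1, (hu x hx).2, (le_div_iff₀' hσ).2 hv]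
      _ = C * Real.exp (-κ * x) * ((1 + 1 / Real.sqrt E) * n) := by ring
  rw [inv_mul_le_iff₀ (by positivity)]
  calc Real.exp (κ * x)
      ≤ Real.exp (κ * x) * (C * Real.exp (-κ * x) * ((1 + 1 / Real.sqrt E) * n)) :=
        le_mul_of_one_le_right (Real.exp_pos _).le hone
    _ = C * (1 + 1 / Real.sqrt E) * n := by
        linear_combination C * (1 + 1 / Real.sqrt E) * n * exp_neg_mul_mul_exp_mul κ x

theorem exists_decayPair (hV : Continuous V) (hE : 0 < E) (hρ : 0 ≤ ρ) (hκ : 0 < κ)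
    (hper : ∀ x, ρ ≤ x → V (x + 1) = V x) (hu : IsSolOn (shiftedPotential V E) u u' univ)
    (hv : IsSolOn (shiftedPotential V E) v v' univ) (hW : ∀ x, wronskian u u' v v' x = 1)
    (hμ : ‖μ‖ = Real.exp (-κ))
    (hμu : ∀ x, ρ ≤ x → u (x + 1) = μ * u x ∧ u' (x + 1) = μ * u' x)
    (hvr : ∀ x, (v x).im = 0 ∧ (v' x).im = 0) :
    ∃ C c : ℝ, 0 < c ∧ DecayPair V E κ C c u u' v v' := by
  obtain ⟨C, hC, hb⟩ := exists_floquet_exp_bounds (continuous_shiftedPotential hV E) hρ hκ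
    (fun x hx => by simp only [shiftedPotential, hper x hx]) hu hv hW hμ hμu
  obtain ⟨c, hc, hlower⟩ := exists_mul_exp_le_norm_deriv_sub hE hC hW hvr
    fun x hx => ⟨(hb x hx).1, (hb x hx).2.1⟩
  exact ⟨C, c, hc, hu, hv, hW, fun x hx => (hb x hx).1, fun x hx => (hb x hx).2.1,
    fun x hx => (hb x hx).2.2.1, fun x hx => (hb x hx).2.2.2, hlower⟩

theorem IsBoundState.exists_floquet_exponent (hV : Continuous V)
    (hper : Function.Periodic Vper 1) (hout : ∀ x, ρ < |x| → V x = Vper x) (hρ : 0 ≤ ρ)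
    (hE : 0 < E) (hΦ : IsBoundState V E Φ) :
    starRingEnd ℂ (wZero Φ) = wZero Φ ∧ ∃ κ : ℝ, 0 < κ ∧
      (∃ μ : ℂ, ‖μ‖ = Real.exp (-κ) ∧ ∀ x : ℝ, ρ ≤ x → Φ (x + 1) = μ * Φ x) ∧
      (∃ C c : ℝ, 0 < c ∧
        DecayPair V E κ C c (uSol V Φ (wZero Φ) E) (deriv (uSol V Φ (wZero Φ) E))
          (vSol V Φ (wZero Φ) E) (deriv (vSol V Φ (wZero Φ) E))) ∧
      ∃ C c : ℝ, 0 < c ∧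
        DecayPair (fun x => V (-x)) E κ C c (fun x => uSol V Φ (wZero Φ) E (-x))
          (fun x => -deriv (uSol V Φ (wZero Φ) E) (-x))
          (fun x => -vSol V Φ (wZero Φ) E (-x)) (fun x => deriv (vSol V Φ (wZero Φ) E) (-x)) := by
  obtain ⟨hne, hL2, heq⟩ := hΦ
  have hsol := (schrodingerEq_iff hV E Φ).1 heq
  have hne' : ∃ x, Φ x ≠ 0 := Function.ne_iff.1 hne
  obtain ⟨μ, hμ0, hμ1, hμ, hν⟩ := hsol.exists_common_floquet_multiplier hV hper hout hne' hL2
  have hwr := conj_wZero (hsol.mul_conj_deriv_eq hμ1 (hμ ρ le_rfl) 0)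
  have hκ : 0 < -Real.log ‖μ‖ := neg_pos.2 (Real.log_neg (norm_pos_iff.2 hμ0) hμ1)
  have hexp : ‖μ‖ = Real.exp (-(-Real.log ‖μ‖)) := by
    rw [neg_neg, Real.exp_log (norm_pos_iff.2 hμ0)]
  have hu := (uSol_spec hV Φ (wZero Φ) E).1
  have hv := (vSol_spec hV Φ (wZero Φ) E).1
  have hW := wronskian_uSol_vSol hV Φ (one_add_sq_ne_zero hwr) E
  have hvr := vSol_im_eq_zero (E := E) hV Φ hwr
  obtain ⟨k, hk⟩ := exists_uSol_eq_const_mul hV hsol hne'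
  refine ⟨hwr, -Real.log ‖μ‖, hκ, ⟨μ, hexp, fun x hx => (hμ x hx).1⟩, ?_, ?_⟩
  · refine exists_decayPair hV hE hρ hκ
      (fun x hx => add_one_eq_of_eq_periodic_outside hV hper hout hx) hu hv hW hexp
      (fun x hx => ?_) hvr
    simp only [hk, hμ x hx, mul_left_comm, and_self]
  · have hv_neg : IsSolOn (fun x => shiftedPotential V E (-x))
        (fun x => -vSol V Φ (wZero Φ) E (-x)) (fun x => deriv (vSol V Φ (wZero Φ) E) (-x))
        univ := by
      simpa using hv.comp_neg.const_mul (-1)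
    refine exists_decayPair (hV.comp continuous_neg) hE hρ hκ
      (fun x hx => neg_add_one_eq_of_eq_periodic_outside hV hper hout hx) hu.comp_neg hv_neg
      (fun x => ?_) hexp (fun x hx => ?_) (fun x => by simpa using hvr (-x))
    · rw [← hW (-x), wronskian, wronskian]; ring
    · simp only [hk, hν x hx, mul_left_comm, mul_neg, and_self]

end BoundState

section ResonanceParameters

open Filter Asymptotics Topology

variable {V : ℝ → ℝ} {Φ u v : ℝ → ℂ} {E κ C c C' c' : ℝ} {w : ℂ}

theorem integral_comp_neg_add_integral (hu : Continuous u) (M : ℝ) :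
    (∫ t in (0 : ℝ)..M, u t ^ 2) + (∫ t in (0 : ℝ)..M, u (-t) ^ 2) = ∫ t in (-M)..M, u t ^ 2 := by
  have hu2 : Continuous fun t => u t ^ 2 := by fun_prop
  rw [intervalIntegral.integral_comp_neg (fun t => u t ^ 2), neg_zero, add_comm]
  exact intervalIntegral.integral_add_adjacent_intervals (hu2.intervalIntegrable _ _)
    (hu2.intervalIntegrable _ _)

theorem integral_norm_sq_le_norm_integral_sq (hu : Continuous u) (him : ∀ x, (u x).im = 0)
    {a M : ℝ} (ha : 0 ≤ a) (haM : a ≤ M) :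
    ∫ t in (-a)..a, ‖u t‖ ^ 2 ≤ ‖∫ t in (-M)..M, u t ^ 2‖ := by
  have hsq (t : ℝ) : u t ^ 2 = ((‖u t‖ ^ 2 : ℝ) : ℂ) := by
    rw [← Complex.re_add_im (u t), him t]
    simp
  simp_rw [hsq]
  rw [intervalIntegral.integral_ofReal, Complex.norm_real]
  have hu2 : Continuous fun t => ‖u t‖ ^ 2 := by fun_prop
  exact (intervalIntegral.integral_mono_interval (by linarith) (by linarith) haM
    (Eventually.of_forall fun t => by positivity) (hu2.intervalIntegrable _ _)).trans
      (Real.le_norm_self _)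

theorem bMinus_eq_neg_outgoingTrace (E M : ℝ) (y : ℝ → ℂ) :
    bMinus E M y =
      -outgoingTrace (Real.sqrt E) M (fun x => y (-x)) (fun x => -deriv y (-x)) := by
  simp only [bMinus, outgoingTrace]
  ring

theorem bMinus_eq_outgoingTrace_neg (E M : ℝ) (y : ℝ → ℂ) :
    bMinus E M y = outgoingTrace (Real.sqrt E) M (fun x => -y (-x)) (fun x => deriv y (-x)) := by
  simp only [bMinus, outgoingTrace]
  ring

section Approximation

variable {M : ℝ} {m₁ m₂ I₁ I₂ : ℂ}

theorem zApprox_eq (hI : I₁ + I₂ = ∫ t in (-M)..M, u t ^ 2) (hI0 : I₁ + I₂ ≠ 0)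
    (hv : bPlus E M v ≠ 0) (hv' : bMinus E M v ≠ 0) (hm₁ : m₁ = bPlus E M u / bPlus E M v)
    (hm₂ : m₂ = -bMinus E M u / bMinus E M v) :
    zApprox E M u v = E + (m₁ + m₂) / (I₁ + I₂) := by
  rw [zApprox, corrDenom, ← hI, hm₁, hm₂]
  field_simp
  ring

theorem wApprox_eq (w₀ : ℂ) (hI₁ : I₁ = ∫ t in (0 : ℝ)..M, u t ^ 2)
    (hI₂ : I₂ = ∫ t in (-M)..0, u t ^ 2) (hI : I₁ + I₂ = ∫ t in (-M)..M, u t ^ 2)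
    (hI0 : I₁ + I₂ ≠ 0) (hv : bPlus E M v ≠ 0) (hv' : bMinus E M v ≠ 0)
    (hm₁ : m₁ = bPlus E M u / bPlus E M v) (hm₂ : m₂ = -bMinus E M u / bMinus E M v) :
    wApprox w₀ E M u v = w₀ + ((m₁ + m₂) / (I₁ + I₂) * I₁ - m₁) := by
  rw [wApprox, corrDenom, ← hI, ← hI₁, ← hI₂, hm₁, hm₂]
  field_simp
  ring

end Approximation

theorem outgoingTrace_uSol_add (hV : Continuous V) (Φ : ℝ → ℂ) (hw : 1 + w ^ 2 ≠ 0) (d z s : ℂ)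
    (M : ℝ) :
    outgoingTrace s M (uSol V Φ (w + d) z) (deriv (uSol V Φ (w + d) z)) =
        (1 + w / (1 + w ^ 2) * d) * outgoingTrace s M (uSol V Φ w z) (deriv (uSol V Φ w z)) +
          d * outgoingTrace s M (vSol V Φ w z) (deriv (vSol V Φ w z)) ∧
      outgoingTrace s M (fun x => uSol V Φ (w + d) z (-x))
          (fun x => -deriv (uSol V Φ (w + d) z) (-x)) =
        (1 + w / (1 + w ^ 2) * d) * outgoingTrace s M (fun x => uSol V Φ w z (-x))
            (fun x => -deriv (uSol V Φ w z) (-x)) -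
          d * outgoingTrace s M (fun x => -vSol V Φ w z (-x))
            (fun x => deriv (vSol V Φ w z) (-x)) := by
  simp only [outgoingTrace]
  obtain ⟨hr, hr'⟩ := uSol_add hV Φ hw d z M
  obtain ⟨hl, hl'⟩ := uSol_add hV Φ hw d z (-M)
  rw [hr, hr', hl, hl']
  constructor <;> ring

/-- The substitution `d = τ / (1 - aτ)` makes the coefficients `1 + ad` and `d` of
`outgoingTrace_uSol_add` proportional to `1` and `τ`. -/
theorem one_add_mul_div_one_sub_mul {a τ : ℂ} (h : 1 - a * τ ≠ 0) :
    τ / (1 - a * τ) = (1 + a * (τ / (1 - a * τ))) * τ := by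
  linear_combination div_mul_cancel₀ τ h

theorem isBigO_div_one_sub_mul_sub (hκ : 0 < κ) {τ : ℝ → ℂ} (hτ : τ =O[atTop] decaySq κ) (a : ℂ) :
    (∀ᶠ M in atTop, 1 - a * τ M ≠ 0) ∧
      (fun M => τ M / (1 - a * τ M) - τ M) =O[atTop] fun M => M * decaySq κ M * decaySq κ M := by
  have hden : Tendsto (fun M => 1 - a * τ M) atTop (𝓝 1) := by
    simpa only [mul_zero, sub_zero] using
      ((hτ.trans_tendsto (tendsto_decaySq hκ)).const_mul a).const_sub 1
  have hne : ∀ᶠ M in atTop, 1 - a * τ M ≠ 0 := hden.eventually_ne one_ne_zero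
  refine ⟨hne, ?_⟩
  have hsq := ((hτ.const_mul_left a).mul hτ).mul ((hden.inv₀ one_ne_zero).isBigO_one ℝ)
  simp only [mul_one] at hsq
  refine IsBigO.trans (hsq.congr' (hne.mono fun M hM => ?_) .rfl)
    ((isBigO_mul_of_one_le _).congr_right fun M => (mul_assoc _ _ _).symm)
  field_simp
  ring

theorem traceAsymptotics_uSol_right (hV : Continuous V) (hE : 0 < E) (hκ : 0 < κ) (hc : 0 < c)
    (h : DecayPair V E κ C c (uSol V Φ w E) (deriv (uSol V Φ w E)) (vSol V Φ w E)
      (deriv (vSol V Φ w E))) :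
    TraceAsymptotics κ
      (fun M l => outgoingTrace (Complex.sqrt (E + l)) M (uSol V Φ w (E + l))
          (deriv (uSol V Φ w (E + l))) /
        outgoingTrace (Complex.sqrt (E + l)) M (vSol V Φ w E) (deriv (vSol V Φ w E)))
      (fun M l => outgoingTrace (Complex.sqrt (E + l)) M (vSol V Φ w (E + l))
          (deriv (vSol V Φ w (E + l))) /
        outgoingTrace (Complex.sqrt (E + l)) M (vSol V Φ w E) (deriv (vSol V Φ w E)))
      (fun M => bPlus E M (uSol V Φ w E) / bPlus E M (vSol V Φ w E))
      (fun M => ∫ t in (0 : ℝ)..M, uSol V Φ w E t ^ 2) := by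
  have hu := uSol_spec hV Φ w
  have hv := vSol_spec hV Φ w
  exact h.traceAsymptotics hE hκ hc (fun l => (hu l).1)
    (fun l => (hu l).2.1.trans (hu E).2.1.symm) (fun l => (hu l).2.2.trans (hu E).2.2.symm)
    (differentiable_uSol hV Φ w) (fun l => (hv l).1)
    (fun l => (hv l).2.1.trans (hv E).2.1.symm) (fun l => (hv l).2.2.trans (hv E).2.2.symm)
    (differentiable_vSol hV Φ w)

theorem traceAsymptotics_uSol_left (hV : Continuous V) (hE : 0 < E) (hκ : 0 < κ) (hc : 0 < c)
    (h : DecayPair (fun x => V (-x)) E κ C c (fun x => uSol V Φ w E (-x))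
      (fun x => -deriv (uSol V Φ w E) (-x)) (fun x => -vSol V Φ w E (-x))
      (fun x => deriv (vSol V Φ w E) (-x))) :
    TraceAsymptotics κ
      (fun M l => outgoingTrace (Complex.sqrt (E + l)) M (fun x => uSol V Φ w (E + l) (-x))
          (fun x => -deriv (uSol V Φ w (E + l)) (-x)) /
        outgoingTrace (Complex.sqrt (E + l)) M (fun x => -vSol V Φ w E (-x))
          (fun x => deriv (vSol V Φ w E) (-x)))
      (fun M l => outgoingTrace (Complex.sqrt (E + l)) M (fun x => -vSol V Φ w (E + l) (-x))
          (fun x => deriv (vSol V Φ w (E + l)) (-x)) /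
        outgoingTrace (Complex.sqrt (E + l)) M (fun x => -vSol V Φ w E (-x))
          (fun x => deriv (vSol V Φ w E) (-x)))
      (fun M => -bMinus E M (uSol V Φ w E) / bMinus E M (vSol V Φ w E))
      (fun M => ∫ t in (0 : ℝ)..M, uSol V Φ w E (-t) ^ 2) := by
  have hu := uSol_spec hV Φ w
  have hv := vSol_spec hV Φ w
  have huE0 (l : ℂ) : uSol V Φ w l 0 = uSol V Φ w E 0 := (hu l).2.1.trans (hu E).2.1.symm
  have huE0' (l : ℂ) : deriv (uSol V Φ w l) 0 = deriv (uSol V Φ w E) 0 :=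
    (hu l).2.2.trans (hu E).2.2.symm
  have hvE0 (l : ℂ) : vSol V Φ w l 0 = vSol V Φ w E 0 := (hv l).2.1.trans (hv E).2.1.symm
  have hvE0' (l : ℂ) : deriv (vSol V Φ w l) 0 = deriv (vSol V Φ w E) 0 :=
    (hv l).2.2.trans (hv E).2.2.symm
  have key := h.traceAsymptotics hE hκ hc
    (y := fun l x => uSol V Φ w l (-x)) (y' := fun l x => -deriv (uSol V Φ w l) (-x))
    (z := fun l x => -vSol V Φ w l (-x)) (z' := fun l x => deriv (vSol V Φ w l) (-x))
    (fun l => (hu l).1.comp_neg) (fun l => by simpa only [neg_zero] using huE0 l)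
    (fun l => by simpa only [neg_zero, neg_inj] using huE0' l)
    (fun x => ⟨(differentiable_uSol hV Φ w _).1, (differentiable_uSol hV Φ w _).2.neg⟩)
    (fun l => by
      simpa only [neg_mul, one_mul, neg_neg] using
        IsSolOn.const_mul (q := shiftedPotential (fun x => V (-x)) l) (hv l).1.comp_neg (-1))
    (fun l => by simpa only [neg_zero, neg_inj] using hvE0 l)
    (fun l => by simpa only [neg_zero] using hvE0' l)
    (fun x => ⟨(differentiable_vSol hV Φ w _).1.neg, (differentiable_vSol hV Φ w _).2⟩)
  simpa only [bMinus_eq_neg_outgoingTrace _ _ (uSol V Φ w E), neg_neg,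
    bMinus_eq_outgoingTrace_neg _ _ (vSol V Φ w E)] using key

theorem eventually_bPlus_bMinus_ne_zero (hc : 0 < c) (hc' : 0 < c')
    (hR : DecayPair V E κ C c u (deriv u) v (deriv v))
    (hL : DecayPair (fun x => V (-x)) E κ C' c' (fun x => u (-x)) (fun x => -deriv u (-x))
      (fun x => -v (-x)) (fun x => deriv v (-x))) :
    ∀ᶠ M in atTop, bPlus E M v ≠ 0 ∧ bMinus E M v ≠ 0 :=
  (hR.eventually_outgoingTrace_v_ne_zero hc tendsto_id tendsto_const_nhds).and
    ((hL.eventually_outgoingTrace_v_ne_zero hc' tendsto_id tendsto_const_nhds).mono fun M hM => by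
      rwa [bMinus_eq_outgoingTrace_neg])

theorem exists_integral_sq_lower_bound (hV : Continuous V) (Φ : ℝ → ℂ)
    (hw : starRingEnd ℂ w = w) (E : ℝ) :
    ∃ I₀, 0 < I₀ ∧ ∀ᶠ M : ℝ in atTop, I₀ ≤ ‖∫ t in (-M)..M, uSol V Φ w E t ^ 2‖ := by
  have hu := (uSol_spec hV Φ w E).1
  have hne : ∃ x, uSol V Φ w E x ≠ 0 := by
    by_contra! h
    have hzero : uSol V Φ w E = 0 := funext h
    exact (uSol_ne_zero_or_deriv_ne_zero hV Φ w E 0).elim (fun h0 => h0 (h 0))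
      (fun h0 => h0 (by rw [hzero]; exact deriv_const 0 0))
  exact ⟨_, hu.integral_norm_sq_pos (continuous_shiftedPotential hV E) hne (by norm_num),
    (eventually_ge_atTop 1).mono fun M hM => integral_norm_sq_le_norm_integral_sq hu.continuous
      (fun x => (uSol_im_eq_zero hV Φ hw x).1) zero_le_one hM⟩

theorem outgoingTrace_uSol_add_eq_zero (hV : Continuous V) (Φ : ℝ → ℂ) (hw : 1 + w ^ 2 ≠ 0)
    {M : ℝ} {z s τ B B' : ℂ} (hB : B ≠ 0) (hB' : B' ≠ 0) (hτ : 1 - w / (1 + w ^ 2) * τ ≠ 0)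
    (hright : outgoingTrace s M (uSol V Φ w z) (deriv (uSol V Φ w z)) / B +
      τ * (outgoingTrace s M (vSol V Φ w z) (deriv (vSol V Φ w z)) / B) = 0)
    (hleft : outgoingTrace s M (fun x => uSol V Φ w z (-x)) (fun x => -deriv (uSol V Φ w z) (-x)) /
        B' - τ * (outgoingTrace s M (fun x => -vSol V Φ w z (-x))
          (fun x => deriv (vSol V Φ w z) (-x)) / B') = 0) :
    let y := uSol V Φ (w + τ / (1 - w / (1 + w ^ 2) * τ)) z
    outgoingTrace s M y (deriv y) = 0 ∧
      outgoingTrace s M (fun x => y (-x)) (fun x => -deriv y (-x)) = 0 := by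
  intro y
  have hd := one_add_mul_div_one_sub_mul hτ
  obtain ⟨hr, hl⟩ := outgoingTrace_uSol_add hV Φ hw (τ / (1 - w / (1 + w ^ 2) * τ)) z s M
  rw [← mul_div_assoc, ← add_div, div_eq_zero_iff, or_iff_left hB] at hright
  rw [← mul_div_assoc, ← sub_div, div_eq_zero_iff, or_iff_left hB'] at hleft
  set d := τ / (1 - w / (1 + w ^ 2) * τ)
  constructor
  · rw [hr]
    linear_combination (1 + w / (1 + w ^ 2) * d) * hright +
      outgoingTrace s M (vSol V Φ w z) (deriv (vSol V Φ w z)) * hd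
  · rw [hl]
    linear_combination (1 + w / (1 + w ^ 2) * d) * hleft -
      outgoingTrace s M (fun x => -vSol V Φ w z (-x)) (fun x => deriv (vSol V Φ w z) (-x)) * hd

theorem exists_resonance_parameters (hV : Continuous V) (hE : 0 < E) (hκ : 0 < κ) (hc : 0 < c)
    (hc' : 0 < c') (hw : starRingEnd ℂ w = w)
    (hR : DecayPair V E κ C c (uSol V Φ w E) (deriv (uSol V Φ w E)) (vSol V Φ w E)
      (deriv (vSol V Φ w E)))
    (hL : DecayPair (fun x => V (-x)) E κ C' c' (fun x => uSol V Φ w E (-x))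
      (fun x => -deriv (uSol V Φ w E) (-x)) (fun x => -vSol V Φ w E (-x))
      (fun x => deriv (vSol V Φ w E) (-x))) :
    ∃ wStar zStar : ℝ → ℂ,
      (∀ᶠ M in atTop, corrDenom E M (uSol V Φ w E) (vSol V Φ w E) ≠ 0 ∧ 0 < (zStar M).re ∧
        outgoingTrace (Complex.sqrt (zStar M)) M (uSol V Φ (wStar M) (zStar M))
          (deriv (uSol V Φ (wStar M) (zStar M))) = 0 ∧
        outgoingTrace (Complex.sqrt (zStar M)) M (fun x => uSol V Φ (wStar M) (zStar M) (-x))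
          (fun x => -deriv (uSol V Φ (wStar M) (zStar M)) (-x)) = 0) ∧
      (fun M => zStar M - zApprox E M (uSol V Φ w E) (vSol V Φ w E)) =O[atTop]
        (fun M => M * decaySq κ M * decaySq κ M) ∧
      (fun M => wStar M - wApprox w E M (uSol V Φ w E) (vSol V Φ w E)) =O[atTop]
        fun M => M * decaySq κ M * decaySq κ M := by
  have hw0 := one_add_sq_ne_zero hw
  obtain ⟨I₀, hI₀, hIlow⟩ := exists_integral_sq_lower_bound hV Φ hw E
  have hI := integral_comp_neg_add_integral (uSol_spec hV Φ w E).1.continuous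
  obtain ⟨l, τ, ⟨K, hl⟩, hmatch, hτ, hlerr, hτerr⟩ :=
    (traceAsymptotics_uSol_right hV hE hκ hc hR).exists_matching hκ
      (traceAsymptotics_uSol_left hV hE hκ hc' hL) hI₀ (by simpa only [hI] using hIlow)
  have hwin := tendsto_prodMk_energyWindow hl
  have hs := (tendsto_sqrt_energyWindow hE hκ).comp hwin
  obtain ⟨hτne, hderr⟩ := isBigO_div_one_sub_mul_sub hκ hτ (w / (1 + w ^ 2))
  have hbne := eventually_bPlus_bMinus_ne_zero hc hc' hR hL
  have hI0 : ∀ᶠ M in atTop, (∫ t in (-M)..M, uSol V Φ w E t ^ 2) ≠ 0 :=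
    hIlow.mono fun M hM => norm_pos_iff.1 (hI₀.trans_le hM)
  refine ⟨fun M => w + τ M / (1 - w / (1 + w ^ 2) * τ M), fun M => E + l M, ?_, ?_, ?_⟩
  · filter_upwards [hmatch, hτne, hbne, hI0, hwin.eventually (eventually_re_pos_energyWindow hE hκ),
      hR.eventually_outgoingTrace_v_ne_zero hc tendsto_id hs,
      hL.eventually_outgoingTrace_v_ne_zero hc' tendsto_id hs] with M hm hτM hb hIM hre hB hB'
    exact ⟨mul_ne_zero (mul_ne_zero hIM hb.1) hb.2, hre,
      outgoingTrace_uSol_add_eq_zero hV Φ hw0 hB hB' hτM hm.1 hm.2⟩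
  · refine hlerr.congr' ?_ .rfl
    filter_upwards [hbne, hI0] with M hb hIM
    rw [zApprox_eq (hI M) ((hI M).trans_ne hIM) hb.1 hb.2 rfl rfl]
    ring
  · refine (hderr.add hτerr).congr' ?_ .rfl
    filter_upwards [hbne, hI0] with M hb hIM
    rw [wApprox_eq w rfl (by rw [intervalIntegral.integral_comp_neg (uSol V Φ w E · ^ 2), neg_zero])
      (hI M) ((hI M).trans_ne hIM) hb.1 hb.2 rfl rfl]
    ring

end ResonanceParameters

section TruncatedEquation

open Filter

variable {U V : ℝ → ℝ} {w w' h q : ℝ → ℂ} {s : Set ℝ} {z k : ℂ} {M b x : ℝ}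

theorem sq_sqrt (z : ℂ) : Complex.sqrt z ^ 2 = z := by simp [Complex.sqrt]

theorem sqrt_re_pos (hz : 0 < z.re) : 0 < (Complex.sqrt z).re := by
  rw [Complex.sqrt, Complex.cpow_inv_two_re]; positivity

theorem SchrodingerEq.hasDerivWithinAt_deriv (hw : SchrodingerEq U w h) (hs : OrdConnected s)
    {g : ℝ → ℂ} (hg : Continuous g) (heq : ∀ᵐ t, t ∈ s → (U t : ℂ) * w t - h t = g t)
    (hx : x ∈ s) : HasDerivWithinAt (deriv w) (g x) s x := by
  have hprim : ∀ b ∈ s, deriv w b = deriv w x + ∫ t in x..b, g t := fun b hb => by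
    rw [← sub_eq_iff_eq_add', hw.2.2 x b]
    refine intervalIntegral.integral_congr_ae (heq.mono fun t ht htb => ht ?_)
    exact hs.uIcc_subset hx hb (uIoc_subset_uIcc htb)
  exact ((hg.integral_hasStrictDerivAt x x).hasDerivAt.const_add (deriv w x)).hasDerivWithinAt.congr
    hprim (hprim x hx)

theorem SchrodingerEq.isSolOn (hw : SchrodingerEq U w h) (hs : OrdConnected s) (hq : Continuous q)
    (heq : ∀ᵐ t, t ∈ s → (U t : ℂ) * w t - h t = q t * w t) : IsSolOn q w (deriv w) s :=
  fun x hx => ⟨(hw.1 x).hasDerivAt.hasDerivWithinAt,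
    hw.hasDerivWithinAt_deriv hs (hq.mul hw.1.continuous) heq hx⟩

theorem schrodingerEq_of_hasDerivAt_off_countable {S : Set ℝ} (hS : S.Countable)
    (hw : ∀ x, HasDerivAt w (w' x) x) (hw' : Continuous w')
    (hderiv : ∀ x ∉ S, HasDerivAt w' (U x * w x - h x) x)
    (hint : ∀ a b, IntervalIntegrable (fun t => (U t : ℂ) * w t - h t) volume a b) :
    SchrodingerEq U w h := by
  refine ⟨fun x => (hw x).differentiableAt, hint, fun a b => ?_⟩
  rw [funext fun x => (hw x).deriv]
  exact (integral_eq_of_hasDerivAt_off_countable w' _ hS hw'.continuousOn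
    (fun x hx => hderiv x hx.2) (hint a b)).symm

theorem truncate_of_mem (hx : x ∈ Icc (-M) M) : truncate V M x = V x :=
  if_pos (abs_le.2 hx)

theorem truncate_of_gt (hx : M < x) : truncate V M x = 0 :=
  if_neg (not_le.2 (hx.trans_le (le_abs_self x)))

theorem truncate_of_lt (hx : x < -M) : truncate V M x = 0 :=
  if_neg (not_le.2 (lt_abs.2 (.inr (lt_neg.2 hx))))

theorem ofReal_truncate_mul (w : ℝ → ℂ) :
    (fun t => (truncate V M t : ℂ) * w t) = (Icc (-M) M).indicator fun t => (V t : ℂ) * w t := by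
  funext t
  by_cases ht : t ∈ Icc (-M) M
  · rw [indicator_of_mem ht, truncate_of_mem ht]
  · rw [indicator_of_notMem ht, truncate, if_neg (mt abs_le.1 ht), Complex.ofReal_zero, zero_mul]

theorem intervalIntegrable_truncate_mul (hV : Continuous V) (hw : Continuous w) (M a b : ℝ) :
    IntervalIntegrable (fun t => (truncate V M t : ℂ) * w t) volume a b := by
  have hVw : Continuous fun t => (V t : ℂ) * w t := by fun_prop
  rw [ofReal_truncate_mul, intervalIntegrable_iff]
  exact (intervalIntegrable_iff.1 (hVw.intervalIntegrable a b)).indicator measurableSet_Icc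

theorem SchrodingerEq.isSolOn_Ici_of_truncate (hw : SchrodingerEq (truncate V M) w h)
    (hb : M ≤ b) (hh : ∀ᵐ t, b < t → h t = z * w t) :
    IsSolOn (fun _ => -z) w (deriv w) (Ici b) := by
  refine hw.isSolOn ordConnected_Ici continuous_const ?_
  filter_upwards [hh, Measure.ae_ne volume b] with t ht hne hbt
  have hlt : b < t := lt_of_le_of_ne hbt hne.symm
  rw [truncate_of_gt (hb.trans_lt hlt), ht hlt, Complex.ofReal_zero]
  ring

theorem SchrodingerEq.isSolOn_Iic_of_truncate (hw : SchrodingerEq (truncate V M) w h)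
    (hh : ∀ᵐ t, t < -M → h t = z * w t) :
    IsSolOn (fun _ => -z) w (deriv w) (Iic (-M)) := by
  refine hw.isSolOn ordConnected_Iic continuous_const ?_
  filter_upwards [hh, Measure.ae_ne volume (-M)] with t ht hne htM
  have hlt : t < -M := lt_of_le_of_ne htM hne
  rw [truncate_of_lt hlt, ht hlt, Complex.ofReal_zero]
  ring

theorem SchrodingerEq.isSolOn_Icc_of_truncate (hV : Continuous V)
    (hw : SchrodingerEq (truncate V M) w h) (hh : ∀ᵐ t, t < M → h t = z * w t) :
    IsSolOn (shiftedPotential V z) w (deriv w) (Icc (-M) M) := by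
  refine hw.isSolOn ordConnected_Icc (continuous_shiftedPotential hV z) ?_
  filter_upwards [hh, Measure.ae_ne volume M] with t ht hne htM
  rw [truncate_of_mem htM, ht (lt_of_le_of_ne htM.2 hne), shiftedPotential, sub_mul]

theorem isSolOn_exp (k a : ℂ) (b : ℝ) : IsSolOn (fun _ => -k ^ 2)
    (fun x => a * Complex.exp (Complex.I * k * (x - b)))
    (fun x => Complex.I * k * (a * Complex.exp (Complex.I * k * (x - b)))) univ := fun x _ => by
  have hexp : HasDerivAt (fun x : ℝ => a * Complex.exp (Complex.I * k * (x - b)))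
      (Complex.I * k * (a * Complex.exp (Complex.I * k * (x - b)))) x :=
    ((((hasDerivAt_id x).ofReal_comp.sub_const (b : ℂ)).const_mul
      (Complex.I * k)).cexp.const_mul a).congr_deriv (by simp only [id, Complex.ofReal_one]; ring)
  refine ⟨hexp.hasDerivWithinAt,
    ((hexp.const_mul (Complex.I * k)).congr_deriv ?_).hasDerivWithinAt⟩
  linear_combination k ^ 2 * a * Complex.exp (Complex.I * k * (x - b)) * Complex.I_sq

theorem IsSolOn.eq_mul_exp (hs : OrdConnected s) (hw : IsSolOn (fun _ => -k ^ 2) w w' s)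
    (hb : b ∈ s) (hout : w' b = Complex.I * k * w b) (hx : x ∈ s) :
    w x = w b * Complex.exp (Complex.I * k * (x - b)) ∧ w' x = Complex.I * k * w x := by
  have heq := hw.eqOn continuous_const hs ((isSolOn_exp k (w b) b).mono (subset_univ s)) hb
    (by simp) (by simp [hout]) hx
  exact ⟨heq.1, by rw [heq.1, heq.2]⟩

theorem deriv_eq_of_eventuallyEq_exp {a : ℂ}
    (h : w =ᶠ[nhds b] fun x => a * Complex.exp (Complex.I * k * x)) :
    deriv w b = Complex.I * k * w b := by
  have hexp := (isSolOn_exp k a 0).hasDerivAt b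
  simp only [Complex.ofReal_zero, sub_zero] at hexp
  rw [h.deriv_eq, hexp.deriv, h.eq_of_nhds]

end TruncatedEquation

section ResonantState

open Filter

variable {V : ℝ → ℝ} {u u' l l' r r' ψ : ℝ → ℂ} {z : ℂ} {M : ℝ}

theorem hasDerivAt_ite_le {F : Type*} [NormedAddCommGroup F] [NormedSpace ℝ F] {f g : ℝ → F}
    {f' g' : F} {c x : ℝ} (hf : HasDerivAt f f' x) (hg : HasDerivAt g g' x)
    (h : x = c → f x = g x) (h' : x = c → f' = g') :
    HasDerivAt (fun x => if x ≤ c then f x else g x) (if x ≤ c then f' else g') x := by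
  rcases lt_trichotomy x c with hx | rfl | hx
  · rw [if_pos hx.le]
    exact hf.congr_of_eventuallyEq
      (eventually_of_mem (Iio_mem_nhds hx) fun y hy => if_pos (le_of_lt hy))
  · have hright : HasDerivWithinAt (fun y => if y ≤ x then f y else g y) f' (Ici x) x := by
      refine (h' rfl ▸ hg.hasDerivWithinAt).congr (fun y hy => ?_) (by rw [if_pos le_rfl, h rfl])
      rcases eq_or_lt_of_le (mem_Ici.1 hy) with rfl | hlt
      · rw [if_pos le_rfl, h rfl]
      · rw [if_neg hlt.not_ge]
    rw [if_pos le_rfl, ← hasDerivWithinAt_univ, ← Iic_union_Ici (a := x)]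
    refine HasDerivWithinAt.union ?_ hright
    exact hf.hasDerivWithinAt.congr (fun y hy => if_pos hy) (if_pos le_rfl)
  · rw [if_neg hx.not_ge]
    exact hg.congr_of_eventuallyEq
      (eventually_of_mem (Ioi_mem_nhds hx) fun y hy => if_neg (not_le.2 hy))

theorem schrodingerEq_truncate_of_glue (hV : Continuous V) (hM : 0 ≤ M)
    (hl : IsSolOn (fun _ => -z) l l' univ) (hu : IsSolOn (shiftedPotential V z) u u' univ)
    (hr : IsSolOn (fun _ => -z) r r' univ) (hlu : l (-M) = u (-M)) (hlu' : l' (-M) = u' (-M))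
    (hur : u M = r M) (hur' : u' M = r' M) :
    SchrodingerEq (truncate V M) (fun x => if x ≤ -M then l x else if x ≤ M then u x else r x)
      (fun x => z * if x ≤ -M then l x else if x ≤ M then u x else r x) := by
  have hMM : -M ≤ M := by linarith
  have hderiv (x : ℝ) : HasDerivAt (fun x => if x ≤ -M then l x else if x ≤ M then u x else r x)
      (if x ≤ -M then l' x else if x ≤ M then u' x else r' x) x := by
    refine hasDerivAt_ite_le (hl.hasDerivAt x)
      (hasDerivAt_ite_le (hu.hasDerivAt x) (hr.hasDerivAt x) ?_ ?_) ?_ ?_ <;> rintro rfl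
    exacts [hur, hur', by rw [if_pos hMM, hlu], by rw [if_pos hMM, hlu']]
  have hcont := continuous_iff_continuousAt.2 fun x => (hderiv x).continuousAt
  refine schrodingerEq_of_hasDerivAt_off_countable (S := {-M, M}) (by simp) hderiv ?_ ?_
    fun a b => (intervalIntegrable_truncate_mul hV hcont M a b).sub
      ((continuous_const.mul hcont).intervalIntegrable a b)
  · refine Continuous.if_le hl.continuous_deriv (Continuous.if_le hu.continuous_deriv
      hr.continuous_deriv continuous_id continuous_const ?_) continuous_id continuous_const ?_ <;>
      rintro x rfl
    exacts [hur', by rw [if_pos hMM, hlu']]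
  · simp only [mem_insert_iff, mem_singleton_iff, not_or]
    rintro x ⟨hxl, hxr⟩
    refine (hasDerivAt_ite_le (hl.hasDerivAt_deriv x) (hasDerivAt_ite_le (hu.hasDerivAt_deriv x)
      (hr.hasDerivAt_deriv x) (absurd · hxr) (absurd · hxr)) (absurd · hxl)
      (absurd · hxl)).congr_deriv ?_
    split_ifs with h₁ h₂
    · simp [truncate_of_lt (lt_of_le_of_ne h₁ hxl)]
    · simp [truncate_of_mem ⟨(not_le.1 h₁).le, h₂⟩, shiftedPotential, sub_mul]
    · simp [truncate_of_gt (not_le.1 h₂)]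

theorem outgoingExtension_eq_ite_le (hM : 0 ≤ M) (z : ℂ) (u : ℝ → ℂ) (x : ℝ) :
    outgoingExtension M z u x = if x ≤ -M then
      u (-M) * Complex.exp (Complex.I * -Complex.sqrt z * (x - (-M : ℝ))) else if x ≤ M then u x
      else u M * Complex.exp (Complex.I * Complex.sqrt z * (x - M)) := by
  rw [outgoingExtension]
  rcases lt_trichotomy x (-M) with hx | rfl | hx
  · rw [if_pos hx, if_pos hx.le]
    congr 2
    push_cast; ring
  · rw [if_neg (lt_irrefl _), if_pos le_rfl, if_pos (by linarith)]
    simp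
  · rw [if_neg hx.not_gt, if_neg hx.not_ge]

theorem outgoingExtension_self (hM : 0 ≤ M) (z : ℂ) (u : ℝ → ℂ) :
    outgoingExtension M z u M = u M := by
  rw [outgoingExtension, if_neg (by linarith), if_pos le_rfl]

theorem outgoingExtension_congr (hM : 0 ≤ M) {v : ℝ → ℂ} (h : EqOn u v (Icc (-M) M)) :
    outgoingExtension M z u = outgoingExtension M z v := by
  funext x
  simp only [outgoingExtension]
  split_ifs with hl hr
  · rw [h (left_mem_Icc.2 (by linarith))]
  · exact h ⟨not_lt.1 hl, hr⟩
  · rw [h (right_mem_Icc.2 (by linarith))]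

theorem outgoingExtension_const_mul (M : ℝ) (z c : ℂ) (u : ℝ → ℂ) :
    outgoingExtension M z (fun x => c * u x) = c • outgoingExtension M z u := by
  funext x
  simp only [Pi.smul_apply, smul_eq_mul, outgoingExtension]
  split_ifs <;> ring

theorem schrodingerEq_outgoingExtension (hV : Continuous V) (hM : 0 ≤ M)
    (hu : IsSolOn (shiftedPotential V z) u u' univ)
    (hright : u' M = Complex.I * Complex.sqrt z * u M)
    (hleft : u' (-M) = -(Complex.I * Complex.sqrt z * u (-M))) :
    SchrodingerEq (truncate V M) (outgoingExtension M z u)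
      (fun x => z * outgoingExtension M z u x) := by
  have hl := isSolOn_exp (-Complex.sqrt z) (u (-M)) (-M)
  have hr := isSolOn_exp (Complex.sqrt z) (u M) M
  rw [neg_sq, sq_sqrt] at hl
  rw [sq_sqrt] at hr
  simp_rw [funext (outgoingExtension_eq_ite_le hM z u)]
  exact schrodingerEq_truncate_of_glue hV hM hl hu hr (by simp) (by simp [hleft]) (by simp)
    (by simp [hright])

theorem isResonantState_outgoingExtension (hV : Continuous V) (hM : 0 ≤ M)
    (hu : IsSolOn (shiftedPotential V z) u u' univ) (huM : u M ≠ 0)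
    (hright : u' M = Complex.I * Complex.sqrt z * u M)
    (hleft : u' (-M) = -(Complex.I * Complex.sqrt z * u (-M))) :
    IsResonantState (truncate V M) z (outgoingExtension M z u) := by
  refine ⟨fun h => huM ?_, schrodingerEq_outgoingExtension hV hM hu hright hleft, M,
    u M * Complex.exp (-(Complex.I * Complex.sqrt z * M)),
    u (-M) * Complex.exp (-(Complex.I * Complex.sqrt z * M)), fun x hx => ?_, fun x hx => ?_⟩
  · rw [← outgoingExtension_self hM z u, h, Pi.zero_apply]
  · rw [outgoingExtension, if_neg (by linarith), if_neg (by linarith), mul_assoc _ (Complex.exp _),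
      ← Complex.exp_add]
    congr 2; ring
  · rw [outgoingExtension, if_pos hx, mul_assoc _ (Complex.exp _), ← Complex.exp_add]
    congr 2; ring

theorem IsResonantState.deriv_eq_and_eq_outgoingExtension (hM : 0 ≤ M)
    (hψ : IsResonantState (truncate V M) z ψ) :
    deriv ψ M = Complex.I * Complex.sqrt z * ψ M ∧ ψ = outgoingExtension M z ψ := by
  obtain ⟨-, hSE, R, a, b, ha, hb⟩ := hψ
  have hr := hSE.isSolOn_Ici_of_truncate le_rfl (Eventually.of_forall fun t _ => rfl)
  have hl := hSE.isSolOn_Iic_of_truncate (Eventually.of_forall fun t _ => rfl)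
  rw [← sq_sqrt z] at hr
  rw [← sq_sqrt z, ← neg_sq] at hl
  set R' := max M R + 1
  have hMR : M < R' := (le_max_left M R).trans_lt (lt_add_one _)
  have hRR : R < R' := (le_max_right M R).trans_lt (lt_add_one _)
  have hderiv_right : deriv ψ R' = Complex.I * Complex.sqrt z * ψ R' :=
    deriv_eq_of_eventuallyEq_exp (eventually_of_mem (Ioi_mem_nhds hRR) ha)
  have hderiv_left : deriv ψ (-R') = Complex.I * -Complex.sqrt z * ψ (-R') :=
    deriv_eq_of_eventuallyEq_exp (a := b) (eventually_of_mem (Iio_mem_nhds (neg_lt_neg hRR))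
      fun x hx => by simp only [hb x hx, mul_neg, neg_mul])
  have hM_right := (hr.eq_mul_exp ordConnected_Ici hMR.le hderiv_right self_mem_Ici).2
  have hM_left :=
    (hl.eq_mul_exp ordConnected_Iic (neg_le_neg hMR.le) hderiv_left self_mem_Iic).2
  refine ⟨hM_right, funext fun x => ?_⟩
  rw [outgoingExtension_eq_ite_le hM]
  split_ifs with hxl hxr
  · exact (hl.eq_mul_exp ordConnected_Iic self_mem_Iic hM_left hxl).1
  · rfl
  · exact (hr.eq_mul_exp ordConnected_Ici self_mem_Ici hM_right (not_le.1 hxr).le).1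

theorem isResonantState_truncate_iff (hV : Continuous V) (hM : 0 ≤ M)
    (hu : IsSolOn (shiftedPotential V z) u u' univ) (huM : u M ≠ 0)
    (hright : u' M = Complex.I * Complex.sqrt z * u M)
    (hleft : u' (-M) = -(Complex.I * Complex.sqrt z * u (-M))) (ψ : ℝ → ℂ) :
    IsResonantState (truncate V M) z ψ ↔ ∃ c : ℂ, c ≠ 0 ∧ ψ = c • outgoingExtension M z u := by
  constructor
  · intro hψ
    obtain ⟨hψM, hext⟩ := hψ.deriv_eq_and_eq_outgoingExtension hM
    have hsol := hψ.2.1.isSolOn_Icc_of_truncate hV (Eventually.of_forall fun t _ => rfl)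
    have hmul : EqOn ψ (fun x => ψ M / u M * u x) (Icc (-M) M) := fun x hx =>
      (hsol.eqOn (continuous_shiftedPotential hV z) ordConnected_Icc
        ((hu.const_mul (ψ M / u M)).mono (subset_univ _)) (right_mem_Icc.2 (by linarith))
        (div_mul_cancel₀ _ huM).symm (by rw [hψM, hright]; field_simp) hx).1
    rw [outgoingExtension_congr hM hmul, outgoingExtension_const_mul] at hext
    exact ⟨ψ M / u M, fun h => hψ.1 (by rw [hext, h, zero_smul]), hext⟩
  · rintro ⟨c, hc, rfl⟩
    rw [← outgoingExtension_const_mul]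
    exact isResonantState_outgoingExtension hV hM (hu.const_mul c) (mul_ne_zero hc huM)
      (by rw [hright]; ring) (by rw [hleft]; ring)

end ResonantState

section Resolvent

variable {V : ℝ → ℝ} {y y' w h e e' : ℝ → ℂ} {q ξ : ℂ} {M b : ℝ}

theorem IsSolOn.comp_neg_Iic (hy : IsSolOn (fun _ => q) y y' (Iic (-b))) :
    IsSolOn (fun _ => q) (fun x => y (-x)) (fun x => -y' (-x)) (Ici b) := fun x hx => by
  have hmaps : MapsTo Neg.neg (Ici b) (Iic (-b)) := fun t ht => neg_le_neg (mem_Ici.1 ht)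
  have hneg : HasDerivWithinAt Neg.neg (-1 : ℝ) (Ici b) x := (hasDerivAt_neg x).hasDerivWithinAt
  obtain ⟨hderiv, hderiv'⟩ := hy (-x) (hmaps hx)
  exact ⟨(hderiv.scomp x hneg hmaps).congr_deriv (by simp),
    (hderiv'.scomp x hneg hmaps).neg.congr_deriv (by simp)⟩

theorem norm_exp_I_mul_mul_sub (ξ : ℂ) (x b : ℝ) :
    ‖Complex.exp (Complex.I * ξ * (x - b))‖ = Real.exp (-ξ.im * (x - b)) := by
  simp [Complex.norm_exp]

theorem memLp_exp_I_mul (hξ : 0 < ξ.im) (b : ℝ) :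
    MemLp (fun x : ℝ => Complex.exp (Complex.I * ξ * (x - b))) 2 (volume.restrict (Ioi b)) := by
  rw [memLp_two_iff_integrable_sq_norm (by fun_prop)]
  refine ((integrableOn_exp_mul_Ioi (a := -(2 * ξ.im)) (by linarith) b).const_mul
    (Real.exp (2 * ξ.im * b))).congr (.of_forall fun x => ?_)
  simp only [norm_exp_I_mul_mul_sub, ← Real.exp_nat_mul, ← Real.exp_add]
  congr 1
  push_cast; ring

/-- The coefficient of the growing exponential `exp (-iξx)` in `y` vanishes. -/
theorem IsSolOn.deriv_eq_of_memLp (hξ : 0 < ξ.im) (hy : IsSolOn (fun _ => -ξ ^ 2) y y' (Ici b))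
    (hL2 : MemLp y 2 (volume.restrict (Ioi b))) : y' b = Complex.I * ξ * y b := by
  have hξ0 : ξ ≠ 0 := fun h0 => by simp [h0] at hξ
  have hIξ : Complex.I * ξ ≠ 0 := mul_ne_zero Complex.I_ne_zero hξ0
  set A := (y b + y' b / (Complex.I * ξ)) / 2 with hA
  set B := (y b - y' b / (Complex.I * ξ)) / 2 with hB
  have hdecay := isSolOn_exp ξ 1 b
  have hgrow := isSolOn_exp (-ξ) 1 b
  rw [neg_sq] at hgrow
  have hrepr : EqOn (fun x : ℝ => y x - A * Complex.exp (Complex.I * ξ * (x - b)))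
      (fun x => B * Complex.exp (Complex.I * -ξ * (x - b))) (Ioi b) := fun x hx => by
    have := (hy.eqOn_linear_comb continuous_const ordConnected_Ici (hdecay.mono (subset_univ _))
      (hgrow.mono (subset_univ _)) (α := A) (β := B) self_mem_Ici (by simp [hA, hB]; ring)
      (by simp [hA, hB]; field_simp; ring) (Ioi_subset_Ici_self hx)).1
    simpa only [one_mul, sub_eq_iff_eq_add'] using this
  have hgrowL2 := (memLp_congr_ae (ae_restrict_of_forall_mem measurableSet_Ioi hrepr)).1
    (hL2.sub ((memLp_exp_I_mul hξ b).const_mul A))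
  have hconst : IntegrableOn (fun _ => ‖B‖ ^ 2) (Ioi b) := by
    refine (hgrowL2.integrable_norm_pow two_ne_zero).mono' aestronglyMeasurable_const
      (ae_restrict_of_forall_mem measurableSet_Ioi fun x hx => ?_)
    rw [norm_pow, norm_norm, norm_mul, norm_exp_I_mul_mul_sub, Complex.neg_im, neg_neg]
    gcongr
    exact le_mul_of_one_le_right (norm_nonneg _)
      (Real.one_le_exp (mul_nonneg hξ.le (sub_nonneg.2 (le_of_lt hx))))
  have hB0 : B = 0 := by simpa using (integrableOn_const_iff (by finiteness)).1 hconst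
  rw [hB, div_eq_zero_iff, or_iff_left two_ne_zero, sub_eq_zero, eq_div_iff hIξ] at hB0
  rw [← hB0, mul_comm]

/-- The average `∫₀¹ exp (iξt) dt` of a plane wave over a unit interval. At `ξ = 0`, where the
average is `1`, the formula has the junk value `0`. -/
def expAverage (ξ : ℂ) : ℂ := (Complex.exp (Complex.I * ξ) - 1) / (Complex.I * ξ)

theorem expAverage_ne_zero (hξ : ξ.im ≠ 0) : expAverage ξ ≠ 0 := by
  have hξ0 : ξ ≠ 0 := fun h0 => by simp [h0] at hξ
  refine div_ne_zero (fun h => hξ ?_) (mul_ne_zero Complex.I_ne_zero hξ0)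
  have hnorm := congrArg norm (sub_eq_zero.1 h)
  rw [Complex.norm_exp, norm_one, Real.exp_eq_one_iff] at hnorm
  simpa using hnorm

theorem analyticAt_expAverage (hξ : ξ ≠ 0) : AnalyticAt ℂ expAverage ξ :=
  ((analyticAt_const.mul analyticAt_id).cexp.sub analyticAt_const).div
    (analyticAt_const.mul analyticAt_id) (mul_ne_zero Complex.I_ne_zero hξ)

theorem meromorphicAt_expAverage (ξ : ℂ) : MeromorphicAt expAverage ξ :=
  ((analyticAt_const.mul analyticAt_id).cexp.sub analyticAt_const).meromorphicAt.div
    (analyticAt_const.mul analyticAt_id).meromorphicAt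

theorem integral_exp_neg_eq_expAverage (hξ : ξ ≠ 0) (b : ℝ) :
    ∫ x in (b - 1)..b, Complex.exp (Complex.I * -ξ * (x - b)) = expAverage ξ := by
  have hshift := intervalIntegral.integral_comp_sub_right (a := b - 1) (b := b)
    (fun x : ℝ => Complex.exp (Complex.I * -ξ * x)) b
  simp only [Complex.ofReal_sub] at hshift
  rw [hshift, integral_exp_mul_complex (mul_ne_zero Complex.I_ne_zero (neg_ne_zero.2 hξ)),
    sub_self, sub_sub_cancel_left, expAverage, mul_neg, div_neg, ← neg_div]
  simp

/-- Adding the particular solution `ξ⁻²` makes the equation homogeneous; then compare Wronskians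
with `exp (iξx)` at the two endpoints. -/
theorem trace_eq_expAverage_of_unit_source {w' : ℝ → ℂ} (hξ : ξ ≠ 0)
    (hw : ∀ x ∈ Icc b (b + 1), HasDerivWithinAt w (w' x) (Icc b (b + 1)) x)
    (hw' : ∀ x ∈ Icc b (b + 1), HasDerivWithinAt w' (-ξ ^ 2 * w x - 1) (Icc b (b + 1)) x)
    (hout : w' (b + 1) = Complex.I * ξ * w (b + 1)) :
    w' b - Complex.I * ξ * w b = expAverage ξ := by
  have hsol : IsSolOn (fun _ => -ξ ^ 2) (fun x => w x + (ξ ^ 2)⁻¹) w' (Icc b (b + 1)) :=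
    fun x hx => ⟨(hw x hx).add_const _, (hw' x hx).congr_deriv (by field_simp; ring)⟩
  have hW := wronskian_const ordConnected_Icc hsol ((isSolOn_exp ξ 1 b).mono (subset_univ _))
    (left_mem_Icc.2 (by linarith)) (right_mem_Icc.2 (by linarith))
  simp only [wronskian, hout, Complex.ofReal_add, Complex.ofReal_one, add_sub_cancel_left, sub_self,
    mul_zero, Complex.exp_zero, mul_one, one_mul] at hW
  have hξsq : ξ ^ 2 * (ξ ^ 2)⁻¹ = 1 := mul_inv_cancel₀ (pow_ne_zero 2 hξ)
  rw [expAverage, eq_div_iff (mul_ne_zero Complex.I_ne_zero hξ)]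
  linear_combination -(Complex.I * ξ) * hW -
    (Complex.exp (Complex.I * ξ) - 1) * (Complex.I ^ 2 * hξsq + Complex.I_sq)

theorem SchrodingerEq.eq_mul_exp_left_of_memLp (hξ : 0 < ξ.im)
    (hw : SchrodingerEq (truncate V M) w h) (hL2 : MemLp w 2 volume)
    (hh : ∀ᵐ t, t < -M → h t = ξ ^ 2 * w t) :
    deriv w (-M) = -(Complex.I * ξ * w (-M)) ∧
      ∀ x ≤ -M, w x = w (-M) * Complex.exp (Complex.I * -ξ * (x - (-M : ℝ))) := by
  have hsol := hw.isSolOn_Iic_of_truncate hh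
  have hderiv := hsol.comp_neg_Iic.deriv_eq_of_memLp hξ
    ((hL2.comp_measurePreserving (Measure.measurePreserving_neg volume)).restrict _)
  rw [neg_eq_iff_eq_neg] at hderiv
  refine ⟨hderiv, fun x hx => ?_⟩
  rw [← neg_sq] at hsol
  exact (hsol.eq_mul_exp ordConnected_Iic self_mem_Iic (by rw [hderiv]; ring) hx).1

theorem SchrodingerEq.trace_eq_expAverage_of_memLp (hξ : 0 < ξ.im)
    (hw : SchrodingerEq (truncate V M) w h) (hL2 : MemLp w 2 volume)
    (hh : ∀ᵐ t, h t = (Icc M (M + 1)).indicator (fun _ => 1) t + ξ ^ 2 * w t) :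
    deriv w M - Complex.I * ξ * w M = expAverage ξ := by
  have hξ0 : ξ ≠ 0 := fun h0 => by simp [h0] at hξ
  have hhomog : ∀ᵐ t, M + 1 < t → h t = ξ ^ 2 * w t := hh.mono fun t ht htM => by
    rw [ht, indicator_of_notMem fun hmem => htM.not_ge hmem.2, zero_add]
  have hsource : ∀ᵐ t, t ∈ Icc M (M + 1) →
      (truncate V M t : ℂ) * w t - h t = -ξ ^ 2 * w t - 1 := by
    filter_upwards [hh, Measure.ae_ne volume M] with t ht hne htM
    rw [truncate_of_gt (lt_of_le_of_ne htM.1 hne.symm), ht, indicator_of_mem htM,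
      Complex.ofReal_zero]
    ring
  have hcont := hw.1.continuous
  exact trace_eq_expAverage_of_unit_source hξ0
    (fun x _ => (hw.1 x).hasDerivAt.hasDerivWithinAt)
    (fun x hx => hw.hasDerivWithinAt_deriv ordConnected_Icc (g := fun x => -ξ ^ 2 * w x - 1)
      (by fun_prop) hsource hx)
    ((hw.isSolOn_Ici_of_truncate (by linarith) hhomog).deriv_eq_of_memLp hξ (hL2.restrict _))

/-- The left side is the matrix element of the resolvent between the indicator functions of
`[M, M + 1]` and `[-M - 1, -M]`; the denominator is the outgoing trace at `M` of the solution which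
is outgoing at `-∞`. -/
theorem integral_eq_expAverage_sq_div (hV : Continuous V) (hM : 0 ≤ M) (hξ : 0 < ξ.im)
    (hw : SchrodingerEq (truncate V M) w h) (hL2 : MemLp w 2 volume)
    (hh : ∀ᵐ t, h t = (Icc M (M + 1)).indicator (fun _ => 1) t + ξ ^ 2 * w t)
    (he : IsSolOn (shiftedPotential V (ξ ^ 2)) e e' univ) (he0 : e (-M) = 1)
    (he0' : e' (-M) = -(Complex.I * ξ)) :
    ∫ x in (-M - 1)..(-M), w x = expAverage ξ ^ 2 / outgoingTrace ξ M e e' := by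
  have hξ0 : ξ ≠ 0 := fun h0 => by simp [h0] at hξ
  have hhomog : ∀ᵐ t, t < M → h t = ξ ^ 2 * w t := hh.mono fun t ht htM => by
    rw [ht, indicator_of_notMem fun hmem => htM.not_ge hmem.1, zero_add]
  obtain ⟨hleft, hexp⟩ := hw.eq_mul_exp_left_of_memLp hξ hL2
    (hhomog.mono fun t ht htM => ht (by linarith))
  obtain ⟨hwM, hwM'⟩ := (hw.isSolOn_Icc_of_truncate hV hhomog).eqOn
    (continuous_shiftedPotential hV _) ordConnected_Icc
    ((he.const_mul (w (-M))).mono (subset_univ _)) (left_mem_Icc.2 (by linarith))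
    (by simp [he0]) (by simp only [he0', hleft]; ring) (right_mem_Icc.2 (by linarith))
  have htrace : w (-M) * outgoingTrace ξ M e e' = expAverage ξ := by
    rw [← hw.trace_eq_expAverage_of_memLp hξ hL2 hh, hwM, hwM', outgoingTrace]
    ring
  have hne : outgoingTrace ξ M e e' ≠ 0 := fun h0 =>
    expAverage_ne_zero hξ.ne' (by rw [← htrace, h0, mul_zero])
  calc ∫ x in (-M - 1)..(-M), w x
      = ∫ x in (-M - 1)..(-M), w (-M) * Complex.exp (Complex.I * -ξ * (x - (-M : ℝ))) :=
        intervalIntegral.integral_congr fun x hx =>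
          hexp x ((uIcc_of_le (by linarith : -M - 1 ≤ -M) ▸ hx).2)
    _ = w (-M) * expAverage ξ := by
        rw [intervalIntegral.integral_const_mul, integral_exp_neg_eq_expAverage hξ0]
    _ = expAverage ξ ^ 2 / outgoingTrace ξ M e e' := by
        rw [eq_div_iff hne, mul_right_comm, htrace, sq]

end Resolvent

section Resonance

open Filter

variable {V : ℝ → ℝ} {u u' : ℝ → ℂ} {D : ℂ → ℂ} {x₀ x₁ z ξ : ℂ} {M κ k : ℝ}

theorem exists_isSolOn_outgoing_left (hV : Continuous V) (M : ℝ) : ∃ e e' : ℂ → ℝ → ℂ,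
    (∀ ξ, IsSolOn (shiftedPotential V (ξ ^ 2)) (e ξ) (e' ξ) univ ∧ e ξ (-M) = 1 ∧
      e' ξ (-M) = -(Complex.I * ξ)) ∧
    Differentiable ℂ fun ξ => outgoingTrace ξ M (e ξ) (e' ξ) := by
  let U : ℝ → ℝ := fun x => V (x - M)
  have hU : Continuous U := by fun_prop
  let cosine : ℂ → ℝ → ℂ := fun ξ => schrodingerSol U (ξ ^ 2) 1 0
  let sine : ℂ → ℝ → ℂ := fun ξ => schrodingerSol U (ξ ^ 2) 0 1
  let e : ℂ → ℝ → ℂ := fun ξ x => 1 * cosine ξ x + -(Complex.I * ξ) * sine ξ x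
  let e' : ℂ → ℝ → ℂ := fun ξ x =>
    1 * deriv (cosine ξ) x + -(Complex.I * ξ) * deriv (sine ξ) x
  refine ⟨fun ξ x => e ξ (x + M), fun ξ x => e' ξ (x + M), fun ξ => ?_, ?_⟩
  · obtain ⟨hcos, hcos0, hcos0'⟩ := schrodingerSol_spec hU (ξ ^ 2) 1 0
    obtain ⟨hsin, hsin0, hsin0'⟩ := schrodingerSol_spec hU (ξ ^ 2) 0 1
    refine ⟨((hcos.linear_comb hsin 1 (-(Complex.I * ξ))).comp_add_const M).congr_coeff
      fun x _ => by simp [shiftedPotential, U], ?_, ?_⟩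
    · simp [e, cosine, sine, hcos0, hsin0]
    · simp [e', cosine, sine, hcos0', hsin0']
  · have hsq : Differentiable ℂ fun ξ : ℂ => ξ ^ 2 := by fun_prop
    have hcos := differentiable_schrodingerSol hU 1 0 (M + M)
    have hsin := differentiable_schrodingerSol hU 0 1 (M + M)
    have hcos₀ : Differentiable ℂ fun ξ => cosine ξ (M + M) := hcos.1.comp hsq
    have hcos₁ : Differentiable ℂ fun ξ => deriv (cosine ξ) (M + M) := hcos.2.comp hsq
    have hsin₀ : Differentiable ℂ fun ξ => sine ξ (M + M) := hsin.1.comp hsq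
    have hsin₁ : Differentiable ℂ fun ξ => deriv (sine ξ) (M + M) := hsin.2.comp hsq
    simp only [outgoingTrace, e, e']
    fun_prop

theorem outgoingTrace_sqrt_eq_zero (hV : Continuous V)
    (hu : IsSolOn (shiftedPotential V z) u u' univ) (hne : u (-M) ≠ 0)
    (hright : u' M = Complex.I * Complex.sqrt z * u M)
    (hleft : u' (-M) = -(Complex.I * Complex.sqrt z * u (-M))) {e e' : ℝ → ℂ}
    (he : IsSolOn (shiftedPotential V z) e e' univ) (he0 : e (-M) = 1)
    (he0' : e' (-M) = -(Complex.I * Complex.sqrt z)) :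
    outgoingTrace (Complex.sqrt z) M e e' = 0 := by
  obtain ⟨huM, huM'⟩ := hu.eqOn (continuous_shiftedPotential hV z) ordConnected_univ
    (he.const_mul (u (-M))) (mem_univ (-M)) (by rw [he0, mul_one]) (by rw [he0', hleft]; ring)
    (mem_univ M)
  rw [huM, huM'] at hright
  refine (mul_eq_zero.1 (?_ : u (-M) * outgoingTrace (Complex.sqrt z) M e e' = 0)).resolve_left hne
  rw [outgoingTrace]
  linear_combination hright

theorem outgoingTrace_ne_zero (hV : Continuous V) (hM : 0 ≤ M) (hre : ξ.re ≠ 0) (him : 0 ≤ ξ.im)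
    {e e' : ℝ → ℂ} (he : IsSolOn (shiftedPotential V (ξ ^ 2)) e e' univ) (he0 : e (-M) = 1)
    (he0' : e' (-M) = -(Complex.I * ξ)) : outgoingTrace ξ M e e' ≠ 0 := fun htrace =>
  him.not_gt (im_neg_of_outgoing hV hre hM (he.mono (subset_univ _)) (sub_eq_zero.1 htrace)
    (by rw [he0', he0, mul_one]) ⟨-M, left_mem_Icc.2 (by linarith), by simp [he0]⟩)

theorem meromorphicOrderAt_inv_neg {U : Set ℂ} (hD : AnalyticOnNhd ℂ D U) (hU : IsPreconnected U)
    (hx₀ : x₀ ∈ U) (hx₁ : x₁ ∈ U) (h₀ : D x₀ = 0) (h₁ : D x₁ ≠ 0) :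
    meromorphicOrderAt D⁻¹ x₀ < 0 := by
  have hpos : 0 < analyticOrderAt D x₀ :=
    pos_iff_ne_zero.2 ((hD x₀ hx₀).analyticOrderAt_ne_zero.2 h₀)
  have hfin : analyticOrderAt D x₀ ≠ ⊤ := fun htop => h₁
    (hD.eqOn_zero_of_preconnected_of_eventuallyEq_zero hU hx₀ (analyticOrderAt_eq_top.1 htop) hx₁)
  obtain ⟨n, hn⟩ := ENat.ne_top_iff_exists.1 hfin
  rw [← hn, Nat.cast_pos] at hpos
  rw [meromorphicOrderAt_inv, (hD x₀ hx₀).meromorphicOrderAt_eq, ← hn, ENat.map_natCast,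
    ← WithTop.LinearOrderedAddCommGroup.coe_neg]
  exact_mod_cast (by simpa using hpos : -(n : ℤ) < 0)

/-- The indicator function of `[a, b]` as an element of `L²(ℝ)`; resolvent matrix elements are
tested against two of these. -/
def indicatorIcc (a b : ℝ) : Lp ℂ 2 (volume : Measure ℝ) :=
  indicatorConstLp 2 (measurableSet_Icc (a := a) (b := b)) measure_Icc_lt_top.ne 1

theorem coeFn_indicatorIcc (a b : ℝ) :
    indicatorIcc a b =ᵐ[volume] (Icc a b).indicator fun _ => (1 : ℂ) :=
  indicatorConstLp_coeFn

theorem hasBoundedSupport_indicatorIcc (a b : ℝ) : HasBoundedSupport (indicatorIcc a b) := by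
  refine ⟨max |a| |b|, (coeFn_indicatorIcc a b).mono fun x hx hlt => ?_⟩
  rw [hx, indicator_of_notMem fun hmem => hlt.not_ge (abs_le_max_abs_abs hmem.1 hmem.2)]

theorem inner_indicatorIcc {a b : ℝ} (hab : a ≤ b) {f : Lp ℂ 2 (volume : Measure ℝ)} {w : ℝ → ℂ}
    (hf : f =ᵐ[volume] w) : inner ℂ (indicatorIcc a b) f = ∫ x in a..b, w x := by
  rw [indicatorIcc, L2.inner_indicatorConstLp_one,
    setIntegral_congr_ae measurableSet_Icc (hf.mono fun x hx _ => hx),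
    integral_Icc_eq_integral_Ioc, ← intervalIntegral.integral_of_le hab]

theorem isResolventContinuation_truncate (hV : Continuous V) (hM : 0 ≤ M) {e e' : ℂ → ℝ → ℂ}
    (he : ∀ ξ, IsSolOn (shiftedPotential V (ξ ^ 2)) (e ξ) (e' ξ) univ ∧ e ξ (-M) = 1 ∧
      e' ξ (-M) = -(Complex.I * ξ))
    (hdiff : Differentiable ℂ fun ξ => outgoingTrace ξ M (e ξ) (e' ξ)) :
    IsResolventContinuation (truncate V M) (indicatorIcc M (M + 1)) (indicatorIcc (-M - 1) (-M))
      (expAverage ^ 2 * (fun ξ => outgoingTrace ξ M (e ξ) (e' ξ))⁻¹) := by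
  refine ⟨fun ξ => ((meromorphicAt_expAverage ξ).pow 2).mul (hdiff.analyticAt ξ).meromorphicAt.inv,
    fun ξ hξ R hR => ?_⟩
  set f := indicatorIcc M (M + 1) with hf
  obtain ⟨w, hRw, hw⟩ := (hR (R f) f).1 rfl
  have hsource : ∀ᵐ t, (f + ξ ^ 2 • R f : Lp ℂ 2 (volume : Measure ℝ)) t =
      (Icc M (M + 1)).indicator (fun _ => 1) t + ξ ^ 2 * w t := by
    filter_upwards [hRw, Lp.coeFn_add f (ξ ^ 2 • R f), Lp.coeFn_smul (ξ ^ 2) (R f),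
      coeFn_indicatorIcc M (M + 1)] with t hwt hadd hsmul hft
    rw [hadd, Pi.add_apply, hsmul, Pi.smul_apply, hwt, hf, hft, smul_eq_mul]
  rw [inner_indicatorIcc (by linarith) hRw, integral_eq_expAverage_sq_div hV hM hξ hw
    ((Lp.memLp (R f)).ae_eq hRw) hsource (he ξ).1 (he ξ).2.1 (he ξ).2.2]
  exact (div_eq_mul_inv _ _).symm

theorem isResonance_truncate (hV : Continuous V) (hM : 0 ≤ M)
    (hu : IsSolOn (shiftedPotential V z) u u' univ) (hne : u (-M) ≠ 0)
    (hright : u' M = Complex.I * Complex.sqrt z * u M)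
    (hleft : u' (-M) = -(Complex.I * Complex.sqrt z * u (-M))) (hz : (Complex.sqrt z).im ≠ 0) :
    IsResonance (truncate V M) z := by
  obtain ⟨e, e', he, hdiff⟩ := exists_isSolOn_outgoing_left hV M
  have hzero := outgoingTrace_sqrt_eq_zero hV hu hne hright hleft
    (sq_sqrt z ▸ (he (Complex.sqrt z)).1) (he _).2.1 (he _).2.2
  have hone := outgoingTrace_ne_zero hV hM (by simp) (by simp) (he 1).1 (he 1).2.1 (he 1).2.2
  have hsqrt : Complex.sqrt z ≠ 0 := fun h0 => hz (by simp [h0])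
  refine ⟨_, _, hasBoundedSupport_indicatorIcc _ _, hasBoundedSupport_indicatorIcc _ _, _,
    isResolventContinuation_truncate hV hM he hdiff, ?_⟩
  rw [meromorphicOrderAt_mul_of_ne_zero ((analyticAt_expAverage hsqrt).pow 2)
    (pow_ne_zero 2 (expAverage_ne_zero hz))]
  exact meromorphicOrderAt_inv_neg (fun ξ _ => hdiff.analyticAt ξ) isPreconnected_univ
    (mem_univ _) (mem_univ 1) hzero hone

theorem resonance_of_outgoingTrace_eq_zero (hV : Continuous V) (hM : 0 ≤ M)
    (hu : IsSolOn (shiftedPotential V z) u u' univ) (hne : ∀ x, u x ≠ 0 ∨ u' x ≠ 0) (hz : 0 < z.re)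
    (hright : outgoingTrace (Complex.sqrt z) M u u' = 0)
    (hleft : outgoingTrace (Complex.sqrt z) M (fun x => u (-x)) (fun x => -u' (-x)) = 0) :
    z.im < 0 ∧ IsResonance (truncate V M) z ∧ ∀ ψ, IsResonantState (truncate V M) z ψ ↔
      ∃ c : ℂ, c ≠ 0 ∧ ψ = c • outgoingExtension M z u := by
  rw [outgoingTrace, sub_eq_zero] at hright hleft
  rw [neg_eq_iff_eq_neg] at hleft
  have huM : u M ≠ 0 := fun h0 => (hne M).elim (· h0) (· (by rw [hright, h0, mul_zero]))
  have huM' : u (-M) ≠ 0 := fun h0 =>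
    (hne (-M)).elim (· h0) (· (by rw [hleft, h0, mul_zero, neg_zero]))
  have hre := sqrt_re_pos hz
  have him : (Complex.sqrt z).im < 0 := im_neg_of_outgoing hV hre.ne' hM
    (by rw [sq_sqrt]; exact hu.mono (subset_univ _)) hright hleft
    ⟨M, right_mem_Icc.2 (by linarith), huM⟩
  refine ⟨?_, isResonance_truncate hV hM hu huM' hright hleft him.ne,
    isResonantState_truncate_iff hV hM hu huM hright hleft⟩
  rw [← sq_sqrt z, sq, Complex.mul_im]
  nlinarith

theorem exists_eventually_norm_le_mul_exp {F : Type*} [Norm F] {f : ℝ → F}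
    (hf : f =O[atTop] fun M => M * decaySq κ M * decaySq κ M) :
    ∃ C : ℝ, 0 ≤ C ∧ ∀ᶠ M in atTop, ‖f M‖ ≤ C * (M * Real.exp (-4 * κ * M)) := by
  obtain ⟨C, hC, hbound⟩ := hf.exists_nonneg
  refine ⟨C, hC, ?_⟩
  filter_upwards [hbound.bound, eventually_ge_atTop 0] with M hfM hM
  have hexp : decaySq κ M * decaySq κ M = Real.exp (-4 * κ * M) := by
    rw [← Real.exp_add]; ring_nf
  rwa [mul_assoc, hexp, Real.norm_of_nonneg (mul_nonneg hM (Real.exp_nonneg _))] at hfM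

theorem mul_exp_le_exp (hk : k < κ) (M : ℝ) :
    M * Real.exp (-4 * κ * M) ≤ (4 * (κ - k))⁻¹ * Real.exp (-4 * k * M) := by
  have hgap : 0 < 4 * (κ - k) := by linarith
  have hM : M ≤ (4 * (κ - k))⁻¹ * Real.exp (4 * (κ - k) * M) := by
    rw [← div_eq_inv_mul, le_div_iff₀' hgap]
    linarith [Real.add_one_le_exp (4 * (κ - k) * M)]
  calc M * Real.exp (-4 * κ * M)
      ≤ (4 * (κ - k))⁻¹ * Real.exp (4 * (κ - k) * M) * Real.exp (-4 * κ * M) := by gcongr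
    _ = (4 * (κ - k))⁻¹ * Real.exp (-4 * k * M) := by
        rw [mul_assoc, ← Real.exp_add]; ring_nf

end Resonance

end

theorem mainTheorem6_general (V Vper Vdef : ℝ → ℝ) (ρ E : ℝ) (Φ : ℝ → ℂ)
    (hV : Continuous V) (hsum : ∀ x, V x = Vper x + Vdef x)
    (hper : ∀ x, Vper (x + 1) = Vper x)
    (hρ : 0 ≤ ρ) (hdef : ∀ x, ρ < |x| → Vdef x = 0)
    (hE : 0 < E) (hΦ : IsBoundState V E Φ) :
    ∃ κ : ℝ, 0 < κ ∧
      (∃ μ : ℂ, ‖μ‖ = Real.exp (-κ) ∧ ∀ x : ℝ, ρ ≤ x → Φ (x + 1) = μ * Φ x) ∧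
      ∃ (M₀ C : ℝ) (wstar zstar : ℝ → ℂ), ρ < M₀ ∧
        (∀ M : ℝ, M₀ ≤ M →
          0 < (zstar M).re ∧ (zstar M).im < 0 ∧
          IsResonance (truncate V M) (zstar M) ∧
          (∀ ψ : ℝ → ℂ, IsResonantState (truncate V M) (zstar M) ψ ↔
            ∃ c : ℂ, c ≠ 0 ∧
              ψ = c • outgoingExtension M (zstar M) (uSol V Φ (wstar M) (zstar M))) ∧
          corrDenom E M (uSol V Φ (wZero Φ) E) (vSol V Φ (wZero Φ) E) ≠ 0 ∧
          ‖zstar M - zApprox E M (uSol V Φ (wZero Φ) E) (vSol V Φ (wZero Φ) E)‖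
            ≤ C * (M * Real.exp (-4 * κ * M)) ∧
          ‖wstar M - wApprox (wZero Φ) E M (uSol V Φ (wZero Φ) E) (vSol V Φ (wZero Φ) E)‖
            ≤ C * (M * Real.exp (-4 * κ * M))) ∧
        ∀ k : ℝ, 0 < k → k < κ → ∃ C' : ℝ, ∀ M : ℝ, M₀ ≤ M →
          ‖zstar M - zApprox E M (uSol V Φ (wZero Φ) E) (vSol V Φ (wZero Φ) E)‖
            ≤ C' * Real.exp (-4 * k * M) ∧
          ‖wstar M - wApprox (wZero Φ) E M (uSol V Φ (wZero Φ) E) (vSol V Φ (wZero Φ) E)‖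
            ≤ C' * Real.exp (-4 * k * M) := by
  obtain ⟨hwZero, κ, hκ, hμ, ⟨_, _, hc, hR⟩, _, _, hc', hL⟩ := hΦ.exists_floquet_exponent hV hper
    (fun x hx => by rw [hsum, hdef x hx, add_zero]) hρ hE
  obtain ⟨wstar, zstar, hpar, hz, hw⟩ :=
    exists_resonance_parameters hV hE hκ hc hc' hwZero hR hL
  obtain ⟨C, hC, hbound⟩ := exists_eventually_norm_le_mul_exp (hz.prod_left hw)
  obtain ⟨M₀, hM₀⟩ := ((hpar.and hbound).and (Filter.eventually_gt_atTop ρ)).exists_forall_of_atTop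
  refine ⟨κ, hκ, hμ, M₀, C, wstar, zstar, (hM₀ M₀ le_rfl).2, fun M hM => ?_, fun k _ hk =>
    ⟨C * (4 * (κ - k))⁻¹, fun M hM => ?_⟩⟩
  · obtain ⟨⟨⟨hN, hre, hright, hleft⟩, herror⟩, hρM⟩ := hM₀ M hM
    obtain ⟨him, hres, hstates⟩ := resonance_of_outgoingTrace_eq_zero hV (hρ.trans hρM.le)
      (uSol_spec hV Φ (wstar M) (zstar M)).1
      (uSol_ne_zero_or_deriv_ne_zero hV Φ (wstar M) (zstar M)) hre hright hleft
    exact ⟨hre, him, hres, hstates, hN, norm_prod_le_iff.1 herror⟩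
  · refine norm_prod_le_iff.1 ((hM₀ M hM).1.2.trans ?_)
    exact (mul_le_mul_of_nonneg_left (mul_exp_le_exp hk M) hC).trans_eq (mul_assoc _ _ _).symm

theorem mainTheorem6 (V Vper Vdef : ℝ → ℝ) (ρ E : ℝ) (Φ : ℝ → ℂ)
    (hV : ContDiff ℝ ∞ V) (hsum : ∀ x, V x = Vper x + Vdef x)
    (hper : ∀ x, Vper (x + 1) = Vper x)
    (hρ : 0 ≤ ρ) (hdef : ∀ x, ρ < |x| → Vdef x = 0)
    (hE : 0 < E) (hΦ : IsBoundState V E Φ) :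
    ∃ κ : ℝ, 0 < κ ∧
      (∃ μ : ℂ, ‖μ‖ = Real.exp (-κ) ∧ ∀ x : ℝ, ρ ≤ x → Φ (x + 1) = μ * Φ x) ∧
      ∃ (M₀ C : ℝ) (wstar zstar : ℝ → ℂ), ρ < M₀ ∧
        (∀ M : ℝ, M₀ ≤ M →
          0 < (zstar M).re ∧ (zstar M).im < 0 ∧
          IsResonance (truncate V M) (zstar M) ∧
          (∀ ψ : ℝ → ℂ, IsResonantState (truncate V M) (zstar M) ψ ↔
            ∃ c : ℂ, c ≠ 0 ∧
              ψ = c • outgoingExtension M (zstar M) (uSol V Φ (wstar M) (zstar M))) ∧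
          corrDenom E M (uSol V Φ (wZero Φ) E) (vSol V Φ (wZero Φ) E) ≠ 0 ∧
          ‖zstar M - zApprox E M (uSol V Φ (wZero Φ) E) (vSol V Φ (wZero Φ) E)‖
            ≤ C * (M * Real.exp (-4 * κ * M)) ∧
          ‖wstar M - wApprox (wZero Φ) E M (uSol V Φ (wZero Φ) E) (vSol V Φ (wZero Φ) E)‖
            ≤ C * (M * Real.exp (-4 * κ * M))) ∧
        ∀ k : ℝ, 0 < k → k < κ → ∃ C' : ℝ, ∀ M : ℝ, M₀ ≤ M →
          ‖zstar M - zApprox E M (uSol V Φ (wZero Φ) E) (vSol V Φ (wZero Φ) E)‖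
            ≤ C' * Real.exp (-4 * k * M) ∧
          ‖wstar M - wApprox (wZero Φ) E M (uSol V Φ (wZero Φ) E) (vSol V Φ (wZero Φ) E)‖
            ≤ C' * Real.exp (-4 * k * M) :=
  mainTheorem6_general V Vper Vdef ρ E Φ hV.continuous hsum hper hρ hdef hE hΦ
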